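/- **Setting.** Let $\alpha\in[0,1)$, $\gamma\in(0,1)$, $z_s,q>0$, and $a_l=l^\alpha$, $b_l=l^\alpha(z_s+ql^{-\gamma})$ for $l\ge1$. Put $Q_l=\prod_{j=1}^{l-1}a_j/b_{j+1}$, $\omega_l(z)=z^lQ_l$, $\omega_l=\omega_l(z_s)$, $\varrho_s=\sum_{l\ge1}l\,\omega_l$, and fix a total mass $\varrho_0>\varrho_s$. With $\psi(a)=a\log a-a+1$ let $$\mathcal F(n)=\sum_{l\ge1}\omega_l\,\psi(n_l/\omega_l),\qquad \mathcal D(n)=\sum_{l\ge1}(a_ln_1n_l-b_{l+1}n_{l+1})\log\frac{a_ln_1n_l}{b_{l+1}n_{l+1}},$$ $$\mathcal A(n,\phi)=\sum_{l\ge1}k^l\hat n_l\,|\phi_{l+1}-\phi_l-\phi_1|^2,\quad k^l=a_l\omega_1\omega_l,\quad \hat n_l=\Lambda\Big(\tfrac{n_1n_l}{\omega_1\omega_l},\tfrac{n_{l+1}}{\omega_{l+1}}\Big),$$ where $\Lambda(a,b)=\int_0^1a^sb^{1-s}\,ds$ is the logarithmic mean, and let $\mathcal K(n)\phi=\sum_{l\ge1}k^l\hat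 n_l\,\big((e^1+e^l-e^{l+1})\cdot\phi\big)(e^1+e^l-e^{l+1})$. For $\varepsilon\in(0,1]$ put $\mathcal F^\varepsilon=z_s\varepsilon^{-\gamma}\mathcal F$, $\mathcal D^\varepsilon=z_s\varepsilon^{-(1-\alpha+2\gamma)}\mathcal D$, $\mathcal A^\varepsilon=z_s\varepsilon^{-(1-\alpha+2\gamma)}\mathcal A$. Let $x\in(0,\tfrac12)$ and $l_0=\lfloor\varepsilon^{-x}\rfloor$. The subscripts mic and mac mean that the sums defining $\mathcal F^\varepsilon$, $\mathcal D^\varepsilon$ are restricted to $1\le l\le l_0-1$ and to $l\ge l_0$, respectively. Put $$\mathcal H_{\rm mic}(n\mid\omega(z))=\sum_{l=1}^{l_0-1}\omega_l(z)\,\psi\big(n_l/\omega_l(z)\big).$$ Fix $K$. A *rescaled curve of finite action* on $[0,T]$ is a pair $t\mapsto(n^\varepsilon(t),\phi^\varepsilon(t))$ such that: $n^\varepsilon(t)\in[0,\infty)^{\mathbb N}$, $\sum_l l\,n^\varepsilon_l(t)=\varrho_0$ and $\mathcal F(n^\varepsilon(t))\le K\varepsilon^\gamma$ for all $t\in[0,T]$;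 each $n^\varepsilon_l$ is absolutely continuous; each $\phi^\varepsilon_l$ is measurable; the series for $\mathcal K(n^\varepsilon)\phi^\varepsilon$ converges absolutely for a.e. $t$, with components locally integrable in $(0,T)$; the equation $$\int_0^T\big(\dot\eta\,n_i^\varepsilon-\eta\,\varepsilon^{-(1-\alpha+\gamma)}(\mathcal K(n^\varepsilon)\phi^\varepsilon)_i\big)\,dt=0$$ holds for all $\eta\in C_c^1((0,T))$ and $i\ge1$; and $\sup_t\mathcal F^\varepsilon(n^\varepsilon(t))$, $\int_0^T\mathcal D^\varepsilon(n^\varepsilon)\,dt$, $\int_0^T\mathcal A^\varepsilon(n^\varepsilon,\phi^\varepsilon)\,dt$ are finite. For such a curve, $$\mathcal J^\varepsilon(n^\varepsilon)=\mathcal F^\varepsilon(n^\varepsilon(T))-\mathcal F^\varepsilon(n^\varepsilon(0))+\tfrac12\int_0^T\mathcal D^\varepsilon(n^\varepsilon)\,dt+\tfrac12\int_0^T\mathcal A^\varepsilon(n^\varepsilon,\phi^\varepsilon)\,dt.$$ Let $\nu^\varepsilon_t=\varepsilon^{-1}\sum_{l\ge l_0}n^\varepsilon_l(t)\,\delta_{\varepsilon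 l}$, and for a measure $\nu$ on $(0,\infty)$ let $E(\nu)=\frac q{1-\gamma}\int\lambda^{1-\gamma}\,\nu(d\lambda)$. **Theorem 2.5 (Quasistationary distribution).** There is a constant $C>0$ depending only on $\alpha,\gamma,z_s,q$, and for all $\varrho_0>\varrho_s$, $x\in(0,\tfrac12)$ and $K$ there is $\varepsilon_0>0$, such that the following holds. Let $T>0$, $S\subseteq(0,1]$, and let $(n^\varepsilon,\phi^\varepsilon)_{\varepsilon\in S}$ be rescaled curves of finite action on $[0,T]$ with $\sup_{\varepsilon\in S}\mathcal J^\varepsilon(n^\varepsilon)<\infty$ and $\int_{(R,\infty)}\lambda\,\nu^\varepsilon_0(d\lambda)\to0$ as $R\to\infty$, uniformly in $\varepsilon\in S$. Then: 1. for every $\varepsilon\in S$ with $\varepsilon<\varepsilon_0$, $$\int_0^T\mathcal H_{\rm mic}\big(n^\varepsilon(t)\mid\omega(n_1^\varepsilon(t))\big)\,dt\le C\,\varepsilon^{\gamma+(1-x)(1-\alpha+\gamma)}\int_0^T\mathcal D^\varepsilon_{\rm mic}(n^\varepsilon(t))\,dt;$$ 2. every sequence $\varepsilon_j\to0$ in $S$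 has a subsequence, not relabelled, for which there are measures $\nu_t$ on $(0,\infty)$, $t\in[0,T]$, with $\int\lambda\,d\nu_t=\varrho_0-\varrho_s$ and $\nu^{\varepsilon_j}_t\to\nu_t$ weakly* in $C_c^0((0,\infty))^*$ for all $t\in[0,T]$, and such that for a.e. $t\in(0,T)$ $$\lim_{j\to\infty}\mathcal F^{\varepsilon_j}_{\rm mic}(n^{\varepsilon_j}(t))=0\qquad\text{and}\qquad\lim_{j\to\infty}\mathcal F^{\varepsilon_j}_{\rm mac}(n^{\varepsilon_j}(t))=E(\nu_t).$$ -/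

import Mathlib

open MeasureTheory Filter Topology
open scoped ENNReal

noncomputable section

namespace BeckerDoring

/-! Conventions. A cluster state is a sequence `n : ℕ → ℝ`, where `n l` is the density of clusters
of size `l ≥ 1`; the entry `n 0` is never used. Nonnegative quantities which may be infinite
(entropies, dissipation, action) take values in `ℝ≥0∞`. -/

/-- The parameters of the rates `a_l = l^α`, `b_l = l^α (z_s + q l^{-γ})`, with
`α ∈ [0,1)`, `γ ∈ (0,1)`, `z_s, q > 0`. -/
structure Rates where
  α : ℝ
  γ : ℝ
  zs : ℝ
  q : ℝ
  α_nonneg : 0 ≤ α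
  α_lt_one : α < 1
  γ_pos : 0 < γ
  γ_lt_one : γ < 1
  zs_pos : 0 < zs
  q_pos : 0 < q

/-- `ψ(a) = a log a - a + 1` (so `ψ(0) = 1`). -/
def psi (a : ℝ) : ℝ := a * Real.log a - a + 1

/-- One summand `ω ψ(n/ω)` of the relative entropy, for `n, ω ≥ 0`; for `ω = 0` it is `0` if
`n = 0` and `+∞` otherwise. -/
def entropyTerm (n ω : ℝ) : ℝ≥0∞ :=
  if ω = 0 then (if n = 0 then 0 else ⊤) else ENNReal.ofReal (ω * psi (n / ω))

/-- The relative entropy of `n` with respect to `ω`, with summation restricted to cluster sizes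
in `I`. -/
def relEntropyOn (I : Set ℕ) (n ω : ℕ → ℝ) : ℝ≥0∞ := ∑' l : I, entropyTerm (n l) (ω l)

/-- The logarithmic mean `Λ(a,b) = ∫₀¹ a^s b^{1-s} ds` of `a, b ≥ 0`; it vanishes if one of the
arguments does. -/
def logMean (a b : ℝ) : ℝ :=
  if a = b then a else if a = 0 ∨ b = 0 then 0 else (a - b) / (Real.log a - Real.log b)

/-- `(a - b)(log a - log b)` for `a, b ≥ 0`; it is `+∞` if exactly one of `a, b` is zero, and `0`
if both are. -/
def dissipationTerm (a b : ℝ) : ℝ≥0∞ :=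
  if a = b then 0 else if a = 0 ∨ b = 0 then ⊤
    else ENNReal.ofReal ((a - b) * (Real.log a - Real.log b))

/-- `∇_l φ = φ_{l+1} - φ_l - φ_1`. -/
def nabla (φ : ℕ → ℝ) (l : ℕ) : ℝ := φ (l + 1) - φ l - φ 1

/-- The vector `e^1 + e^l - e^{l+1}` of the `l`-th reaction, for `l ≥ 1`. -/
def reactionVec (l i : ℕ) : ℝ :=
  (if i = 1 then 1 else 0) + (if i = l then 1 else 0) - (if i = l + 1 then 1 else 0)

/-- The cut-off `l_0 = ⌊ε^{-x}⌋` between small and large clusters. -/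
def cutoff (x ε : ℝ) : ℕ := ⌊ε ^ (-x)⌋₊

/-- The cluster sizes `{1, …, l_0 - 1}`. -/
def micSizes (x ε : ℝ) : Set ℕ := Set.Ico 1 (cutoff x ε)

/-- The cluster sizes `{l_0, l_0 + 1, …}`. -/
def macSizes (x ε : ℝ) : Set ℕ := Set.Ici (cutoff x ε)

/-- The macroscopic empirical measure `ν^ε = ε⁻¹ ∑_{l ≥ l_0} n_l δ_{εl}`. -/
def macMeasure (x ε : ℝ) (n : ℕ → ℝ) : Measure ℝ :=
  Measure.sum fun l : macSizes x ε => ENNReal.ofReal (n l / ε) • Measure.dirac (ε * (l : ℕ))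

/-- Weak* convergence in `C_c^0(ℝ_+)^*`, `ℝ_+ = (0,∞)`: test functions are continuous with
compact support in `(0,∞)`. -/
def WeakStarTendsto (μ : ℕ → Measure ℝ) (ν : Measure ℝ) : Prop :=
  ∀ ζ : ℝ → ℝ, Continuous ζ → HasCompactSupport ζ → tsupport ζ ⊆ Set.Ioi 0 →
    Tendsto (fun k => ∫ y, ζ y ∂(μ k)) atTop (𝓝 (∫ y, ζ y ∂ν))

/-- The macroscopic state space: measures on `(0,∞)` with first moment `ρ`. -/
def IsMacroState (ρ : ℝ) (ν : Measure ℝ) : Prop :=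
  ν (Set.Iic 0) = 0 ∧ ∫⁻ y, ENNReal.ofReal y ∂ν = ENNReal.ofReal ρ

namespace Rates

variable (P : Rates)

/-- Coagulation rates `a_l`. -/
def a (l : ℕ) : ℝ := (l : ℝ) ^ P.α

/-- Fragmentation rates `b_l`. -/
def b (l : ℕ) : ℝ := (l : ℝ) ^ P.α * (P.zs + P.q * (l : ℝ) ^ (-P.γ))

/-- `Q_l = ∏_{j=1}^{l-1} a_j / b_{j+1}`. -/
def Q (l : ℕ) : ℝ := ∏ j ∈ Finset.Ico 1 l, P.a j / P.b (j + 1)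

/-- The equilibria `ω_l(z) = z^l Q_l`. -/
def ω (z : ℝ) (l : ℕ) : ℝ := z ^ l * P.Q l

/-- The critical mass `ϱ_s = ∑_{l ≥ 1} l z_s^l Q_l` (a convergent series for these rates). -/
def criticalMass : ℝ := ∑' l : ℕ, (l : ℝ) * P.ω P.zs l

/-- The equilibrium fluxes `k^l = a_l ω_1 ω_l` at `z = z_s`. -/
def k (l : ℕ) : ℝ := P.a l * P.ω P.zs 1 * P.ω P.zs l

/-- `n̂_l^ω = Λ(n_1 n_l / (ω_1 ω_l), n_{l+1} / ω_{l+1})`, with `ω = ω(z_s)`. -/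
def nHat (n : ℕ → ℝ) (l : ℕ) : ℝ :=
  logMean (n 1 * n l / (P.ω P.zs 1 * P.ω P.zs l)) (n (l + 1) / P.ω P.zs (l + 1))

/-- The Onsager operator
`K(n) φ = ∑_{l ≥ 1} k^l n̂_l ((e^1 + e^l - e^{l+1}) · φ) (e^1 + e^l - e^{l+1})`. -/
def onsager (n φ : ℕ → ℝ) (i : ℕ) : ℝ :=
  ∑' l : Set.Ici 1, P.k l * P.nHat n l * (-nabla φ l) * reactionVec l i

/-- The free energy `F(n) = H(n | ω(z_s))`, with summation restricted to sizes in `I`. -/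
def freeEnergyOn (I : Set ℕ) (n : ℕ → ℝ) : ℝ≥0∞ := relEntropyOn I n (P.ω P.zs)

/-- The dissipation `∑ (a_l n_1 n_l - b_{l+1} n_{l+1}) (log a_l n_1 n_l - log b_{l+1} n_{l+1})`,
with summation restricted to `I`. -/
def dissipationOn (I : Set ℕ) (n : ℕ → ℝ) : ℝ≥0∞ :=
  ∑' l : I, dissipationTerm (P.a l * n 1 * n l) (P.b (l + 1) * n (l + 1))

/-- The action `A(n,φ) = ∑_{l ≥ 1} k^l n̂_l |∇_l φ|²`. -/
def action (n φ : ℕ → ℝ) : ℝ≥0∞ :=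
  ∑' l : Set.Ici 1, ENNReal.ofReal (P.k l * P.nHat n l * nabla φ l ^ 2)

/-- The rescaled free energy `F^ε = z_s ε^{-γ} F`, restricted to sizes in `I`. -/
def freeEnergyResc (ε : ℝ) (I : Set ℕ) (n : ℕ → ℝ) : ℝ≥0∞ :=
  ENNReal.ofReal (P.zs * ε ^ (-P.γ)) * P.freeEnergyOn I n

/-- The rescaled dissipation `D^ε = z_s ε^{-(1-α+2γ)} D`, restricted to sizes in `I`. -/
def dissipationResc (ε : ℝ) (I : Set ℕ) (n : ℕ → ℝ) : ℝ≥0∞ :=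
  ENNReal.ofReal (P.zs * ε ^ (-(1 - P.α + 2 * P.γ))) * P.dissipationOn I n

/-- The rescaled action `A^ε = z_s ε^{-(1-α+2γ)} A`. The rescaled covector `w` of the continuous
description is given by `z_s⁻¹ ε^γ w(εl) = ∇_l φ`. -/
def actionResc (ε : ℝ) (n φ : ℕ → ℝ) : ℝ≥0∞ :=
  ENNReal.ofReal (P.zs * ε ^ (-(1 - P.α + 2 * P.γ))) * P.action n φ

/-- The rescaled Onsager operator `ε^{-(1-α+γ)} K(n) φ`. -/
def onsagerResc (ε : ℝ) (n φ : ℕ → ℝ) (i : ℕ) : ℝ :=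
  ε ^ (-(1 - P.α + P.γ)) * P.onsager n φ i

/-- The restricted state space: nonnegative states of total mass `ρ₀` whose free energy is of
order `ε^γ`, with constant `K`. -/
structure IsState (ρ₀ K ε : ℝ) (n : ℕ → ℝ) : Prop where
  nonneg : ∀ l, 1 ≤ l → 0 ≤ n l
  mass : HasSum (fun l : ℕ => (l : ℝ) * n l) ρ₀
  energy : P.freeEnergyOn (Set.Ici 1) n ≤ ENNReal.ofReal (K * ε ^ P.γ)

/-- Rescaled curves of finite action on `[0,T]`. -/
structure IsRescaledCurve (ρ₀ K T ε : ℝ) (n φ : ℝ → ℕ → ℝ) : Prop where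
  state : ∀ t ∈ Set.Icc 0 T, P.IsState ρ₀ K ε (n t)
  absCont : ∀ l, 1 ≤ l → AbsolutelyContinuousOnInterval (fun t => n t l) 0 T
  measurable_covector : ∀ l, 1 ≤ l →
    AEMeasurable (fun t => φ t l) (volume.restrict (Set.Icc 0 T))
  /-- The series defining `K(n(t)) φ(t)` converges. -/
  covector : ∀ᵐ t ∂(volume.restrict (Set.Icc 0 T)),
    Summable fun l : Set.Ici 1 => P.k l * P.nHat (n t) l * nabla (φ t) l
  locallyIntegrable : ∀ i, 1 ≤ i →
    LocallyIntegrableOn (fun t => P.onsagerResc ε (n t) (φ t) i) (Set.Ioo 0 T)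
  /-- The rescaled continuity equation in weak form. -/
  continuityEq : ∀ i, 1 ≤ i → ∀ η : ℝ → ℝ, ContDiff ℝ 1 η → HasCompactSupport η →
    tsupport η ⊆ Set.Ioo 0 T →
    ∫ t in Set.Ioo 0 T, (deriv η t * n t i - η t * P.onsagerResc ε (n t) (φ t) i) = 0
  finite_energy : ⨆ t ∈ Set.Icc 0 T, P.freeEnergyResc ε (Set.Ici 1) (n t) < ⊤
  finite_action : ∫⁻ t in Set.Icc 0 T, P.actionResc ε (n t) (φ t) < ⊤
  finite_dissipation : ∫⁻ t in Set.Icc 0 T, P.dissipationResc ε (Set.Ici 1) (n t) < ⊤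

/-- `J^ε = F^ε(n(T)) - F^ε(n(0)) + ½ ∫ D^ε(n) dt + ½ ∫ A^ε(n,φ) dt`; all four terms are finite
for rescaled curves of finite action. -/
def gradFunctional (T ε : ℝ) (n φ : ℝ → ℕ → ℝ) : ℝ :=
  (P.freeEnergyResc ε (Set.Ici 1) (n T)).toReal - (P.freeEnergyResc ε (Set.Ici 1) (n 0)).toReal
    + 1 / 2 * (∫⁻ t in Set.Icc 0 T, P.dissipationResc ε (Set.Ici 1) (n t)).toReal
    + 1 / 2 * (∫⁻ t in Set.Icc 0 T, P.actionResc ε (n t) (φ t)).toReal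

/-- The macroscopic energy `E(ν) = q/(1-γ) ∫ λ^{1-γ} dν`. -/
def macEnergy (ν : Measure ℝ) : ℝ≥0∞ :=
  ENNReal.ofReal (P.q / (1 - P.γ)) * ∫⁻ y in Set.Ioi 0, ENNReal.ofReal (y ^ (1 - P.γ)) ∂ν

end Rates

end BeckerDoring

end

noncomputable section

namespace BeckerDoring

/-! The equilibrium satisfies `-log ω_l ∼ c l^{1-γ}` with `c = q / (z_s (1-γ))`
(`tendsto_neg_log_ω_div`), so it has stretched exponential moments. Since the relative entropy with
respect to `ω(z_s)` is `O(ε^γ)`, Fenchel duality (`IsState.sum_mul_le`) bounds linear functionals of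
a state. The choice of test sequence gives closeness of `n_1` to `z_s`, closeness of the mass below
the cut-off `l_0` to `ϱ_s`, and `∑ l^{1-γ} n_l = O(ε^γ)` above it.

Assertion 1 is a logarithmic Sobolev inequality for a single state, integrated in time. With `f_l =
n_l / ω_l(n_1)` the dissipation is a Dirichlet form of `f`, and `f_1 = 1`. A discrete Hardy argument
(`psiMaj_sub_le`, `sum_mul_le_of_step`) applies because the tails of `ω(n_1)` are at most a multiple
of `l^γ ω_l(n_1)` up to `l_0` (`exists_sum_ω_le`). This needs `n_1 - z_s` to be below a small
multiple of `l_0^{-γ}`, which the energy bound provides for `x < 1/2`. The total loss is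
`l^{1-α+γ}`, at most `ε^{-x(1-α+γ)}` below the cut-off.

For assertion 2, the mass distributions `ϱ₀⁻¹ ∑ l n_l δ_{εl}` are probability measures. The
continuity equation and the action bound make their integrals against piecewise linear functions
equicontinuous in time and keep mass from escaping to infinity. An Arzelà–Ascoli argument gives
limits `μ_t` along one subsequence for all `t`. Exactly the mass `ϱ_s` concentrates at the origin,
and `ν_t` is `ϱ₀ y⁻¹ μ_t` on `(0,∞)`.

The entropy of large clusters is asymptotically `E(ν^ε)`, because `ω_l ψ(n_l/ω_l)` is `-n_l log ω_l`
up to small errors. The difficulty is that `E` is the integral of the unbounded function `y^{-γ}`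
against the mass, so energy could be lost at `y = 0`. Two tests of the reaction fluxes exclude this,
with `D` denoting the rescaled dissipation at the given time. As `ϱ₀ > ϱ_s`, some mass stays at
sizes of order `1/ε`, and a plateau weight gives `|n_1 - z_s| ≤ C ε^γ (1 + D)`
(`exists_abs_sub_zs_le`). A ramp weight then makes the surplus fragmentation `q l^{-γ}` control `∑
l^{1-γ} n_l` over `l_0 ≤ l ≤ δ/ε` by `ε^γ ((1 + D) δ^{γ/2} + ε^{x(1-γ)})`
(`exists_sum_rpow_mul_le_dissipation`). The bound on `n_1` also handles the small clusters: their
energy is the entropy relative to `ω(n_1)` plus at most `|log(n_1/z_s)|` times a vanishing mass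
deviation.

Since `D` is bounded only in `L¹` in time, these errors are removed by a diagonal choice in which
the truncation scale shrinks geometrically; this yields convergence for almost every `t`
(`IsBoundedSeq.exists_subseq_ae_tendsto`). -/

/-! ### Elementary inequalities for `psi`, `logMean` and `dissipationTerm` -/

/-- Fenchel's inequality for `psi` and `exp`. -/
lemma mul_le_psi_add (a y : ℝ) (ha : 0 ≤ a) : a * y ≤ psi a + (Real.exp y - 1) := by
  unfold psi
  rcases ha.eq_or_lt with rfl | ha
  · simpa using (Real.exp_pos y).le
  · have h := Real.add_one_le_exp (y - Real.log a)
    rw [Real.exp_sub, Real.exp_log ha, le_div_iff₀ ha] at h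
    nlinarith

lemma psi_nonneg {a : ℝ} (ha : 0 ≤ a) : 0 ≤ psi a := by
  simpa using mul_le_psi_add a 0 ha

lemma mul_le_mul_psi_add {n ω : ℝ} (hn : 0 ≤ n) (hω : 0 < ω) (y : ℝ) :
    n * y ≤ ω * psi (n / ω) + ω * (Real.exp y - 1) := by
  have h := mul_le_mul_of_nonneg_left (mul_le_psi_add (n / ω) y (div_nonneg hn hω.le)) hω.le
  have e : ω * (n / ω * y) = n * y := by field_simp
  rw [e] at h
  linarith

lemma psi_le_sq {a : ℝ} (ha : 0 ≤ a) : psi a ≤ (a - 1) ^ 2 := by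
  unfold psi
  rcases ha.eq_or_lt with rfl | ha
  · simp
  · have := Real.log_le_sub_one_of_pos ha
    nlinarith

lemma psi_exp (g : ℝ) : psi (Real.exp g) = Real.exp g * (g - 1) + 1 := by
  simp [psi]; ring

/-- For `a = exp g ≥ 1` one has `a (log a)² ≤ 2 (1 + log a) ψ(a)`. -/
lemma exp_mul_sq_le {g : ℝ} (hg : 0 ≤ g) :
    Real.exp g * g ^ 2 ≤ 2 * (1 + g) * psi (Real.exp g) := by
  rw [psi_exp]
  have e1 : 1 + g + g ^ 2 / 2 ≤ Real.exp g := Real.quadratic_le_exp_of_nonneg hg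
  -- Expanded, the claim reads `e^g (2 - g²) ≤ 2 + 2g`, which has content only for `g² ≤ 2`.
  by_cases h : g ^ 2 ≤ 2
  · have h2 : Real.exp g * (2 - g ^ 2) ≤ 2 + 2 * g := by
      have key : ∀ y : ℝ, 0 ≤ y → 0 ≤ (y ^ 2 - 2) * Real.exp y + 2 + 2 * y := by
        have mono : MonotoneOn (fun y : ℝ => (y ^ 2 - 2) * Real.exp y + 2 + 2 * y) (Set.Ici 0) := by
          apply monotoneOn_of_deriv_nonneg (convex_Ici 0)
          · fun_prop
          · fun_prop
          · intro y hy
            rw [interior_Ici, Set.mem_Ioi] at hy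
            have hder : HasDerivAt (fun y : ℝ => (y ^ 2 - 2) * Real.exp y + 2 + 2 * y)
                ((2 * y) * Real.exp y + (y ^ 2 - 2) * Real.exp y + 2) y := by
              have h1 : HasDerivAt (fun y : ℝ => y ^ 2 - 2) (2 * y) y := by
                simpa using (hasDerivAt_pow 2 y).sub_const 2
              have h2 := (h1.mul (Real.hasDerivAt_exp y)).add_const 2
              have h3 : HasDerivAt (fun y : ℝ => 2 * y) 2 y := by
                simpa using (hasDerivAt_id y).const_mul 2
              exact h2.add h3
            rw [hder.deriv]
            by_cases h4 : 2 ≤ y ^ 2 + 2 * y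
            · nlinarith [Real.exp_pos y]
            · have h5 : Real.exp y * (1 - y) ≤ 1 := by
                have := Real.add_one_le_exp (-y)
                have h6 : Real.exp y * Real.exp (-y) = 1 := by rw [← Real.exp_add]; simp
                nlinarith [Real.exp_pos y]
              nlinarith [Real.exp_pos y]
        intro y hy
        have := mono (Set.mem_Ici.2 le_rfl) (Set.mem_Ici.2 hy) hy
        simpa using this
      nlinarith [key g hg]
    nlinarith
  · push Not at h
    nlinarith [Real.exp_pos g]

lemma log_sub_log_ge {a b : ℝ} (ha : 0 < a) (hb : 0 < b) :
    (a - b) / a ≤ Real.log a - Real.log b := by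
  have h := Real.log_le_sub_one_of_pos (div_pos hb ha)
  rw [Real.log_div hb.ne' ha.ne'] at h
  have : (a - b) / a = 1 - b / a := by field_simp
  linarith

lemma logMean_comm (a b : ℝ) : logMean a b = logMean b a := by
  unfold logMean
  by_cases h : a = b
  · simp [h]
  · rw [if_neg h, if_neg (Ne.symm h)]
    by_cases h0 : a = 0 ∨ b = 0
    · rw [if_pos h0, if_pos h0.symm]
    · rw [if_neg h0, if_neg (fun h => h0 h.symm), ← neg_sub b a, ← neg_sub (Real.log b), neg_div_neg_eq]

lemma logMean_mem {a b : ℝ} (ha : 0 ≤ a) (hb : 0 ≤ b) : 0 ≤ logMean a b ∧ logMean a b ≤ a + b := by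
  wlog hab : b ≤ a generalizing a b
  · rw [logMean_comm, add_comm]
    exact this hb ha (le_of_not_ge hab)
  unfold logMean
  split_ifs with h1 h2
  · exact ⟨ha, by linarith⟩
  · exact ⟨le_rfl, by linarith⟩
  · push Not at h2
    have ha' := lt_of_le_of_ne ha h2.1.symm
    have hb' := lt_of_le_of_ne hb h2.2.symm
    have hlt : b < a := lt_of_le_of_ne hab (Ne.symm h1)
    have hl : 0 < Real.log a - Real.log b := sub_pos.2 (Real.log_lt_log hb' hlt)
    refine ⟨div_nonneg (by linarith) hl.le, ?_⟩
    have := log_sub_log_ge ha' hb'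
    rw [div_le_iff₀ hl]
    rw [div_le_iff₀ ha'] at this
    nlinarith

lemma logMean_nonneg {a b : ℝ} (ha : 0 ≤ a) (hb : 0 ≤ b) : 0 ≤ logMean a b := (logMean_mem ha hb).1

lemma logMean_le {a b : ℝ} (ha : 0 ≤ a) (hb : 0 ≤ b) : logMean a b ≤ a + b := (logMean_mem ha hb).2

lemma sub_mul_log_sub_nonneg {a b : ℝ} (ha : 0 < a) (hb : 0 < b) :
    0 ≤ (a - b) * (Real.log a - Real.log b) := by
  rcases le_total a b with h | h
  · exact mul_nonneg_of_nonpos_of_nonpos (by linarith) (by linarith [Real.log_le_log ha h])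
  · exact mul_nonneg (by linarith) (by linarith [Real.log_le_log hb h])

/-- A finite `dissipationTerm` controls the squared difference of its arguments. -/
lemma sq_sub_le_dissipationTerm {a b : ℝ} (ha : 0 ≤ a) (hb : 0 ≤ b)
    (h : dissipationTerm a b ≠ ⊤) :
    (a - b) ^ 2 ≤ (a + b) * (dissipationTerm a b).toReal := by
  unfold dissipationTerm at h ⊢
  split_ifs at h ⊢ with h1 h2
  · simp [h1]
  · exact absurd rfl h
  · push Not at h2
    have ha' := lt_of_le_of_ne ha h2.1.symm
    have hb' := lt_of_le_of_ne hb h2.2.symm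
    rw [ENNReal.toReal_ofReal (sub_mul_log_sub_nonneg ha' hb')]
    have key : ∀ {a b : ℝ}, 0 < a → 0 < b → b ≤ a →
        (a - b) ^ 2 ≤ (a + b) * ((a - b) * (Real.log a - Real.log b)) := by
      intro a b ha hb hab
      have h3 := log_sub_log_ge ha hb
      rw [div_le_iff₀ ha] at h3
      have h5 : 0 ≤ Real.log a - Real.log b := by linarith [Real.log_le_log hb hab]
      nlinarith [mul_nonneg (sub_nonneg.2 hab) (mul_nonneg hb.le h5),
        mul_le_mul_of_nonneg_left h3 (sub_nonneg.2 hab)]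
    rcases le_total b a with hab | hab
    · exact key ha' hb' hab
    · have := key hb' ha' hab
      nlinarith

/-- Young's inequality: the product of the two summands on the right dominates the square of the
left side. The free `τ` distributes powers of `ε` between mobility and dissipation and is tuned
separately in each flux estimate. -/
lemma abs_mul_sub_le_dissipationTerm {a b : ℝ} (ha : 0 ≤ a) (hb : 0 ≤ b)
    (h : dissipationTerm a b ≠ ⊤) (χ : ℝ) {τ : ℝ} (hτ : 0 < τ) :
    |χ * (a - b)| ≤ τ * χ ^ 2 * (a + b) + (dissipationTerm a b).toReal / τ := by
  have h1 := sq_sub_le_dissipationTerm ha hb h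
  set d := (dissipationTerm a b).toReal with hd
  have hd0 : 0 ≤ d := ENNReal.toReal_nonneg
  have hs : 0 ≤ τ * χ ^ 2 * (a + b) := by positivity
  have hq : 0 ≤ d / τ := by positivity
  apply abs_le_of_sq_le_sq _ (by linarith)
  have h2 : (χ * (a - b)) ^ 2 ≤ (τ * χ ^ 2 * (a + b)) * (d / τ) := by
    have : (τ * χ ^ 2 * (a + b)) * (d / τ) = χ ^ 2 * ((a + b) * d) := by field_simp
    rw [this, mul_pow]
    exact mul_le_mul_of_nonneg_left h1 (sq_nonneg _)
  nlinarith

namespace Rates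

variable (P : Rates)

/-! ### The equilibria -/

lemma a_pos {l : ℕ} (hl : 1 ≤ l) : 0 < P.a l :=
  Real.rpow_pos_of_pos (by exact_mod_cast hl) _

lemma a_nonneg (l : ℕ) : 0 ≤ P.a l := Real.rpow_nonneg (Nat.cast_nonneg l) _

lemma b_nonneg (l : ℕ) : 0 ≤ P.b l := by
  have := P.zs_pos
  have := P.q_pos
  unfold b
  positivity

lemma b_pos {l : ℕ} (hl : 1 ≤ l) : 0 < P.b l := by
  have h : (0 : ℝ) < l := by exact_mod_cast hl
  have := P.zs_pos
  have := P.q_pos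
  unfold b
  positivity

lemma Q_pos (l : ℕ) : 0 < P.Q l :=
  Finset.prod_pos fun j hj => div_pos (P.a_pos (Finset.mem_Ico.1 hj).1) (P.b_pos (by omega))

lemma ω_pos {z : ℝ} (hz : 0 < z) (l : ℕ) : 0 < P.ω z l := mul_pos (pow_pos hz l) (P.Q_pos l)

lemma ω_one (z : ℝ) : P.ω z 1 = z := by simp [ω, Q]

/-- Detailed balance, for every fugacity `z`. All comparisons between consecutive sizes rest on it.
-/
lemma b_mul_ω_succ (z : ℝ) {l : ℕ} (hl : 1 ≤ l) :
    P.b (l + 1) * P.ω z (l + 1) = z * P.a l * P.ω z l := by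
  have hb := (P.b_pos (l := l + 1) (by omega)).ne'
  unfold ω Q
  rw [Finset.prod_Ico_succ_top hl]
  field_simp
  ring

lemma b_succ (l : ℕ) : P.b l = P.a l * (P.zs + P.q * (l : ℝ) ^ (-P.γ)) := rfl

lemma ω_eq_mul_div_pow {z : ℝ} (l : ℕ) : P.ω z l = P.ω P.zs l * (z / P.zs) ^ l := by
  have := P.zs_pos.ne'
  unfold ω
  rw [div_pow]
  field_simp

/-- The decay rate of `ω_l ≈ exp (- c l^{1-γ})`. -/
def decay : ℝ := P.q / (P.zs * (1 - P.γ))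

lemma decay_pos : 0 < P.decay :=
  div_pos P.q_pos (mul_pos P.zs_pos (by linarith [P.γ_lt_one]))

/-- The logarithm of detailed balance at `z_s`. The first summand is `O(1/l)`; the second is of
order `l^{-γ}` and dominates because `γ < 1`. -/
lemma neg_log_ω_succ_sub {l : ℕ} (hl : 1 ≤ l) :
    -Real.log (P.ω P.zs (l + 1)) - -Real.log (P.ω P.zs l)
      = P.α * (Real.log ((l : ℝ) + 1) - Real.log l)
        + Real.log (1 + P.q / P.zs * ((l : ℝ) + 1) ^ (-P.γ)) := by
  have hz := P.zs_pos
  have hq := P.q_pos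
  have hl' : (0 : ℝ) < l := by exact_mod_cast hl
  have h := P.b_mul_ω_succ P.zs hl
  have hu : 0 < 1 + P.q / P.zs * ((l : ℝ) + 1) ^ (-P.γ) := by positivity
  have e : P.b (l + 1) = ((l : ℝ) + 1) ^ P.α * (P.zs * (1 + P.q / P.zs * ((l : ℝ) + 1) ^ (-P.γ))) := by
    unfold b
    push_cast
    field_simp
  have h2 := congrArg Real.log h
  rw [Real.log_mul (P.b_pos (by omega)).ne' (P.ω_pos hz _).ne',
    Real.log_mul (mul_pos hz (P.a_pos hl)).ne' (P.ω_pos hz _).ne',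
    Real.log_mul hz.ne' (P.a_pos hl).ne', e, Real.log_mul (by positivity) (by positivity),
    Real.log_mul hz.ne' hu.ne', Real.log_rpow (by positivity)] at h2
  have h3 : Real.log (P.a l) = P.α * Real.log l := by
    unfold a; rw [Real.log_rpow hl']
  rw [h3] at h2
  linarith

/-- By homogeneity this is the difference quotient of `y ↦ y^β` at `1` with step `1/(m+1)`. -/
lemma tendsto_mul_rpow_succ_sub (β : ℝ) :
    Tendsto (fun m : ℕ => ((m : ℝ) + 1) ^ (1 - β) * (((m : ℝ) + 1 + 1) ^ β - ((m : ℝ) + 1) ^ β))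
      atTop (𝓝 β) := by
  have hd : HasDerivAt (fun y : ℝ => y ^ β) (β * 1 ^ (β - 1)) 1 :=
    Real.hasDerivAt_rpow_const (Or.inl one_ne_zero)
  rw [Real.one_rpow, mul_one] at hd
  have h := hd.tendsto_slope_zero_right
  have hm : Tendsto (fun m : ℕ => ((m : ℝ) + 1)⁻¹) atTop (𝓝[>] 0) := by
    refine tendsto_nhdsWithin_iff.2 ⟨?_, Eventually.of_forall fun m => by
      have : (0 : ℝ) < (m : ℝ) + 1 := by positivity
      exact Set.mem_Ioi.2 (inv_pos.2 this)⟩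
    exact tendsto_inv_atTop_zero.comp
      (tendsto_atTop_add_const_right _ 1 tendsto_natCast_atTop_atTop)
  refine (h.comp hm).congr fun m => ?_
  have hp : (0 : ℝ) < (m : ℝ) + 1 := by positivity
  simp only [Function.comp, inv_inv, smul_eq_mul, Real.one_rpow]
  have e : (1 : ℝ) + ((m : ℝ) + 1)⁻¹ = ((m : ℝ) + 1 + 1) / ((m : ℝ) + 1) := by field_simp
  rw [e, Real.div_rpow (by positivity) hp.le, Real.rpow_sub hp, Real.rpow_one]
  have := Real.rpow_pos_of_pos hp β
  field_simp

lemma tendsto_natCast_add_rpow_neg {β : ℝ} (hβ : 0 < β) (c : ℝ) :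
    Tendsto (fun m : ℕ => ((m : ℝ) + c) ^ (-β)) atTop (𝓝 0) :=
  (tendsto_rpow_neg_atTop hβ).comp (tendsto_atTop_add_const_right _ c tendsto_natCast_atTop_atTop)

lemma tendsto_mul_neg_log_ω_succ_sub :
    Tendsto (fun m : ℕ => ((m : ℝ) + 1) ^ P.γ *
      (P.α * (Real.log ((m : ℝ) + 1 + 1) - Real.log ((m : ℝ) + 1))
        + Real.log (1 + P.q / P.zs * ((m : ℝ) + 1 + 1) ^ (-P.γ)))) atTop (𝓝 (P.q / P.zs)) := by
  have hz := P.zs_pos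
  have hq := P.q_pos
  have h1 : Tendsto (fun m : ℕ => P.α * (((m : ℝ) + 1) ^ P.γ *
      (Real.log ((m : ℝ) + 1 + 1) - Real.log ((m : ℝ) + 1)))) atTop (𝓝 (P.α * 0)) := by
    refine Tendsto.const_mul _ (squeeze_zero' (Eventually.of_forall fun m => ?_)
      (Eventually.of_forall fun m => ?_)
      (tendsto_natCast_add_rpow_neg (β := 1 - P.γ) (by linarith [P.γ_lt_one]) 1))
    · have hp : (0 : ℝ) < (m : ℝ) + 1 := by positivity
      exact mul_nonneg (by positivity)
        (sub_nonneg.2 (Real.log_le_log hp (by linarith)))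
    · have hp : (0 : ℝ) < (m : ℝ) + 1 := by positivity
      have hl : Real.log ((m : ℝ) + 1 + 1) - Real.log ((m : ℝ) + 1) ≤ ((m : ℝ) + 1)⁻¹ := by
        rw [← Real.log_div (by positivity) hp.ne']
        refine (Real.log_le_sub_one_of_pos (by positivity)).trans (le_of_eq ?_)
        field_simp
        ring
      refine (mul_le_mul_of_nonneg_left hl (by positivity)).trans (le_of_eq ?_)
      rw [← Real.rpow_neg_one, ← Real.rpow_add hp]
      congr 1
      ring
  have hu : Tendsto (fun m : ℕ => P.q / P.zs * ((m : ℝ) + 1 + 1) ^ (-P.γ)) atTop (𝓝[>] 0) := by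
    refine tendsto_nhdsWithin_iff.2 ⟨?_, Eventually.of_forall fun m => Set.mem_Ioi.2 (by positivity)⟩
    simpa [add_assoc] using (tendsto_natCast_add_rpow_neg P.γ_pos (1 + 1)).const_mul (P.q / P.zs)
  have hlog : HasDerivAt Real.log 1 1 := by simpa using Real.hasDerivAt_log one_ne_zero
  have h2 := hlog.tendsto_slope_zero_right.comp hu
  have h3 : Tendsto (fun m : ℕ => ((m : ℝ) + 1) ^ P.γ *
      (P.q / P.zs * ((m : ℝ) + 1 + 1) ^ (-P.γ))) atTop (𝓝 (P.q / P.zs)) := by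
    have h4 : Tendsto (fun m : ℕ => (((m : ℝ) + 1) / ((m : ℝ) + 1 + 1)) ^ P.γ) atTop (𝓝 (1 ^ P.γ)) := by
      refine Tendsto.rpow_const ?_ (Or.inl one_ne_zero)
      have := tendsto_natCast_div_add_atTop (𝕜 := ℝ) 1
      have := (tendsto_add_atTop_iff_nat 1).2 this
      simpa using this
    rw [Real.one_rpow] at h4
    have h5 := h4.const_mul (P.q / P.zs)
    rw [mul_one] at h5
    refine h5.congr fun m => ?_
    rw [Real.div_rpow (by positivity) (by positivity), Real.rpow_neg (by positivity)]
    field_simp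
  have h4 := h1.add (h2.mul h3)
  simp only [mul_zero, one_mul, zero_add] at h4
  refine h4.congr fun m => ?_
  have hp : (0 : ℝ) < P.q / P.zs * ((m : ℝ) + 1 + 1) ^ (-P.γ) := by positivity
  simp only [Function.comp, smul_eq_mul, Real.log_one, sub_zero]
  field_simp

/-- `-log ω_l ∼ q / (z_s (1 - γ)) l^{1-γ}`. -/
lemma tendsto_neg_log_ω_div :
    Tendsto (fun l : ℕ => -Real.log (P.ω P.zs l) / (l : ℝ) ^ (1 - P.γ)) atTop (𝓝 P.decay) := by
  have hz := P.zs_pos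
  have hγ := P.γ_lt_one
  have hγ' : 0 < 1 - P.γ := by linarith
  set inc : ℕ → ℝ := fun m => P.α * (Real.log ((m : ℝ) + 1 + 1) - Real.log ((m : ℝ) + 1))
        + Real.log (1 + P.q / P.zs * ((m : ℝ) + 1 + 1) ^ (-P.γ)) with hinc
  set g : ℕ → ℝ := fun m => ((m : ℝ) + 1 + 1) ^ (1 - P.γ) - ((m : ℝ) + 1) ^ (1 - P.γ) with hg
  have hgpos : ∀ m, 0 < g m := fun m =>
    sub_pos.2 (Real.rpow_lt_rpow (by positivity) (by linarith) hγ')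
  have hsumg : ∀ n : ℕ, ∑ i ∈ Finset.range n, g i = ((n : ℝ) + 1) ^ (1 - P.γ) - 1 := by
    intro n
    have := Finset.sum_range_sub (fun i : ℕ => ((i : ℝ) + 1) ^ (1 - P.γ)) n
    simpa [hg] using this
  have hsumi : ∀ n : ℕ, ∑ i ∈ Finset.range n, inc i
      = -Real.log (P.ω P.zs (n + 1)) + Real.log P.zs := by
    intro n
    have := Finset.sum_range_sub (fun i : ℕ => -Real.log (P.ω P.zs (i + 1))) n
    rw [P.ω_one] at this
    rw [← sub_neg_eq_add]
    rw [← this]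
    refine Finset.sum_congr rfl fun i _ => ?_
    have h := P.neg_log_ω_succ_sub (l := i + 1) (by omega)
    push_cast at h
    exact h.symm
  have hratio : Tendsto (fun m => inc m / g m) atTop (𝓝 P.decay) := by
    have h1 := P.tendsto_mul_neg_log_ω_succ_sub
    have h2 := tendsto_mul_rpow_succ_sub (1 - P.γ)
    have h3 := h1.div h2 hγ'.ne'
    have e : P.decay = P.q / P.zs / (1 - P.γ) := by unfold decay; field_simp
    rw [e]
    refine h3.congr fun m => ?_
    have hp := Real.rpow_pos_of_pos (show (0 : ℝ) < (m : ℝ) + 1 by positivity) P.γ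
    simp only [hinc, hg, Pi.div_apply, sub_sub_cancel]
    rw [mul_div_mul_left _ _ hp.ne']
  -- Stolz–Cesàro: the increments are asymptotically proportional and the partial sums of `g`
  -- diverge, so the sums are asymptotically proportional too.
  have ho : (fun m => inc m - P.decay * g m) =o[atTop] g := by
    refine Asymptotics.isLittleO_of_tendsto (fun m hm => absurd hm (hgpos m).ne') ?_
    have := hratio.sub_const P.decay
    rw [sub_self] at this
    refine this.congr fun m => ?_
    have := (hgpos m).ne'
    field_simp
  have htop : Tendsto (fun n : ℕ => ((n : ℝ) + 1) ^ (1 - P.γ)) atTop atTop :=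
    (tendsto_rpow_atTop hγ').comp
      (tendsto_atTop_add_const_right _ 1 tendsto_natCast_atTop_atTop)
  have hO := ho.sum_range (fun m => (hgpos m).le) (by
    simp only [hsumg]
    exact tendsto_atTop_add_const_right _ (-1) htop)
  simp only [Finset.sum_sub_distrib, ← Finset.mul_sum, hsumg, hsumi] at hO
  have hdiv := hO.tendsto_div_nhds_zero
  have hinv : Tendsto (fun n : ℕ => (((n : ℝ) + 1) ^ (1 - P.γ))⁻¹) atTop (𝓝 0) :=
    tendsto_inv_atTop_zero.comp htop
  rw [← tendsto_add_atTop_iff_nat 1]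
  have hfin := ((hdiv.mul ((hinv.const_sub 1))).add_const P.decay).sub
    (hinv.mul_const (Real.log P.zs + P.decay))
  simp only [sub_zero, zero_mul, zero_add] at hfin
  refine hfin.congr' ?_
  filter_upwards [eventually_gt_atTop 0] with n hn
  have hn' : (0 : ℝ) < n := by exact_mod_cast hn
  have h1 : 1 < ((n : ℝ) + 1) ^ (1 - P.γ) := Real.one_lt_rpow (by linarith) hγ'
  have h2 : ((n : ℝ) + 1) ^ (1 - P.γ) - 1 ≠ 0 := by linarith
  push_cast
  generalize ((n : ℝ) + 1) ^ (1 - P.γ) = X at *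
  have h3 : X ≠ 0 := by linarith
  field_simp
  ring

/-- Two-sided stretched exponential bounds for the equilibrium. -/
lemma eventually_ω_bounds {s : ℝ} (hs : 0 < s) :
    ∀ᶠ l : ℕ in atTop, Real.exp (-(P.decay + s) * (l : ℝ) ^ (1 - P.γ)) ≤ P.ω P.zs l ∧
      P.ω P.zs l ≤ Real.exp (-(P.decay - s) * (l : ℝ) ^ (1 - P.γ)) := by
  have h := P.tendsto_neg_log_ω_div
  filter_upwards [h.eventually (Ioo_mem_nhds (sub_lt_self P.decay hs) (lt_add_of_pos_right P.decay hs)),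
    eventually_gt_atTop 0] with l hl hl0
  have hp : (0 : ℝ) < (l : ℝ) ^ (1 - P.γ) := Real.rpow_pos_of_pos (by exact_mod_cast hl0) _
  have hw := P.ω_pos P.zs_pos l
  obtain ⟨h1, h2⟩ := hl
  rw [lt_div_iff₀ hp] at h1
  rw [div_lt_iff₀ hp] at h2
  rw [← Real.le_log_iff_exp_le hw, ← Real.log_le_iff_le_exp hw]
  constructor <;> linarith

lemma exists_neg_log_ω_le :
    ∃ C : ℝ, 0 < C ∧ ∀ l : ℕ, 1 ≤ l → -Real.log (P.ω P.zs l) ≤ C * (l : ℝ) ^ (1 - P.γ) := by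
  obtain ⟨C, hC⟩ := P.tendsto_neg_log_ω_div.bddAbove_range
  refine ⟨max C 1, by positivity, fun l hl => ?_⟩
  have hp : (0 : ℝ) < (l : ℝ) ^ (1 - P.γ) := Real.rpow_pos_of_pos (by exact_mod_cast hl) _
  have := (hC ⟨l, rfl⟩ : _ ≤ C)
  rw [div_le_iff₀ hp] at this
  exact this.trans (mul_le_mul_of_nonneg_right (le_max_left _ _) hp.le)

lemma summable_rpow_mul_exp_neg {β s : ℝ} (hβ : 0 < β) (hs : 0 < s) (p : ℝ) :
    Summable fun l : ℕ => (l : ℝ) ^ p * Real.exp (-s * (l : ℝ) ^ β) := by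
  have h0 := (tendsto_rpow_mul_exp_neg_mul_atTop_nhds_zero ((p + 2) / β) s hs).comp
    ((tendsto_rpow_atTop hβ).comp (tendsto_natCast_atTop_atTop (R := ℝ)))
  have h2 : Summable fun l : ℕ => (l : ℝ) ^ (-2 : ℝ) := Real.summable_nat_rpow.2 (by norm_num)
  refine summable_of_isBigO_nat h2 ?_
  refine Asymptotics.IsBigO.of_bound 1 ?_
  filter_upwards [h0.eventually (gt_mem_nhds one_pos), eventually_gt_atTop 0] with l hl hl0
  have hl' : (0 : ℝ) < l := by exact_mod_cast hl0
  simp only [Function.comp] at hl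
  rw [← Real.rpow_mul hl'.le, mul_div_cancel₀ _ hβ.ne', Real.rpow_add hl'] at hl
  rw [Real.norm_of_nonneg (by positivity), Real.norm_of_nonneg (by positivity), one_mul,
    Real.rpow_neg hl'.le, ← one_div, le_div_iff₀ (by positivity)]
  nlinarith

/-- All stretched exponential moments of the equilibrium below the critical one are finite. -/
lemma summable_rpow_mul_ω_mul_exp {s : ℝ} (hs : s < P.decay) (p : ℝ) :
    Summable fun l : ℕ => (l : ℝ) ^ p * (P.ω P.zs l * Real.exp (s * (l : ℝ) ^ (1 - P.γ))) := by
  -- Half of the gap is spent on the upper bound for `ω`; the other half remains as decay.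
  have hd : 0 < (P.decay - s) / 2 := by linarith
  refine summable_of_isBigO_nat
    (summable_rpow_mul_exp_neg (β := 1 - P.γ) (by linarith [P.γ_lt_one]) hd p) ?_
  refine Asymptotics.IsBigO.of_bound 1 ?_
  filter_upwards [P.eventually_ω_bounds hd] with l hl
  have hw := P.ω_pos P.zs_pos l
  rw [Real.norm_of_nonneg (by positivity), Real.norm_of_nonneg (by positivity), one_mul]
  refine mul_le_mul_of_nonneg_left ?_ (by positivity)
  refine (mul_le_mul_of_nonneg_right hl.2 (Real.exp_pos _).le).trans (le_of_eq ?_)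
  rw [← Real.exp_add]
  congr 1
  ring

lemma summable_criticalMass : Summable fun l : ℕ => (l : ℝ) * P.ω P.zs l := by
  simpa using P.summable_rpow_mul_ω_mul_exp P.decay_pos 1

end Rates

/-! ### A logarithmic Sobolev inequality on an initial segment of cluster sizes -/

/-- A majorant of `psi` which is quadratic below `1`. -/
def psiMaj (f : ℝ) : ℝ := if f ≤ 1 then (f - 1) ^ 2 else psi f

lemma psi_le_psiMaj {f : ℝ} (hf : 0 ≤ f) : psi f ≤ psiMaj f := by
  unfold psiMaj
  split_ifs
  · exact psi_le_sq hf
  · exact le_rfl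

lemma psiMaj_nonneg {f : ℝ} (hf : 0 ≤ f) : 0 ≤ psiMaj f := (psi_nonneg hf).trans (psi_le_psiMaj hf)

/-- The tangent inequality for the convex function `psi`, whose derivative is `log`; it is Fenchel's
inequality at `y = log g`. -/
lemma psi_sub_psi_le {f g : ℝ} (hf : 0 ≤ f) (hg : 0 < g) :
    psi g - psi f ≤ Real.log g * (g - f) := by
  have := mul_le_psi_add f (Real.log g) hf
  rw [Real.exp_log hg] at this
  have e : psi g = g * Real.log g - g + 1 := rfl
  linarith [e, mul_comm f (Real.log g), mul_comm g (Real.log g), mul_sub (Real.log g) g f]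

/-- The one-step estimate behind the logarithmic Sobolev inequality. -/
lemma psiMaj_sub_le {f f' lam M : ℝ} (hf : 0 < f) (hf' : 0 < f') (hlam : 0 < lam) (hlam1 : lam ≤ 1)
    (hM : 2 * (1 + max 0 (Real.log f')) / lam ≤ M) :
    psiMaj f' - psiMaj f ≤ lam * psiMaj f' + M * ((f' - f) * (Real.log f' - Real.log f)) := by
  have hde := sub_mul_log_sub_nonneg hf' hf
  have hG' := psiMaj_nonneg hf'.le
  have hG := psiMaj_nonneg hf.le
  rw [div_le_iff₀ hlam] at hM
  have hmax : 0 ≤ max 0 (Real.log f') := le_max_left _ _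
  have hMl : 2 ≤ M * lam := by linarith
  have hM0 : 0 < M := pos_of_mul_pos_left (by linarith) hlam.le
  have hM2 : 2 ≤ M := by nlinarith
  have hRHS : 0 ≤ lam * psiMaj f' := by positivity
  have hRHS' : 0 ≤ M * ((f' - f) * (Real.log f' - Real.log f)) := by positivity
  -- Below `1` the derivative of `psi` is unbounded, which is why the majorant is quadratic there.
  -- The essential case is `f' < f ≤ 1`, where `(f - f')² ≤ (f' - f)(log f' - log f)` and Young's
  -- inequality conclude.
  by_cases h1 : f' ≤ 1
  · have eG' : psiMaj f' = (f' - 1) ^ 2 := if_pos h1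
    rcases le_or_gt f f' with h2 | h2
    · have eG : psiMaj f = (f - 1) ^ 2 := if_pos (h2.trans h1)
      rw [eG'] at hRHS ⊢
      rw [eG]
      nlinarith
    · have h3 := log_sub_log_ge hf hf'
      rw [div_le_iff₀ hf] at h3
      have hle : 0 ≤ Real.log f - Real.log f' := by linarith [Real.log_le_log hf' h2.le]
      by_cases h4 : f ≤ 1
      · have eG : psiMaj f = (f - 1) ^ 2 := if_pos h4
        have h5 : f - f' ≤ Real.log f - Real.log f' := by nlinarith
        have h6 : (f - f') ^ 2 ≤ (f' - f) * (Real.log f' - Real.log f) := by nlinarith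
        rw [eG', eG]
        have h7 : 2 * (f - f') * (1 - f') ≤ lam * (1 - f') ^ 2 + M * (f - f') ^ 2 := by
          have : 0 ≤ (lam * (1 - f') - (f - f')) ^ 2 := sq_nonneg _
          have h8 : (f - f') ^ 2 ≤ lam * (M * (f - f') ^ 2) := by nlinarith [sq_nonneg (f - f')]
          have h9 : 0 ≤ lam * (lam * (1 - f') ^ 2 + M * (f - f') ^ 2 - 2 * (f - f') * (1 - f')) := by
            nlinarith
          have := nonneg_of_mul_nonneg_right h9 hlam
          linarith
        nlinarith
      · push Not at h4
        have h5 : 1 - f' ≤ Real.log f - Real.log f' := by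
          have := Real.log_le_sub_one_of_pos hf'
          have := Real.log_nonneg h4.le
          linarith
        have h6 : (f' - 1) ^ 2 ≤ (f' - f) * (Real.log f' - Real.log f) := by nlinarith
        rw [eG'] at hRHS ⊢
        nlinarith
  · push Not at h1
    have eG' : psiMaj f' = psi f' := if_neg (not_le.2 h1)
    have hg : 0 < Real.log f' := Real.log_pos h1
    rcases le_or_gt f' f with h2 | h2
    · have eG : psiMaj f = psi f := if_neg (not_le.2 (h1.trans_le h2))
      have := psi_sub_psi_le hf'.le hf
      have h3 := psi_sub_psi_le hf.le hf'
      rw [eG'] at hRHS ⊢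
      rw [eG]
      nlinarith
    · have h3 : psiMaj f' - psiMaj f ≤ Real.log f' * (f' - f) := by
        have := psi_sub_psi_le hf.le hf'
        have := psi_le_psiMaj hf.le
        rw [eG']
        linarith
      have h4 := log_sub_log_ge hf' hf
      rw [div_le_iff₀ hf'] at h4
      have hexp := exp_mul_sq_le hg.le
      rw [Real.exp_log hf', ← eG'] at hexp
      rw [max_eq_right hg.le] at hM
      set g := Real.log f' with hgdef
      set e := g - Real.log f with hedef
      have he : 0 < e := sub_pos.2 (Real.log_lt_log hf h2)
      have hd : 0 < f' - f := by linarith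
      -- The increment is at most `g (f' - f)`. A large logarithmic jump `e` puts it into the
      -- dissipation. A small one, with `f' - f ≤ e f'`, bounds it by `lam` times a multiple of `f'
      -- g² / (1 + g)`, which `exp_mul_sq_le` compares with `psi f'`.
      by_cases h5 : lam * g ≤ 2 * (1 + g) * e
      · have h6 : lam * (g * (f' - f)) ≤ lam * (M * ((f' - f) * e)) := by
          have := mul_le_mul_of_nonneg_right h5 hd.le
          have := mul_le_mul_of_nonneg_right hM (mul_pos hd he).le
          nlinarith
        have := le_of_mul_le_mul_left h6 hlam
        linarith
      · push Not at h5
        have h6 : g * (f' - f) ≤ g * (e * f') := mul_le_mul_of_nonneg_left h4 hg.le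
        have h7 : 2 * (1 + g) * (g * (e * f')) ≤ 2 * (1 + g) * (lam * psiMaj f') := by
          have a1 := mul_le_mul_of_nonneg_right h5.le (mul_pos hg hf').le
          have a2 := mul_le_mul_of_nonneg_left hexp hlam.le
          nlinarith
        have := le_of_mul_le_mul_left h7 (by positivity)
        linarith

/-- Summation of one-step estimates against weights with controlled tails. -/
lemma sum_mul_le_of_step {N : ℕ} {w A lam M D G : ℕ → ℝ} (hw : ∀ l, 0 ≤ w l)
    (hG : ∀ l, 1 ≤ l → l ≤ N → 0 ≤ G l) (hG1 : G 1 = 0)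
    (hD : ∀ l ∈ Finset.Ico 1 N, 0 ≤ M l * D l)
    (hlam : ∀ l ∈ Finset.Ico 1 N, 0 ≤ lam l)
    (hW : ∀ l ∈ Finset.Ico 1 N, ∑ m ∈ Finset.Ico (l + 1) (N + 1), w m ≤ A l * w (l + 1))
    (hstep : ∀ l ∈ Finset.Ico 1 N, G (l + 1) - G l ≤ lam l * G (l + 1) + M l * D l)
    (hA : ∀ l ∈ Finset.Ico 1 N, A l * lam l ≤ 1 / 2) :
    ∑ l ∈ Finset.Ico 1 (N + 1), w l * G l
      ≤ 2 * ∑ l ∈ Finset.Ico 1 N, A l * w (l + 1) * (M l * D l) := by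
  have hGsum : ∀ m, 1 ≤ m → G m = ∑ l ∈ Finset.Ico 1 m, (G (l + 1) - G l) := by
    intro m hm
    rw [Finset.sum_Ico_sub _ hm, hG1, sub_zero]
  -- Hardy's argument: `G` is the sum of its increments, and exchanging the order of summation
  -- weights each increment by a tail of `w`.
  have e1 : ∑ l ∈ Finset.Ico 1 (N + 1), w l * G l
      = ∑ l ∈ Finset.Ico 1 (N + 1), ∑ m ∈ Finset.Ico (l + 1) (N + 1), (G (l + 1) - G l) * w m := by
    rw [Finset.sum_Ico_Ico_comm' 1 (N + 1) (fun l m => (G (l + 1) - G l) * w m)]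
    refine Finset.sum_congr rfl fun m hm => ?_
    rw [← Finset.sum_mul, ← hGsum m (Finset.mem_Ico.1 hm).1, mul_comm]
  have e2 : ∑ l ∈ Finset.Ico 1 (N + 1), ∑ m ∈ Finset.Ico (l + 1) (N + 1), (G (l + 1) - G l) * w m
      = ∑ l ∈ Finset.Ico 1 N, (G (l + 1) - G l) * ∑ m ∈ Finset.Ico (l + 1) (N + 1), w m := by
    rcases Nat.eq_zero_or_pos N with rfl | hN
    · simp
    · rw [Finset.sum_Ico_succ_top hN]
      simp [Finset.mul_sum]
  set X := ∑ l ∈ Finset.Ico 1 (N + 1), w l * G l with hX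
  -- Because `A l * lam l ≤ 1/2`, the `lam` terms reproduce at most half of the left side and are
  -- absorbed.
  have h1 : ∀ l ∈ Finset.Ico 1 N, (G (l + 1) - G l) * ∑ m ∈ Finset.Ico (l + 1) (N + 1), w m
      ≤ 1 / 2 * (w (l + 1) * G (l + 1)) + A l * w (l + 1) * (M l * D l) := by
    intro l hl
    have hl' := Finset.mem_Ico.1 hl
    have hW0 : 0 ≤ ∑ m ∈ Finset.Ico (l + 1) (N + 1), w m := Finset.sum_nonneg fun m _ => hw m
    have hg := hG (l + 1) (by omega) (by omega)
    have a0 : 0 ≤ lam l * G (l + 1) + M l * D l :=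
      add_nonneg (mul_nonneg (hlam l hl) hg) (hD l hl)
    have a1 := mul_le_mul_of_nonneg_right (hstep l hl) hW0
    have a2 := mul_le_mul_of_nonneg_left (hW l hl) a0
    have a3 := mul_le_mul_of_nonneg_right (hA l hl) (mul_nonneg (hw (l + 1)) hg)
    nlinarith
  have h2 : ∑ l ∈ Finset.Ico 1 N, w (l + 1) * G (l + 1) ≤ X := by
    rw [Finset.sum_Ico_add' (fun l => w l * G l) 1 N 1]
    refine Finset.sum_le_sum_of_subset_of_nonneg (Finset.Ico_subset_Ico (by omega) le_rfl) ?_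
    intro l hl _
    have hl' := Finset.mem_Ico.1 hl
    exact mul_nonneg (hw l) (hG l hl'.1 (by omega))
  have h3 := Finset.sum_le_sum h1
  rw [Finset.sum_add_distrib, ← Finset.mul_sum] at h3
  rw [e2] at e1
  linarith

lemma tsum_Ico_eq_sum (f : ℕ → ℝ≥0∞) (a b : ℕ) :
    ∑' l : Set.Ico a b, f l = ∑ l ∈ Finset.Ico a b, f l := by
  rw [← Finset.tsum_subtype' (Finset.Ico a b) f, Finset.coe_Ico]

lemma entropyTerm_of_pos {n ω : ℝ} (h : 0 < ω) : entropyTerm n ω = ENNReal.ofReal (ω * psi (n / ω)) :=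
  if_neg h.ne'

namespace Rates

variable (P : Rates)

/-- Detailed balance gives the ratio `z a_l / b_{l+1}`, and `a_l ≤ a_{l+1}` since `α ≥ 0`. -/
lemma ω_succ_le {z c : ℝ} (hz : 0 < z) {l : ℕ} (hl : 1 ≤ l)
    (hc : z ≤ (1 - c) * (P.zs + P.q * ((l + 1 : ℕ) : ℝ) ^ (-P.γ))) :
    P.ω z (l + 1) ≤ (1 - c) * P.ω z l := by
  have hzs := P.zs_pos
  have hq := P.q_pos
  have h := P.b_mul_ω_succ z hl
  have hl' : (0 : ℝ) < l := by exact_mod_cast hl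
  have hb := P.b_pos (l := l + 1) (by omega)
  have hu : 0 < P.zs + P.q * ((l + 1 : ℕ) : ℝ) ^ (-P.γ) := by positivity
  have hw := P.ω_pos hz l
  have h1c : 0 < 1 - c := pos_of_mul_pos_left (hz.trans_le hc) hu.le
  refine le_of_mul_le_mul_left ?_ hb
  rw [h]
  have ha : P.a l ≤ P.a (l + 1) :=
    Real.rpow_le_rpow hl'.le (by push_cast; linarith) P.α_nonneg
  have ha0 := P.a_pos hl
  rw [P.b_succ]
  calc z * P.a l * P.ω z l
      ≤ ((1 - c) * (P.zs + P.q * ((l + 1 : ℕ) : ℝ) ^ (-P.γ))) * P.a (l + 1) * P.ω z l := by gcongr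
    _ = _ := by ring

/-- Bernoulli's inequality, with the factor `γ` of the increment bounded by `1`. -/
lemma add_one_rpow_le {γ y : ℝ} (h0 : 0 < γ) (h1 : γ < 1) (hy : 0 < y) :
    (y + 1) ^ γ ≤ y ^ γ + y ^ (γ - 1) := by
  have hb := rpow_one_add_le_one_add_mul_self (s := y⁻¹) (by
    have := inv_pos.2 hy; linarith) h0.le h1.le
  have e : y + 1 = y * (1 + y⁻¹) := by field_simp
  have hi := inv_pos.2 hy
  rw [e, Real.mul_rpow hy.le (by positivity), Real.rpow_sub hy, Real.rpow_one]
  calc y ^ γ * (1 + y⁻¹) ^ γ ≤ y ^ γ * (1 + γ * y⁻¹) := by gcongr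
    _ ≤ y ^ γ * (1 + 1 * y⁻¹) := by gcongr
    _ = _ := by field_simp

/-- Tails of the equilibria `ω(z)` for `z` not much larger than `z_s`. -/
lemma exists_sum_ω_le :
    ∃ A : ℝ, 1 ≤ A ∧ ∀ (N : ℕ) (z : ℝ), 0 < z → z ≤ P.zs + P.q / 2 * (N : ℝ) ^ (-P.γ) →
      ∀ l, 1 ≤ l → l ≤ N → ∑ m ∈ Finset.Ico l (N + 1), P.ω z m ≤ A * (l : ℝ) ^ P.γ * P.ω z l := by
  have hzs := P.zs_pos
  have hq := P.q_pos
  have hγ := P.γ_pos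
  have hγ1 := P.γ_lt_one
  set c := P.q / (2 * (P.zs + P.q)) with hc
  have hc0 : 0 < c := by positivity
  have hc1 : c ≤ 1 / 2 := by
    rw [hc, div_le_div_iff₀ (by positivity) (by norm_num)]
    linarith
  -- The shift solves `s^{γ-1} = c/2`, so that `(l + s)^γ` grows by at most `c/2` per step, also for
  -- small `l`.
  set s := (2 / c) ^ (1 / (1 - P.γ)) with hs
  have hs0 : 0 < s := by positivity
  have hsc : s ^ (P.γ - 1) = c / 2 := by
    rw [hs, ← Real.rpow_mul (by positivity)]
    have : 1 / (1 - P.γ) * (P.γ - 1) = -1 := by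
      have : 1 - P.γ ≠ 0 := by linarith
      field_simp
      ring
    rw [this, Real.rpow_neg_one, inv_div]
  have hAc : 4 ≤ 2 / c := by
    rw [le_div_iff₀ hc0]; linarith
  have h1s : 1 ≤ (1 + s) ^ P.γ := Real.one_le_rpow (by linarith) hγ.le
  refine ⟨2 / c * (1 + s) ^ P.γ, by nlinarith, fun N z hz hzN => ?_⟩
  -- Induction downwards from `l = N`. In units of `ω_l`, the decay of `ω` gains at least `2`: one
  -- unit pays for the new summand, the other for the growth of `(2/c)(l + s)^γ`.
  have key : ∀ k l : ℕ, 1 ≤ l → l + k = N →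
      ∑ m ∈ Finset.Ico l (N + 1), P.ω z m ≤ 2 / c * ((l : ℝ) + s) ^ P.γ * P.ω z l := by
    intro k
    induction k with
    | zero =>
      intro l hl hlN
      have hl' : (1 : ℝ) ≤ l := by exact_mod_cast hl
      have : l = N := by omega
      subst this
      rw [Finset.sum_Ico_succ_top le_rfl, Finset.Ico_self, Finset.sum_empty, zero_add]
      have h1 : 1 ≤ ((l : ℝ) + s) ^ P.γ := Real.one_le_rpow (by linarith) hγ.le
      have := P.ω_pos hz l
      refine le_mul_of_one_le_left this.le ?_
      nlinarith
    | succ k ih =>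
      intro l hl hlN
      have hl' : (1 : ℝ) ≤ l := by exact_mod_cast hl
      have hw := P.ω_pos hz l
      have ih' := ih (l + 1) (by omega) (by omega)
      rw [Finset.sum_eq_sum_Ico_succ_bot (by omega)]
      set u := ((l + 1 : ℕ) : ℝ) ^ (-P.γ) with hu
      have hl1 : (0 : ℝ) < ((l + 1 : ℕ) : ℝ) := by positivity
      have hu0 : 0 < u := by positivity
      have hu1 : u ≤ 1 := Real.rpow_le_one_of_one_le_of_nonpos (by push_cast; linarith) (by linarith)
      have hNu : (N : ℝ) ^ (-P.γ) ≤ u :=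
        Real.rpow_le_rpow_of_nonpos hl1 (by exact_mod_cast (by omega : l + 1 ≤ N)) (by linarith)
      have hstep : P.ω z (l + 1) ≤ (1 - c * u) * P.ω z l := by
        refine P.ω_succ_le hz hl ?_
        have h2 : c * (P.zs + P.q * u) ≤ P.q / 2 := by
          rw [hc, div_mul_eq_mul_div, div_le_div_iff₀ (by positivity) (by norm_num)]
          nlinarith [mul_nonneg (mul_pos hq hq).le (sub_nonneg.2 hu1)]
        have h3 : z ≤ P.zs + P.q / 2 * u := hzN.trans (by gcongr)
        nlinarith
      have hlu : 1 ≤ (((l + 1 : ℕ) : ℝ) + s) ^ P.γ * u := by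
        rw [hu, Real.rpow_neg hl1.le, ← div_eq_mul_inv, one_le_div (by positivity)]
        exact Real.rpow_le_rpow hl1.le (by linarith) hγ.le
      have hpow : (((l + 1 : ℕ) : ℝ) + s) ^ P.γ ≤ ((l : ℝ) + s) ^ P.γ + c / 2 := by
        have h4 := add_one_rpow_le hγ hγ1 (show (0 : ℝ) < (l : ℝ) + s by linarith)
        have h5 : ((l : ℝ) + s) ^ (P.γ - 1) ≤ c / 2 := by
          rw [← hsc]
          exact Real.rpow_le_rpow_of_nonpos hs0 (by linarith) (by linarith)
        have e : ((l + 1 : ℕ) : ℝ) + s = (l : ℝ) + s + 1 := by push_cast; ring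
        rw [e]
        linarith
      set Y := (((l + 1 : ℕ) : ℝ) + s) ^ P.γ with hY
      set Y0 := ((l : ℝ) + s) ^ P.γ with hY0
      have hYpos : 0 < Y := by positivity
      calc P.ω z l + ∑ m ∈ Finset.Ico (l + 1) (N + 1), P.ω z m
          ≤ P.ω z l + 2 / c * Y * ((1 - c * u) * P.ω z l) := by
            have : 2 / c * Y * P.ω z (l + 1) ≤ 2 / c * Y * ((1 - c * u) * P.ω z l) := by gcongr
            linarith
        _ = (1 + 2 / c * Y - 2 * (Y * u)) * P.ω z l := by field_simp; ring
        _ ≤ (2 / c * Y0) * P.ω z l := by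
            refine mul_le_mul_of_nonneg_right ?_ hw.le
            have : 2 / c * Y ≤ 2 / c * (Y0 + c / 2) := by gcongr
            have e : 2 / c * (Y0 + c / 2) = 2 / c * Y0 + 1 := by field_simp
            linarith
  intro l hl hlN
  refine (key (N - l) l hl (by omega)).trans ?_
  have hl' : (1 : ℝ) ≤ l := by exact_mod_cast hl
  have hw := P.ω_pos hz l
  refine mul_le_mul_of_nonneg_right ?_ hw.le
  rw [mul_assoc]
  refine mul_le_mul_of_nonneg_left ?_ (by positivity)
  rw [← Real.mul_rpow (by positivity) (by positivity)]
  exact Real.rpow_le_rpow (by positivity) (by nlinarith) hγ.le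

lemma exists_ω_le : ∃ C : ℝ, 0 < C ∧ ∀ l, P.ω P.zs l ≤ C := by
  have h := P.summable_rpow_mul_ω_mul_exp P.decay_pos 0
  simp only [Real.rpow_zero, zero_mul, Real.exp_zero, mul_one, one_mul] at h
  obtain ⟨C, hC⟩ := h.tendsto_atTop_zero.bddAbove_range
  exact ⟨max C 1, by positivity, fun l => (hC ⟨l, rfl⟩ : _ ≤ C).trans (le_max_left _ _)⟩

/-- The quotients `n_l / ω_l(n_1)` grow at most like a stretched exponential. -/
lemma exists_log_div_ω_le (B : ℝ) :
    ∃ C : ℝ, 1 ≤ C ∧ ∀ (N : ℕ) (z : ℝ), 0 < z → P.zs ≤ z * (1 + (N : ℝ) ^ (-P.γ)) →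
      ∀ l, 1 ≤ l → l ≤ N → ∀ y, 0 < y → y ≤ B →
        1 + max 0 (Real.log (y / P.ω z l)) ≤ C * (l : ℝ) ^ (1 - P.γ) := by
  obtain ⟨C, hC, h⟩ := P.exists_neg_log_ω_le
  have hγ := P.γ_pos
  have hγ1 := P.γ_lt_one
  have hzs := P.zs_pos
  refine ⟨|B| + C + 2, by linarith [abs_nonneg B], fun N z hz hzN l hl hlN y hy hyB => ?_⟩
  have hl' : (1 : ℝ) ≤ l := by exact_mod_cast hl
  have hl0 : (0 : ℝ) < l := by linarith
  have hX : 1 ≤ (l : ℝ) ^ (1 - P.γ) := Real.one_le_rpow hl' (by linarith)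
  have h1 : Real.log y ≤ |B| :=
    ((Real.log_le_sub_one_of_pos hy).trans (by linarith)).trans (le_abs_self B)
  have h2 : Real.log (P.zs / z) ≤ (l : ℝ) ^ (-P.γ) := by
    refine (Real.log_le_sub_one_of_pos (by positivity)).trans ?_
    have h3 : P.zs / z ≤ 1 + (N : ℝ) ^ (-P.γ) := by
      rw [div_le_iff₀ hz]; linarith
    have h4 : (N : ℝ) ^ (-P.γ) ≤ (l : ℝ) ^ (-P.γ) :=
      Real.rpow_le_rpow_of_nonpos hl0 (by exact_mod_cast hlN) (by linarith)
    linarith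
  have h5 : Real.log (y / P.ω z l)
      = Real.log y - Real.log (P.ω P.zs l) + l * Real.log (P.zs / z) := by
    rw [Real.log_div hy.ne' (P.ω_pos hz l).ne', P.ω_eq_mul_div_pow,
      Real.log_mul (P.ω_pos hzs l).ne' (by positivity), Real.log_pow,
      Real.log_div hz.ne' hzs.ne', Real.log_div hzs.ne' hz.ne']
    ring
  have h6 : (l : ℝ) * Real.log (P.zs / z) ≤ (l : ℝ) ^ (1 - P.γ) := by
    have e : (l : ℝ) ^ (1 - P.γ) = l * (l : ℝ) ^ (-P.γ) := by
      rw [sub_eq_add_neg, Real.rpow_add hl0, Real.rpow_one]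
    rw [e]
    gcongr
  have h7 := h l hl
  have h8 : Real.log (y / P.ω z l) ≤ (|B| + C + 1) * (l : ℝ) ^ (1 - P.γ) := by
    rw [h5]
    nlinarith [abs_nonneg B]
  have h9 : max 0 (Real.log (y / P.ω z l)) ≤ (|B| + C + 1) * (l : ℝ) ^ (1 - P.γ) :=
    max_le (by positivity) h8
  nlinarith

/-- Detailed balance at fugacity `n 1` gives both rates the same prefactor, times consecutive values
of `n_l / ω_l(n_1)`. The dissipation thus becomes a Dirichlet form of that quotient. -/
lemma dissipationTerm_eq {n : ℕ → ℝ} {l : ℕ} (hl : 1 ≤ l) (h1 : 0 < n 1) (hn : 0 < n l)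
    (hn' : 0 < n (l + 1)) :
    dissipationTerm (P.a l * n 1 * n l) (P.b (l + 1) * n (l + 1))
      = ENNReal.ofReal (n 1 * P.a l * P.ω (n 1) l *
        ((n (l + 1) / P.ω (n 1) (l + 1) - n l / P.ω (n 1) l) *
          (Real.log (n (l + 1) / P.ω (n 1) (l + 1)) - Real.log (n l / P.ω (n 1) l)))) := by
  have ha := P.a_pos hl
  have hb := P.b_pos (l := l + 1) (by omega)
  have hw := P.ω_pos h1 l
  have hw' := P.ω_pos h1 (l + 1)
  have hk : 0 < n 1 * P.a l * P.ω (n 1) l := by positivity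
  have e1 : P.a l * n 1 * n l = n 1 * P.a l * P.ω (n 1) l * (n l / P.ω (n 1) l) := by field_simp
  have e2 : P.b (l + 1) * n (l + 1)
      = n 1 * P.a l * P.ω (n 1) l * (n (l + 1) / P.ω (n 1) (l + 1)) := by
    rw [← P.b_mul_ω_succ (n 1) hl]; field_simp
  rw [e1, e2]
  have hf : 0 < n l / P.ω (n 1) l := by positivity
  have hf' : 0 < n (l + 1) / P.ω (n 1) (l + 1) := by positivity
  generalize n l / P.ω (n 1) l = f at *
  generalize n (l + 1) / P.ω (n 1) (l + 1) = f' at *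
  generalize n 1 * P.a l * P.ω (n 1) l = k at *
  unfold dissipationTerm
  by_cases h : f = f'
  · simp [h]
  · rw [if_neg (fun hh => h (mul_left_cancel₀ hk.ne' hh)), if_neg (by
      rintro (hh | hh)
      · exact (mul_pos hk hf).ne' hh
      · exact (mul_pos hk hf').ne' hh), Real.log_mul hk.ne' hf.ne', Real.log_mul hk.ne' hf'.ne']
    congr 1
    ring

/-- The entropy-dissipation inequality for small clusters. -/
lemma exists_relEntropyOn_le (B : ℝ) :
    ∃ C : ℝ, 0 < C ∧ ∀ (N : ℕ) (n : ℕ → ℝ), 1 ≤ N → (∀ l, 1 ≤ l → 0 ≤ n l) → (∀ l, 1 ≤ l → n l ≤ B) →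
      0 < n 1 → n 1 ≤ P.zs + P.q / 2 * (N : ℝ) ^ (-P.γ) →
      P.zs ≤ n 1 * (1 + (N : ℝ) ^ (-P.γ)) →
      relEntropyOn (Set.Ico 1 (N + 1)) n (P.ω (n 1))
        ≤ ENNReal.ofReal (C * (N : ℝ) ^ (1 - P.α + P.γ)) *
          P.dissipationOn (Set.Ico 1 (N + 1)) n := by
  obtain ⟨A, hA1, hA⟩ := P.exists_sum_ω_le
  obtain ⟨Cg, hCg1, hCg⟩ := P.exists_log_div_ω_le B
  have hzs := P.zs_pos
  have hγ := P.γ_pos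
  have hγ1 := P.γ_lt_one
  have hα := P.α_nonneg
  have hα1 := P.α_lt_one
  have hA0 : 0 < A := by linarith
  refine ⟨64 * A ^ 2 * Cg / P.zs, by positivity, fun N n hN hn hnB h1 hup hlow => ?_⟩
  have hN' : (1 : ℝ) ≤ N := by exact_mod_cast hN
  unfold relEntropyOn dissipationOn
  rw [tsum_Ico_eq_sum (fun l => entropyTerm (n l) (P.ω (n 1) l)),
    tsum_Ico_eq_sum (fun l => dissipationTerm (P.a l * n 1 * n l) (P.b (l + 1) * n (l + 1)))]
  set d : ℕ → ℝ≥0∞ := fun l => dissipationTerm (P.a l * n 1 * n l) (P.b (l + 1) * n (l + 1)) with hd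
  have hC0 : 0 < 64 * A ^ 2 * Cg / P.zs * (N : ℝ) ^ (1 - P.α + P.γ) := by positivity
  by_cases htop : ∃ l ∈ Finset.Ico 1 (N + 1), d l = ⊤
  · obtain ⟨l, hl, hdl⟩ := htop
    have : ∑ l ∈ Finset.Ico 1 (N + 1), d l = ⊤ := ENNReal.sum_eq_top.2 ⟨l, hl, hdl⟩
    rw [this, ENNReal.mul_top (by simpa using hC0)]
    exact le_top
  push Not at htop
  -- A dissipation term is infinite if exactly one of its rates vanishes, so positivity propagates
  -- upwards from `n 1`.
  have hpos : ∀ l, 1 ≤ l → l ≤ N → 0 < n l := by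
    intro l hl
    induction l, hl using Nat.le_induction with
    | base => exact fun _ => h1
    | succ l hl ih =>
      intro hlN
      have hnl := ih (by omega)
      by_contra hcon
      have h0 : n (l + 1) = 0 := le_antisymm (not_lt.1 hcon) (hn _ (by omega))
      refine htop l (Finset.mem_Ico.2 ⟨hl, by omega⟩) ?_
      have hp : P.a l * n 1 * n l ≠ 0 := (mul_pos (mul_pos (P.a_pos hl) h1) hnl).ne'
      simp only [hd, dissipationTerm, h0, mul_zero]
      rw [if_neg hp, if_pos (Or.inr trivial)]
  set f : ℕ → ℝ := fun l => n l / P.ω (n 1) l with hf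
  have hfpos : ∀ l, 1 ≤ l → l ≤ N → 0 < f l := fun l hl hlN => div_pos (hpos l hl hlN) (P.ω_pos h1 l)
  have hf1 : f 1 = 1 := by simp only [hf, P.ω_one]; exact div_self h1.ne'
  set D : ℕ → ℝ := fun l => (f (l + 1) - f l) * (Real.log (f (l + 1)) - Real.log (f l)) with hD
  have hD0 : ∀ l ∈ Finset.Ico 1 N, 0 ≤ D l := by
    intro l hl
    have hl' := Finset.mem_Ico.1 hl
    exact sub_mul_log_sub_nonneg (hfpos _ (by omega) (by omega)) (hfpos _ hl'.1 (by omega))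
  -- The tails cost `A ∼ l^γ`, absorption forces `lam ∼ l^{-γ}`, and `log f ≲ l^{1-γ}` then makes
  -- `M` linear in `l`. Divided by the mobility `a_l`, the product `A M` is of order `l^{1-α+γ}`.
  have hmain := sum_mul_le_of_step (N := N) (w := P.ω (n 1))
    (A := fun l => A * ((l + 1 : ℕ) : ℝ) ^ P.γ)
    (lam := fun l => (2 * (A * ((l + 1 : ℕ) : ℝ) ^ P.γ))⁻¹)
    (M := fun l => 4 * A * Cg * ((l + 1 : ℕ) : ℝ)) (D := D) (G := fun l => psiMaj (f l))
    (fun l => (P.ω_pos h1 l).le) (fun l hl hlN => psiMaj_nonneg (hfpos l hl hlN).le)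
    (by simp [hf1, psiMaj]) (fun l hl => mul_nonneg (by positivity) (hD0 l hl))
    (fun l hl => by positivity)
    (fun l hl => by
      have hl' := Finset.mem_Ico.1 hl
      exact hA N (n 1) h1 hup (l + 1) (by omega) (by omega))
    (fun l hl => by
      have hl' := Finset.mem_Ico.1 hl
      have hx : (1 : ℝ) ≤ ((l + 1 : ℕ) : ℝ) ^ P.γ := Real.one_le_rpow (by push_cast; linarith [Nat.cast_nonneg (α := ℝ) l]) hγ.le
      refine psiMaj_sub_le (hfpos _ hl'.1 (by omega)) (hfpos _ (by omega) (by omega))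
        (by positivity) ?_ ?_
      · rw [inv_le_one₀ (by positivity)]
        nlinarith
      · have hg := hCg N (n 1) h1 hlow (l + 1) (by omega) (by omega) (n (l + 1))
          (hpos _ (by omega) (by omega)) (hnB _ (by omega))
        have hp : (0 : ℝ) < ((l + 1 : ℕ) : ℝ) := by positivity
        have e : ((l + 1 : ℕ) : ℝ) = ((l + 1 : ℕ) : ℝ) ^ (1 - P.γ) * ((l + 1 : ℕ) : ℝ) ^ P.γ := by
          rw [← Real.rpow_add hp]; simp
        rw [div_inv_eq_mul]
        calc 2 * (1 + max 0 (Real.log (f (l + 1)))) * (2 * (A * ((l + 1 : ℕ) : ℝ) ^ P.γ))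
            ≤ 2 * (Cg * ((l + 1 : ℕ) : ℝ) ^ (1 - P.γ)) * (2 * (A * ((l + 1 : ℕ) : ℝ) ^ P.γ)) := by
              gcongr
          _ = 4 * A * Cg * (((l + 1 : ℕ) : ℝ) ^ (1 - P.γ) * ((l + 1 : ℕ) : ℝ) ^ P.γ) := by ring
          _ = _ := by rw [← e])
    (fun l hl => by
      have hx : 0 < A * ((l + 1 : ℕ) : ℝ) ^ P.γ := by positivity
      show A * ((l + 1 : ℕ) : ℝ) ^ P.γ * (2 * (A * ((l + 1 : ℕ) : ℝ) ^ P.γ))⁻¹ ≤ 1 / 2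
      generalize A * ((l + 1 : ℕ) : ℝ) ^ P.γ = y at *
      rw [mul_inv]
      field_simp
      norm_num)
  have hleft : ∑ l ∈ Finset.Ico 1 (N + 1), entropyTerm (n l) (P.ω (n 1) l)
      ≤ ENNReal.ofReal (∑ l ∈ Finset.Ico 1 (N + 1), P.ω (n 1) l * psiMaj (f l)) := by
    rw [ENNReal.ofReal_sum_of_nonneg (fun l hl => by
      have hl' := Finset.mem_Ico.1 hl
      exact mul_nonneg (P.ω_pos h1 l).le (psiMaj_nonneg (hfpos l hl'.1 (by omega)).le))]
    refine Finset.sum_le_sum fun l hl => ?_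
    have hl' := Finset.mem_Ico.1 hl
    rw [entropyTerm_of_pos (P.ω_pos h1 l)]
    exact ENNReal.ofReal_le_ofReal (mul_le_mul_of_nonneg_left
      (psi_le_psiMaj (hfpos l hl'.1 (by omega)).le) (P.ω_pos h1 l).le)
  refine hleft.trans ((ENNReal.ofReal_le_ofReal hmain).trans ?_)
  rw [Finset.mul_sum, Finset.mul_sum, ENNReal.ofReal_sum_of_nonneg (fun l hl => by
    have := hD0 l hl
    have := P.ω_pos h1 (l + 1)
    positivity)]
  -- The dissipation up to `N` includes the reaction from `N` to `N + 1`, which is not needed and is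
  -- dropped.
  refine (Finset.sum_le_sum ?_).trans
    (Finset.sum_le_sum_of_subset (Finset.Ico_subset_Ico le_rfl (Nat.le_succ N)))
  intro l hl
  have hl' := Finset.mem_Ico.1 hl
  have hlr : (1 : ℝ) ≤ l := by exact_mod_cast hl'.1
  have hlN : (l : ℝ) ≤ N := by exact_mod_cast hl'.2.le
  rw [P.dissipationTerm_eq hl'.1 h1 (hpos l hl'.1 (by omega)) (hpos (l + 1) (by omega) (by omega)),
    ← ENNReal.ofReal_mul hC0.le]
  refine ENNReal.ofReal_le_ofReal ?_
  change _ ≤ 64 * A ^ 2 * Cg / P.zs * (N : ℝ) ^ (1 - P.α + P.γ) * (n 1 * P.a l * P.ω (n 1) l * D l)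
  have hDl := hD0 l hl
  have hw := P.ω_pos h1 l
  have hNγ : (N : ℝ) ^ (-P.γ) ≤ 1 := Real.rpow_le_one_of_one_le_of_nonpos hN' (by linarith)
  have hz2 : P.zs ≤ 2 * n 1 := by nlinarith
  have hwl : P.ω (n 1) (l + 1) ≤ P.ω (n 1) l := by
    have := P.ω_succ_le (c := 0) h1 hl'.1 (by
      have : (N : ℝ) ^ (-P.γ) ≤ ((l + 1 : ℕ) : ℝ) ^ (-P.γ) :=
        Real.rpow_le_rpow_of_nonpos (by positivity) (by exact_mod_cast hl'.2) (by linarith)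
      have hq := P.q_pos
      have : 0 ≤ (N : ℝ) ^ (-P.γ) := by positivity
      nlinarith)
    simpa using this
  have hl2 : ((l + 1 : ℕ) : ℝ) ^ (1 + P.γ) ≤ 4 * (l : ℝ) ^ (1 + P.γ) := by
    calc ((l + 1 : ℕ) : ℝ) ^ (1 + P.γ) ≤ (2 * (l : ℝ)) ^ (1 + P.γ) :=
          Real.rpow_le_rpow (by positivity) (by push_cast; linarith) (by linarith)
      _ = 2 ^ (1 + P.γ) * (l : ℝ) ^ (1 + P.γ) := Real.mul_rpow (by norm_num) (by linarith)
      _ ≤ 2 ^ (2 : ℝ) * (l : ℝ) ^ (1 + P.γ) := by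
          gcongr
          · norm_num
          · linarith
      _ = 4 * (l : ℝ) ^ (1 + P.γ) := by norm_num
  have hl3 : (l : ℝ) ^ (1 + P.γ) ≤ (N : ℝ) ^ (1 - P.α + P.γ) * P.a l := by
    have e : (l : ℝ) ^ (1 + P.γ) = (l : ℝ) ^ (1 - P.α + P.γ) * P.a l := by
      unfold a
      rw [← Real.rpow_add (by linarith)]
      congr 1
      ring
    rw [e]
    have := P.a_nonneg l
    gcongr
  have e0 : ((l + 1 : ℕ) : ℝ) ^ P.γ * ((l + 1 : ℕ) : ℝ) = ((l + 1 : ℕ) : ℝ) ^ (1 + P.γ) := by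
    rw [Real.rpow_add (by positivity), Real.rpow_one, mul_comm]
  set X := (N : ℝ) ^ (1 - P.α + P.γ) with hX
  have ha := P.a_pos hl'.1
  have hX0 : 0 < X := by positivity
  have hw' := (P.ω_pos h1 (l + 1)).le
  calc 2 * (A * ((l + 1 : ℕ) : ℝ) ^ P.γ * P.ω (n 1) (l + 1) * (4 * A * Cg * ((l + 1 : ℕ) : ℝ) * D l))
      = 8 * A ^ 2 * Cg * (((l + 1 : ℕ) : ℝ) ^ P.γ * ((l + 1 : ℕ) : ℝ)) * P.ω (n 1) (l + 1) * D l := by ring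
    _ ≤ 8 * A ^ 2 * Cg * (4 * (X * P.a l)) * P.ω (n 1) l * D l := by
        rw [e0]
        have : ((l + 1 : ℕ) : ℝ) ^ (1 + P.γ) ≤ 4 * (X * P.a l) := by linarith
        gcongr
    _ = 32 * A ^ 2 * Cg * X * P.a l * P.ω (n 1) l * D l * 1 := by ring
    _ ≤ 32 * A ^ 2 * Cg * X * P.a l * P.ω (n 1) l * D l * (2 * n 1 / P.zs) := by
        gcongr
        rw [le_div_iff₀ hzs]
        linarith
    _ = _ := by field_simp; ring

end Rates

/-! ### Consequences of the energy bound -/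

lemma one_le_cutoff {x ε : ℝ} (hx : 0 < x) (h0 : 0 < ε) (h1 : ε ≤ 1) : 1 ≤ cutoff x ε := by
  unfold cutoff
  rw [Nat.one_le_floor_iff]
  exact Real.one_le_rpow_of_pos_of_le_one_of_nonpos h0 h1 (by linarith)

lemma cutoff_le {x ε : ℝ} (h0 : 0 < ε) : (cutoff x ε : ℝ) ≤ ε ^ (-x) :=
  Nat.floor_le (by positivity)

lemma rpow_neg_le_two_mul_cutoff {x ε : ℝ} (hx : 0 < x) (h0 : 0 < ε) (h1 : ε ≤ 1) :
    ε ^ (-x) ≤ 2 * cutoff x ε := by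
  have h := Nat.lt_floor_add_one (ε ^ (-x))
  have h2 : (1 : ℝ) ≤ cutoff x ε := by exact_mod_cast one_le_cutoff hx h0 h1
  change _ < (cutoff x ε : ℝ) + 1 at h
  linarith

lemma rpow_mul_le_rpow_neg {x ε γ : ℝ} (h0 : 0 < ε) (hγ : 0 < γ) {l : ℕ} (hl : 1 ≤ l)
    (hlc : l ≤ cutoff x ε) : ε ^ (x * γ) ≤ (l : ℝ) ^ (-γ) := by
  have hl' : (0 : ℝ) < l := by exact_mod_cast hl
  have h : (l : ℝ) ≤ ε ^ (-x) := (by exact_mod_cast hlc : (l : ℝ) ≤ cutoff x ε).trans (cutoff_le h0)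
  have := Real.rpow_le_rpow_of_nonpos hl' h (by linarith : -γ ≤ 0)
  rwa [← Real.rpow_mul h0.le, neg_mul_neg] at this

lemma tendsto_rpow_nhdsWithin_zero {p : ℝ} (hp : 0 < p) (C : ℝ) :
    Tendsto (fun ε : ℝ => C * ε ^ p) (𝓝[>] 0) (𝓝 0) := by
  have h : Tendsto (fun ε : ℝ => ε ^ p) (𝓝[>] 0) (𝓝 (0 ^ p)) :=
    (Real.continuousAt_rpow_const 0 p (Or.inr hp.le)).tendsto.mono_left nhdsWithin_le_nhds
  rw [Real.zero_rpow hp.ne'] at h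
  simpa using h.const_mul C

lemma eventually_mul_rpow_le {p : ℝ} (hp : 0 < p) (C : ℝ) {s : ℝ} (hs : 0 < s) :
    ∀ᶠ ε : ℝ in 𝓝[>] 0, C * ε ^ p ≤ s :=
  (tendsto_rpow_nhdsWithin_zero hp C).eventually (ge_mem_nhds hs)

lemma eventually_mem_Ioc : ∀ᶠ ε : ℝ in 𝓝[>] 0, 0 < ε ∧ ε ≤ 1 := by
  filter_upwards [Ioc_mem_nhdsGT (zero_lt_one (α := ℝ))] with ε hε using hε

/-- No smallness of `y` is assumed: the argument will be a multiple of `l`, and the factor `e^{|y|}`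
is absorbed by the decay of `ω`. -/
lemma exp_sub_one_sub_le (y : ℝ) : Real.exp y - 1 - y ≤ y ^ 2 * Real.exp |y| := by
  have h1 := Real.add_one_le_exp (-y)
  have h2 := Real.add_one_le_exp y
  have h3 : Real.exp y * Real.exp (-y) = 1 := by rw [← Real.exp_add]; simp
  have h4 := Real.exp_pos y
  have h5 : Real.exp y - 1 ≤ y * Real.exp y := by nlinarith
  rcases le_total 0 y with hy | hy
  · rw [abs_of_nonneg hy]
    nlinarith
  · rw [abs_of_nonpos hy]
    have : 1 ≤ Real.exp (-y) := Real.one_le_exp (by linarith)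
    nlinarith [sq_nonneg y]

lemma abs_log_le {y : ℝ} (hy : 1 / 2 ≤ y) : |Real.log y| ≤ 2 * |y - 1| := by
  have h0 : 0 < y := by linarith
  have h1 := Real.log_le_sub_one_of_pos h0
  have h2 := Real.one_sub_inv_le_log_of_pos h0
  rw [abs_le]
  constructor
  · have : -(2 * |y - 1|) ≤ 1 - y⁻¹ := by
      have e : 1 - y⁻¹ = (y - 1) * y⁻¹ := by field_simp
      have h3 : y⁻¹ ≤ 2 := by rw [inv_le_comm₀ h0 (by norm_num)]; linarith
      have h4 := inv_pos.2 h0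
      rw [e]
      have := neg_abs_le (y - 1)
      nlinarith [abs_nonneg (y - 1)]
    linarith
  · have := le_abs_self (y - 1)
    have := abs_nonneg (y - 1)
    linarith

namespace Rates

variable {P : Rates} {ρ₀ K ε : ℝ} {n : ℕ → ℝ}

lemma IsState.term_nonneg (h : P.IsState ρ₀ K ε n) {l : ℕ} (hl : 1 ≤ l) :
    0 ≤ P.ω P.zs l * psi (n l / P.ω P.zs l) := by
  have hw := P.ω_pos P.zs_pos l
  exact mul_nonneg hw.le (psi_nonneg (div_nonneg (h.nonneg l hl) hw.le))

lemma IsState.sum_le (h : P.IsState ρ₀ K ε n) (hε : 0 < ε) (s : Finset ℕ) (hs : ∀ l ∈ s, 1 ≤ l) :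
    ∑ l ∈ s, P.ω P.zs l * psi (n l / P.ω P.zs l) ≤ |K| * ε ^ P.γ := by
  have he := h.energy
  unfold freeEnergyOn relEntropyOn at he
  rw [tsum_subtype (Set.Ici 1) (fun l => entropyTerm (n l) (P.ω P.zs l))] at he
  have h1 := (ENNReal.sum_le_tsum s).trans he
  have h2 : ∑ l ∈ s, (Set.Ici 1).indicator (fun l => entropyTerm (n l) (P.ω P.zs l)) l
      = ENNReal.ofReal (∑ l ∈ s, P.ω P.zs l * psi (n l / P.ω P.zs l)) := by
    rw [ENNReal.ofReal_sum_of_nonneg fun l hl => h.term_nonneg (hs l hl)]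
    refine Finset.sum_congr rfl fun l hl => ?_
    rw [Set.indicator_of_mem (Set.mem_Ici.2 (hs l hl)), entropyTerm_of_pos (P.ω_pos P.zs_pos l)]
  rw [h2] at h1
  have hp : 0 < ε ^ P.γ := by positivity
  have h3 : ENNReal.ofReal (K * ε ^ P.γ) ≤ ENNReal.ofReal (|K| * ε ^ P.γ) :=
    ENNReal.ofReal_le_ofReal (mul_le_mul_of_nonneg_right (le_abs_self K) hp.le)
  exact (ENNReal.ofReal_le_ofReal_iff (by positivity)).1 (h1.trans h3)

/-- Entropy duality: Fenchel's inequality summed against `ω`. The a priori bounds that follow come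
from choices of `y`. -/
lemma IsState.sum_mul_le (h : P.IsState ρ₀ K ε n) (hε : 0 < ε) (s : Finset ℕ) (hs : ∀ l ∈ s, 1 ≤ l)
    (y : ℕ → ℝ) :
    ∑ l ∈ s, n l * y l ≤ |K| * ε ^ P.γ + ∑ l ∈ s, P.ω P.zs l * (Real.exp (y l) - 1) := by
  have h1 := h.sum_le hε s hs
  have h2 : ∑ l ∈ s, n l * y l ≤ ∑ l ∈ s, (P.ω P.zs l * psi (n l / P.ω P.zs l)
      + P.ω P.zs l * (Real.exp (y l) - 1)) :=
    Finset.sum_le_sum fun l hl => mul_le_mul_psi_add (h.nonneg l (hs l hl)) (P.ω_pos P.zs_pos l) _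
  rw [Finset.sum_add_distrib] at h2
  linarith

lemma IsState.le_of_energy_le_one (h : P.IsState ρ₀ K ε n) (hε : 0 < ε) (hK : |K| * ε ^ P.γ ≤ 1)
    {l : ℕ} (hl : 1 ≤ l) : n l ≤ 1 + P.ω P.zs l * (Real.exp 1 - 1) := by
  have := h.sum_mul_le hε {l} (by simpa using hl) (fun _ => 1)
  simp only [Finset.sum_singleton, mul_one] at this
  linarith

/-- Duality at the single size `1` with `y = ±s`. -/
lemma IsState.abs_sub_zs_le (h : P.IsState ρ₀ K ε n) (hε : 0 < ε) {s : ℝ} (hs : 0 < s)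
    (hs1 : s ≤ 1) : |n 1 - P.zs| ≤ |K| * ε ^ P.γ / s + P.zs * s := by
  have hz := P.zs_pos
  have key : ∀ y : ℝ, |y| = s → (n 1 - P.zs) * y ≤ |K| * ε ^ P.γ + P.zs * s ^ 2 := by
    intro y hy
    have h1 := h.sum_mul_le hε {1} (by simp) (fun _ => y)
    simp only [Finset.sum_singleton, P.ω_one] at h1
    have h2 := (le_abs_self _).trans (Real.abs_exp_sub_one_sub_id_le (x := y) (by rw [hy]; exact hs1))
    rw [← sq_abs, hy] at h2
    nlinarith
  have e : |K| * ε ^ P.γ / s + P.zs * s = (|K| * ε ^ P.γ + P.zs * s ^ 2) / s := by field_simp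
  rw [e, le_div_iff₀ hs]
  rcases le_total 0 (n 1 - P.zs) with h0 | h0
  · rw [abs_of_nonneg h0]
    exact key s (abs_of_pos hs)
  · rw [abs_of_nonpos h0]
    have := key (-s) (by rw [abs_neg, abs_of_pos hs])
    linarith

variable (P) in
-- Take `s` to be a small multiple of `ε^{xγ}`. The entropy contributes `ε^{γ(1-x)}`, which is
-- `o(ε^{xγ})` exactly when `x < 1/2`. The result is that `n_1 - z_s` falls below any prescribed
-- multiple of `l^{-γ}` for all `l ≤ l_0`, as required for the tails of `ω(n_1)`.
lemma eventually_abs_sub_zs_le (K : ℝ) {x c : ℝ} (hx : 0 < x) (hx2 : x < 1 / 2) (hc : 0 < c) :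
    ∀ᶠ ε : ℝ in 𝓝[>] 0, ∀ ρ₀ n, P.IsState ρ₀ K ε n → |n 1 - P.zs| ≤ c * ε ^ (x * P.γ) := by
  have hz := P.zs_pos
  have hγ := P.γ_pos
  set s₀ := min 1 (c / (2 * P.zs)) with hs₀
  have hs0 : 0 < s₀ := lt_min one_pos (by positivity)
  have hs1 : s₀ ≤ 1 := min_le_left _ _
  have hs2 : P.zs * s₀ ≤ c / 2 := by
    have : s₀ ≤ c / (2 * P.zs) := min_le_right _ _
    rw [le_div_iff₀ (by positivity)] at this
    linarith
  filter_upwards [eventually_mem_Ioc,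
    eventually_mul_rpow_le (p := P.γ * (1 - 2 * x)) (mul_pos hγ (by linarith)) |K|
      (s := s₀ * c / 2) (by positivity)] with ε ⟨hε, hε1⟩ hK ρ₀ n h
  have hX : 0 < ε ^ (x * P.γ) := by positivity
  have hX1 : ε ^ (x * P.γ) ≤ 1 := Real.rpow_le_one hε.le hε1 (by positivity)
  have h1 := h.abs_sub_zs_le hε (s := s₀ * ε ^ (x * P.γ)) (by positivity) (by nlinarith)
  have e : ε ^ P.γ = ε ^ (P.γ * (1 - 2 * x)) * ε ^ (x * P.γ) * ε ^ (x * P.γ) := by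
    rw [← Real.rpow_add hε, ← Real.rpow_add hε]
    congr 1
    ring
  have h2 : |K| * ε ^ P.γ / (s₀ * ε ^ (x * P.γ)) ≤ c / 2 * ε ^ (x * P.γ) := by
    rw [div_le_iff₀ (by positivity), e]
    have := mul_le_mul_of_nonneg_right hK (mul_pos hX hX).le
    linarith
  nlinarith

variable (P) in
/-- The quasistationary estimate for a single state. -/
lemma exists_relEntropyOn_mic_le :
    ∃ C : ℝ, 0 < C ∧ ∀ K x : ℝ, 0 < x → x < 1 / 2 → ∀ᶠ ε : ℝ in 𝓝[>] 0, ∀ ρ₀ n, P.IsState ρ₀ K ε n →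
      relEntropyOn (micSizes x ε) n (P.ω (n 1))
        ≤ ENNReal.ofReal (C * ε ^ (-(x * (1 - P.α + P.γ)))) * P.dissipationOn (micSizes x ε) n := by
  have hz := P.zs_pos
  have hγ := P.γ_pos
  have hq := P.q_pos
  have hα1 := P.α_lt_one
  obtain ⟨Cω, hCω, hω⟩ := P.exists_ω_le
  have he1 : 0 < Real.exp 1 - 1 := by linarith [Real.add_one_le_exp (1 : ℝ)]
  obtain ⟨C, hC, hmain⟩ := P.exists_relEntropyOn_le (1 + Cω * (Real.exp 1 - 1))
  refine ⟨C, hC, fun K x hx hx2 => ?_⟩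
  have hc : 0 < min (P.q / 2) (P.zs / 2) := lt_min (by positivity) (by positivity)
  filter_upwards [eventually_mem_Ioc, P.eventually_abs_sub_zs_le K hx hx2 hc,
    eventually_mul_rpow_le hγ |K| one_pos] with ε ⟨hε, hε1⟩ hn1 hK ρ₀ n h
  have hcut := one_le_cutoff hx hε hε1
  obtain ⟨N, hN⟩ : ∃ N, cutoff x ε = N + 1 := ⟨cutoff x ε - 1, by omega⟩
  unfold micSizes
  rw [hN]
  rcases Nat.eq_zero_or_pos N with rfl | hNpos
  · simp [relEntropyOn]
  have hN1 : (1 : ℝ) ≤ N := by exact_mod_cast hNpos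
  have h1 := hn1 ρ₀ n h
  have hX := rpow_mul_le_rpow_neg (x := x) hε hγ hNpos (by omega : N ≤ cutoff x ε)
  have hX0 : 0 < ε ^ (x * P.γ) := by positivity
  have hu1 : (N : ℝ) ^ (-P.γ) ≤ 1 := Real.rpow_le_one_of_one_le_of_nonpos hN1 (by linarith)
  set u := (N : ℝ) ^ (-P.γ)
  have hcq : min (P.q / 2) (P.zs / 2) ≤ P.q / 2 := min_le_left _ _
  have hcz : min (P.q / 2) (P.zs / 2) ≤ P.zs / 2 := min_le_right _ _
  set c := min (P.q / 2) (P.zs / 2)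
  have hcu : c * ε ^ (x * P.γ) ≤ c * u := by gcongr
  rw [abs_le] at h1
  refine (hmain N n hNpos h.nonneg (fun l hl => ?_) (by nlinarith) (by nlinarith) (by nlinarith)).trans ?_
  · refine (h.le_of_energy_le_one hε hK hl).trans ?_
    have := hω l
    gcongr
  · gcongr
    have h2 : (N : ℝ) ≤ ε ^ (-x) := by
      have := cutoff_le (x := x) hε
      rw [hN] at this
      push_cast at this
      linarith
    have h3 := Real.rpow_le_rpow (by linarith) h2 (by linarith : 0 ≤ 1 - P.α + P.γ)
    rwa [← Real.rpow_mul hε.le, neg_mul] at h3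

variable (P) in
/-- The mass of small clusters is close to the critical one. -/
lemma exists_abs_sum_mic_mass_le :
    ∃ C : ℝ, 0 < C ∧ ∀ K x : ℝ, 0 < x → ∀ ε, 0 < ε → ε ≤ 1 → ∀ ρ₀ n, P.IsState ρ₀ K ε n →
      |∑ l ∈ Finset.Ico 1 (cutoff x ε), (l : ℝ) * (n l - P.ω P.zs l)|
        ≤ C * (|K| + 1) * (ε ^ (P.γ * (1 - x)) + ε ^ (x * P.γ)) := by
  have hd := P.decay_pos
  have hγ := P.γ_pos
  have hsum := P.summable_rpow_mul_ω_mul_exp (s := P.decay / 2) (by linarith) 2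
  set M := ∑' l : ℕ, (l : ℝ) ^ (2 : ℝ) * (P.ω P.zs l * Real.exp (P.decay / 2 * (l : ℝ) ^ (1 - P.γ)))
  have hterm : ∀ l : ℕ, 0 ≤ (l : ℝ) ^ (2 : ℝ) *
      (P.ω P.zs l * Real.exp (P.decay / 2 * (l : ℝ) ^ (1 - P.γ))) := fun l => by
    have := P.ω_pos P.zs_pos l
    positivity
  have hM : 0 ≤ M := tsum_nonneg hterm
  refine ⟨2 / P.decay + P.decay / 2 * M, by positivity, fun K x hx ε hε hε1 ρ₀ n h => ?_⟩
  -- The test sequence is `±s l`. Below the cut-off `ε^{xγ} ≤ l^{-γ}`, so `s l ≤ (decay/2) l^{1-γ}`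
  -- and the exponential remains summable against `ω`.
  set s := P.decay / 2 * ε ^ (x * P.γ) with hs
  have hX : 0 < ε ^ (x * P.γ) := by positivity
  have hs0 : 0 < s := by positivity
  set S := ∑ l ∈ Finset.Ico 1 (cutoff x ε), (l : ℝ) * (n l - P.ω P.zs l) with hS
  have key : ∀ y : ℝ, |y| = s → S * y ≤ |K| * ε ^ P.γ + s ^ 2 * M := by
    intro y hy
    have h1 := h.sum_mul_le hε (Finset.Ico 1 (cutoff x ε)) (fun l hl => (Finset.mem_Ico.1 hl).1)
      (fun l => (l : ℝ) * y)
    have h2 : ∑ l ∈ Finset.Ico 1 (cutoff x ε),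
        P.ω P.zs l * (Real.exp ((l : ℝ) * y) - 1 - (l : ℝ) * y) ≤ s ^ 2 * M := by
      refine le_trans ?_ (mul_le_mul_of_nonneg_left
        (hsum.sum_le_tsum (Finset.Ico 1 (cutoff x ε)) fun l _ => hterm l) (sq_nonneg s))
      rw [Finset.mul_sum]
      refine Finset.sum_le_sum fun l hl => ?_
      have hl' := Finset.mem_Ico.1 hl
      have hlr : (0 : ℝ) < l := by exact_mod_cast hl'.1
      have hw := P.ω_pos P.zs_pos l
      have h3 := exp_sub_one_sub_le ((l : ℝ) * y)
      have h4 : |(l : ℝ) * y| ≤ P.decay / 2 * (l : ℝ) ^ (1 - P.γ) := by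
        rw [abs_mul, hy, abs_of_pos hlr, hs, sub_eq_add_neg, Real.rpow_add hlr, Real.rpow_one]
        have := rpow_mul_le_rpow_neg (x := x) hε hγ hl'.1 hl'.2.le
        calc (l : ℝ) * (P.decay / 2 * ε ^ (x * P.γ)) ≤ (l : ℝ) * (P.decay / 2 * (l : ℝ) ^ (-P.γ)) := by
              gcongr
          _ = _ := by ring
      have h5 : ((l : ℝ) * y) ^ 2 = (l : ℝ) ^ 2 * s ^ 2 := by rw [mul_pow, ← sq_abs y, hy]
      rw [h5] at h3
      have h6 := Real.exp_le_exp.2 h4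
      calc P.ω P.zs l * (Real.exp ((l : ℝ) * y) - 1 - (l : ℝ) * y)
          ≤ P.ω P.zs l * ((l : ℝ) ^ 2 * s ^ 2 * Real.exp (P.decay / 2 * (l : ℝ) ^ (1 - P.γ))) := by
            gcongr
            refine h3.trans ?_
            gcongr
        _ = _ := by rw [Real.rpow_two]; ring
    have e1 : S * y = ∑ l ∈ Finset.Ico 1 (cutoff x ε), n l * ((l : ℝ) * y)
        - ∑ l ∈ Finset.Ico 1 (cutoff x ε), P.ω P.zs l * ((l : ℝ) * y) := by
      rw [hS, Finset.sum_mul, ← Finset.sum_sub_distrib]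
      exact Finset.sum_congr rfl fun l _ => by ring
    have e2 : ∑ l ∈ Finset.Ico 1 (cutoff x ε),
        P.ω P.zs l * (Real.exp ((l : ℝ) * y) - 1 - (l : ℝ) * y)
        = ∑ l ∈ Finset.Ico 1 (cutoff x ε), P.ω P.zs l * (Real.exp ((l : ℝ) * y) - 1)
          - ∑ l ∈ Finset.Ico 1 (cutoff x ε), P.ω P.zs l * ((l : ℝ) * y) := by
      rw [← Finset.sum_sub_distrib]
      exact Finset.sum_congr rfl fun l _ => by ring
    linarith
  have h1 : |S| * s ≤ |K| * ε ^ P.γ + s ^ 2 * M := by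
    rcases le_total 0 S with h0 | h0
    · rw [abs_of_nonneg h0]
      exact key s (abs_of_pos hs0)
    · rw [abs_of_nonpos h0]
      have := key (-s) (by rw [abs_neg, abs_of_pos hs0])
      linarith
  have e : ε ^ P.γ = ε ^ (P.γ * (1 - x)) * ε ^ (x * P.γ) := by
    rw [← Real.rpow_add hε]
    congr 1
    ring
  have h2 : |S| ≤ 2 / P.decay * |K| * ε ^ (P.γ * (1 - x)) + P.decay / 2 * M * ε ^ (x * P.γ) := by
    refine le_of_mul_le_mul_right (h1.trans (le_of_eq ?_)) hs0
    rw [e, hs]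
    field_simp
  have hY : 0 < ε ^ (P.γ * (1 - x)) := by positivity
  have hK := abs_nonneg K
  have hd2 : 0 < 2 / P.decay := by positivity
  have hdM : 0 ≤ P.decay / 2 * M := by positivity
  refine h2.trans ?_
  nlinarith [mul_nonneg hd2.le hY.le, mul_nonneg hd2.le hX.le, mul_nonneg hdM hX.le,
    mul_nonneg hdM hY.le, mul_nonneg (mul_nonneg hd2.le hX.le) hK,
    mul_nonneg (mul_nonneg hdM hX.le) hK, mul_nonneg (mul_nonneg hdM hY.le) hK]

variable (P) in
/-- Stretched exponential moments of the equilibrium over large sizes are smaller than any power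
of `ε`. -/
lemma exists_sum_ω_mul_exp_le {s x : ℝ} (hs : s < P.decay) (hx : 0 < x) {p : ℝ} (hp : 0 < p) :
    ∃ C : ℝ, 0 < C ∧ ∀ ε, 0 < ε → ε ≤ 1 → ∀ S : Finset ℕ, (∀ l ∈ S, (cutoff x ε : ℝ) / 3 ≤ l) →
      ∑ l ∈ S, P.ω P.zs l * Real.exp (s * (l : ℝ) ^ (1 - P.γ)) ≤ C * ε ^ p := by
  have hsum := P.summable_rpow_mul_ω_mul_exp hs (p / x)
  set M := ∑' l : ℕ, (l : ℝ) ^ (p / x) * (P.ω P.zs l * Real.exp (s * (l : ℝ) ^ (1 - P.γ)))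
  have hterm : ∀ l : ℕ, 0 ≤ (l : ℝ) ^ (p / x) *
      (P.ω P.zs l * Real.exp (s * (l : ℝ) ^ (1 - P.γ))) := fun l => by
    have := P.ω_pos P.zs_pos l
    positivity
  have hM : 0 ≤ M := tsum_nonneg hterm
  refine ⟨6 ^ (p / x) * (M + 1), by positivity, fun ε hε hε1 S hS => ?_⟩
  have hle := hsum.sum_le_tsum S fun l _ => hterm l
  calc ∑ l ∈ S, P.ω P.zs l * Real.exp (s * (l : ℝ) ^ (1 - P.γ))
      ≤ ∑ l ∈ S, 6 ^ (p / x) * ε ^ p *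
          ((l : ℝ) ^ (p / x) * (P.ω P.zs l * Real.exp (s * (l : ℝ) ^ (1 - P.γ)))) := by
        refine Finset.sum_le_sum fun l hl => ?_
        have hw := P.ω_pos P.zs_pos l
        -- Hence `(6l)^{p/x} ε^p ≥ 1` can be inserted into each term. The threshold `l_0/3` instead
        -- of `l_0` leaves room for the ramp weight used later.
        have h1 : ε ^ (-x) ≤ 6 * l := by
          have := rpow_neg_le_two_mul_cutoff hx hε hε1
          have := hS l hl
          linarith
        have h2 := Real.rpow_le_rpow (by positivity) h1 (by positivity : 0 ≤ p / x)
        rw [← Real.rpow_mul hε.le, Real.mul_rpow (by norm_num) (by positivity)] at h2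
        have e : -x * (p / x) = -p := by field_simp
        rw [e] at h2
        have h3 : 1 ≤ 6 ^ (p / x) * ε ^ p * (l : ℝ) ^ (p / x) := by
          have h4 : ε ^ p * ε ^ (-p) = 1 := by rw [← Real.rpow_add hε]; simp
          have := mul_le_mul_of_nonneg_left h2 (by positivity : 0 ≤ ε ^ p)
          linarith
        rw [← mul_assoc]
        exact le_mul_of_one_le_left (by positivity) h3
    _ ≤ 6 ^ (p / x) * ε ^ p * M := by
        rw [← Finset.mul_sum]
        gcongr
    _ ≤ _ := by
        have : 0 < 6 ^ (p / x) * ε ^ p := by positivity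
        nlinarith

variable (P) in
/-- The energy controls `∑ l^{1-γ} n_l` over large sizes. -/
lemma exists_sum_rpow_mul_le (K : ℝ) {x : ℝ} (hx : 0 < x) :
    ∃ C : ℝ, 0 < C ∧ ∀ ε, 0 < ε → ε ≤ 1 → ∀ ρ₀ n, P.IsState ρ₀ K ε n →
      ∀ S : Finset ℕ, (∀ l ∈ S, (cutoff x ε : ℝ) / 3 ≤ l) →
        ∑ l ∈ S, (l : ℝ) ^ (1 - P.γ) * n l ≤ C * ε ^ P.γ := by
  have hd := P.decay_pos
  obtain ⟨C, hC, hmain⟩ := P.exists_sum_ω_mul_exp_le (s := P.decay / 2) (by linarith) hx P.γ_pos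
  refine ⟨2 / P.decay * (|K| + C), by positivity, fun ε hε hε1 ρ₀ n h S hS => ?_⟩
  have hcut : (1 : ℝ) ≤ cutoff x ε := by exact_mod_cast one_le_cutoff hx hε hε1
  have hS1 : ∀ l ∈ S, 1 ≤ l := by
    intro l hl
    have := hS l hl
    have : (0 : ℝ) < l := by linarith
    exact_mod_cast this
  -- Half the decay rate of `ω` is subcritical, so the exponential moment over large sizes is of
  -- order `ε^γ` at most.
  have h1 := h.sum_mul_le hε S hS1 (fun l => P.decay / 2 * (l : ℝ) ^ (1 - P.γ))
  have h2 := hmain ε hε hε1 S hS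
  have h3 : ∑ l ∈ S, P.ω P.zs l * (Real.exp (P.decay / 2 * (l : ℝ) ^ (1 - P.γ)) - 1)
      ≤ ∑ l ∈ S, P.ω P.zs l * Real.exp (P.decay / 2 * (l : ℝ) ^ (1 - P.γ)) :=
    Finset.sum_le_sum fun l _ => mul_le_mul_of_nonneg_left (by linarith) (P.ω_pos P.zs_pos l).le
  have e : ∑ l ∈ S, n l * (P.decay / 2 * (l : ℝ) ^ (1 - P.γ))
      = P.decay / 2 * ∑ l ∈ S, (l : ℝ) ^ (1 - P.γ) * n l := by
    rw [Finset.mul_sum]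
    exact Finset.sum_congr rfl fun l _ => by ring
  rw [e] at h1
  refine le_of_mul_le_mul_left (a := P.decay / 2) ?_ (by positivity)
  have e2 : P.decay / 2 * (2 / P.decay * (|K| + C) * ε ^ P.γ) = |K| * ε ^ P.γ + C * ε ^ P.γ := by
    field_simp
  linarith

/-- Changing the reference equilibrium from `ω(n_1)` to `ω(z_s)`. -/
lemma IsState.freeEnergyOn_mic_le (h : P.IsState ρ₀ K ε n) (h1 : 0 < n 1) (N : ℕ) :
    P.freeEnergyOn (Set.Ico 1 N) n ≤ relEntropyOn (Set.Ico 1 N) n (P.ω (n 1)) +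
      ENNReal.ofReal (|Real.log (n 1 / P.zs)| *
        |∑ l ∈ Finset.Ico 1 N, (l : ℝ) * (n l - P.ω P.zs l)|) := by
  have hz := P.zs_pos
  unfold freeEnergyOn relEntropyOn
  rw [tsum_Ico_eq_sum (fun l => entropyTerm (n l) (P.ω P.zs l)),
    tsum_Ico_eq_sum (fun l => entropyTerm (n l) (P.ω (n 1) l))]
  have hterm : ∀ l ∈ Finset.Ico 1 N, 0 ≤ P.ω (n 1) l * psi (n l / P.ω (n 1) l) := fun l hl => by
    have hw := P.ω_pos h1 l
    exact mul_nonneg hw.le (psi_nonneg (div_nonneg (h.nonneg l (Finset.mem_Ico.1 hl).1) hw.le))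
  rw [Finset.sum_congr rfl fun l _ => entropyTerm_of_pos (P.ω_pos hz l),
    Finset.sum_congr rfl fun l _ => entropyTerm_of_pos (P.ω_pos h1 l),
    ← ENNReal.ofReal_sum_of_nonneg hterm, ← ENNReal.ofReal_sum_of_nonneg
      fun l hl => h.term_nonneg (Finset.mem_Ico.1 hl).1,
    ← ENNReal.ofReal_add (Finset.sum_nonneg hterm) (by positivity)]
  refine ENNReal.ofReal_le_ofReal ?_
  have hstep : ∀ l ∈ Finset.Ico 1 N, P.ω P.zs l * psi (n l / P.ω P.zs l)
      ≤ P.ω (n 1) l * psi (n l / P.ω (n 1) l)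
        + Real.log (n 1 / P.zs) * ((l : ℝ) * (n l - P.ω P.zs l)) := by
    intro l hl
    have hw := P.ω_pos hz l
    have hw1 := P.ω_pos h1 l
    have hn := h.nonneg l (Finset.mem_Ico.1 hl).1
    -- Comparing the two equilibria by `e^y ≥ 1 + y` leaves `log(n_1/z_s)` multiplied by the
    -- deviation of the mass from equilibrium, which is small, and not by the mass itself.
    have hexp : P.ω P.zs l * (1 + l * Real.log (n 1 / P.zs)) ≤ P.ω (n 1) l := by
      rw [P.ω_eq_mul_div_pow (z := n 1)]
      refine mul_le_mul_of_nonneg_left ?_ hw.le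
      have := Real.add_one_le_exp (l * Real.log (n 1 / P.zs))
      rw [Real.exp_nat_mul, Real.exp_log (by positivity)] at this
      linarith
    have hpsi : ∀ w : ℝ, 0 < w → w * psi (n l / w) = n l * Real.log (n l / w) - n l + w := by
      intro w hw
      unfold psi
      field_simp
    rw [hpsi _ hw, hpsi _ hw1]
    have hlog : n l * Real.log (n l / P.ω P.zs l)
        = n l * Real.log (n l / P.ω (n 1) l) + n l * (l * Real.log (n 1 / P.zs)) := by
      rcases hn.eq_or_lt with h0 | h0
      · rw [← h0]; simp
      · rw [Real.log_div h0.ne' hw.ne', Real.log_div h0.ne' hw1.ne', P.ω_eq_mul_div_pow (z := n 1),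
          Real.log_mul hw.ne' (by positivity), Real.log_pow]
        ring
    rw [hlog]
    linarith
  refine (Finset.sum_le_sum hstep).trans ?_
  rw [Finset.sum_add_distrib, ← Finset.mul_sum, ← abs_mul]
  linarith [le_abs_self (Real.log (n 1 / P.zs) *
    ∑ l ∈ Finset.Ico 1 N, (l : ℝ) * (n l - P.ω P.zs l))]

end Rates

/-! ### The energy of large clusters -/

lemma tsum_subtype_ofReal_le {I : Set ℕ} {f : ℕ → ℝ} {B : ℝ} (hf : ∀ l ∈ I, 0 ≤ f l)
    (h : ∀ S : Finset ℕ, (∀ l ∈ S, l ∈ I) → ∑ l ∈ S, f l ≤ B) :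
    ∑' l : I, ENNReal.ofReal (f l) ≤ ENNReal.ofReal B := by
  rw [ENNReal.tsum_eq_iSup_sum]
  refine iSup_le fun S => ?_
  rw [← ENNReal.ofReal_sum_of_nonneg (f := fun l : I => f l) fun l _ => hf l l.2]
  refine ENNReal.ofReal_le_ofReal ?_
  have := h (S.map (Function.Embedding.subtype _)) (by
    intro l hl
    obtain ⟨a, _, rfl⟩ := Finset.mem_map.1 hl
    exact a.2)
  rwa [Finset.sum_map] at this

lemma lintegral_macMeasure (x ε : ℝ) (n : ℕ → ℝ) (f : ℝ → ℝ≥0∞) :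
    ∫⁻ y, f y ∂(macMeasure x ε n)
      = ∑' l : macSizes x ε, ENNReal.ofReal (n l / ε) * f (ε * (l : ℕ)) := by
  unfold macMeasure
  rw [lintegral_sum_measure]
  refine tsum_congr fun l => ?_
  rw [lintegral_smul_measure, lintegral_dirac, smul_eq_mul]

lemma setLIntegral_macMeasure (x ε : ℝ) (n : ℕ → ℝ) (f : ℝ → ℝ≥0∞) {s : Set ℝ}
    (hs : MeasurableSet s) :
    ∫⁻ y in s, f y ∂(macMeasure x ε n)
      = ∑' l : macSizes x ε, ENNReal.ofReal (n l / ε) * s.indicator f (ε * (l : ℕ)) := by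
  rw [← lintegral_indicator hs, lintegral_macMeasure]

namespace Rates

variable {P : Rates} {ρ₀ K ε : ℝ} {n : ℕ → ℝ}

variable (P) in
-- The coefficient `q/(1-γ)` is `z_s` times the decay rate, and `(εl)^{1-γ}/ε = ε^{-γ} l^{1-γ}`. The
-- summands can thus be compared with those of the entropy one by one.
lemma macEnergy_macMeasure {x : ℝ} (hx : 0 < x) (h0 : 0 < ε) (h1 : ε ≤ 1) (n : ℕ → ℝ) :
    P.macEnergy (macMeasure x ε n) = ∑' l : macSizes x ε,
      ENNReal.ofReal (P.zs * ε ^ (-P.γ) * (P.decay * (l : ℝ) ^ (1 - P.γ) * n l)) := by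
  have hz := P.zs_pos
  have hq := P.q_pos
  have hγ1 := P.γ_lt_one
  have hq' : 0 < P.q / (1 - P.γ) := div_pos hq (by linarith)
  unfold macEnergy
  rw [setLIntegral_macMeasure _ _ _ _ measurableSet_Ioi, ← ENNReal.tsum_mul_left]
  refine tsum_congr fun l => ?_
  have hl : (0 : ℝ) < (l : ℕ) := by
    have := one_le_cutoff hx h0 h1
    have h2 : cutoff x ε ≤ (l : ℕ) := l.2
    exact_mod_cast (by omega : 0 < (l : ℕ))
  rw [Set.indicator_of_mem (Set.mem_Ioi.2 (by positivity)), mul_comm (ENNReal.ofReal (n l / ε)),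
    ← ENNReal.ofReal_mul (by positivity), ← ENNReal.ofReal_mul hq'.le]
  congr 1
  rw [Real.mul_rpow h0.le hl.le, sub_eq_add_neg 1 P.γ, Real.rpow_add h0, Real.rpow_one]
  unfold decay
  have : 1 - P.γ ≠ 0 := by linarith
  rw [← sub_eq_add_neg 1 P.γ]
  field_simp

lemma third_le_of_mem_macSizes {x : ℝ} {l : ℕ} (hl : l ∈ macSizes x ε) :
    (cutoff x ε : ℝ) / 3 ≤ l := by
  have h : (cutoff x ε : ℝ) ≤ l := by exact_mod_cast (Set.mem_Ici.1 hl)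
  have : (0 : ℝ) ≤ cutoff x ε := Nat.cast_nonneg _
  linarith

variable (P) in
/-- The mass of large but not macroscopic clusters is small. -/
lemma exists_sum_mass_le (K : ℝ) {x : ℝ} (hx : 0 < x) :
    ∃ C : ℝ, 0 < C ∧ ∀ ε, 0 < ε → ε ≤ 1 → ∀ ρ₀ n, P.IsState ρ₀ K ε n →
      ∀ R, 0 < R → ∀ S : Finset ℕ, (∀ l ∈ S, (cutoff x ε : ℝ) / 3 ≤ l) → (∀ l ∈ S, ε * l ≤ R) →
        ∑ l ∈ S, (l : ℝ) * n l ≤ C * R ^ P.γ := by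
  have hγ := P.γ_pos
  obtain ⟨C, hC, hmain⟩ := P.exists_sum_rpow_mul_le K hx
  refine ⟨C, hC, fun ε h0 h1 ρ₀ n h R hR S hS hSR => ?_⟩
  have hcut : (1 : ℝ) ≤ cutoff x ε := by exact_mod_cast one_le_cutoff hx h0 h1
  have h2 := hmain ε h0 h1 ρ₀ n h S hS
  calc ∑ l ∈ S, (l : ℝ) * n l ≤ ∑ l ∈ S, (R / ε) ^ P.γ * ((l : ℝ) ^ (1 - P.γ) * n l) := by
        refine Finset.sum_le_sum fun l hl => ?_
        have hl0 : (0 : ℝ) < l := by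
          have := hS l hl
          linarith
        have hn := h.nonneg l (by exact_mod_cast hl0)
        have e : (l : ℝ) = (l : ℝ) ^ P.γ * (l : ℝ) ^ (1 - P.γ) := by
          rw [← Real.rpow_add hl0]; simp
        have h3 : (l : ℝ) ^ P.γ ≤ (R / ε) ^ P.γ := by
          refine Real.rpow_le_rpow hl0.le ?_ hγ.le
          rw [le_div_iff₀ h0, mul_comm]
          exact hSR l hl
        rw [← mul_assoc]
        refine mul_le_mul_of_nonneg_right ?_ hn
        nth_rewrite 1 [e]
        gcongr
    _ ≤ (R / ε) ^ P.γ * (C * ε ^ P.γ) := by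
        rw [← Finset.mul_sum]
        gcongr
    _ = _ := by
        rw [Real.div_rpow hR.le h0.le]
        field_simp

lemma freeEnergyResc_eq_tsum {I : Set ℕ} (ε : ℝ) (hε : 0 < ε) (n : ℕ → ℝ) :
    P.freeEnergyResc ε I n = ∑' l : I,
      ENNReal.ofReal (P.zs * ε ^ (-P.γ) * (P.ω P.zs l * psi (n l / P.ω P.zs l))) := by
  have hz := P.zs_pos
  unfold freeEnergyResc freeEnergyOn relEntropyOn
  rw [← ENNReal.tsum_mul_left]
  refine tsum_congr fun l => ?_
  rw [entropyTerm_of_pos (P.ω_pos hz l), ← ENNReal.ofReal_mul (by positivity)]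

variable (P) in
lemma exists_tsum_ω_mul_exp_le {s x : ℝ} (hs : s < P.decay) (hx : 0 < x) :
    ∃ C : ℝ, 0 < C ∧ ∀ ε, 0 < ε → ε ≤ 1 → ∑' l : macSizes x ε, ENNReal.ofReal
      (P.zs * ε ^ (-P.γ) * (P.ω P.zs l * Real.exp (s * (l : ℝ) ^ (1 - P.γ)))) ≤ ENNReal.ofReal (C * ε ^ (1 : ℝ)) := by
  have hz := P.zs_pos
  obtain ⟨C, hC, hmain⟩ := P.exists_sum_ω_mul_exp_le hs hx (p := 1 + P.γ) (by linarith [P.γ_pos])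
  refine ⟨P.zs * C, by positivity, fun ε h0 h1 => ?_⟩
  refine tsum_subtype_ofReal_le
    (f := fun l => P.zs * ε ^ (-P.γ) * (P.ω P.zs l * Real.exp (s * (l : ℝ) ^ (1 - P.γ))))
    (fun l _ => ?_) fun S hS => ?_
  · have := P.ω_pos hz l
    positivity
  · have := hmain ε h0 h1 S fun l hl => third_le_of_mem_macSizes (hS l hl)
    rw [← Finset.mul_sum]
    calc _ ≤ P.zs * ε ^ (-P.γ) * (C * ε ^ (1 + P.γ)) := by gcongr
      _ = P.zs * C * (ε ^ (-P.γ) * ε ^ (1 + P.γ)) := by ring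
      _ = _ := by rw [← Real.rpow_add h0]; congr 2; ring

variable (P) in
-- In `ω ψ(n/ω) = (n log n - n) - n log ω + ω` the bracket is nonpositive since `n ≤ e`, and `-log
-- ω_l ≤ (1+s) c l^{1-γ}` for large `l`, with `c` the decay rate. The sum of `ω` over large sizes
-- vanishes even after division by `ε^γ`.
lemma eventually_freeEnergyResc_mac_le (K : ℝ) {x s : ℝ} (hx : 0 < x) (hs : 0 < s) :
    ∀ᶠ ε : ℝ in 𝓝[>] 0, ∀ ρ₀ n, P.IsState ρ₀ K ε n →
      P.freeEnergyResc ε (macSizes x ε) n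
        ≤ ENNReal.ofReal (1 + s) * P.macEnergy (macMeasure x ε n) + ENNReal.ofReal s := by
  have hz := P.zs_pos
  have hd := P.decay_pos
  obtain ⟨C, hC, hmain⟩ := P.exists_tsum_ω_mul_exp_le (s := 0) hd hx
  have hω0 : ∀ᶠ l : ℕ in atTop, P.ω P.zs l ≤ 1 := by
    have h := P.summable_rpow_mul_ω_mul_exp P.decay_pos 0
    simp only [Real.rpow_zero, zero_mul, Real.exp_zero, mul_one, one_mul] at h
    exact h.tendsto_atTop_zero.eventually (ge_mem_nhds one_pos)
  obtain ⟨L, hL⟩ := eventually_atTop.1 (hω0.and (P.eventually_ω_bounds (mul_pos hs hd)))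
  have hbig : ∀ᶠ ε : ℝ in 𝓝[>] 0, (2 * (L : ℝ)) * ε ^ x ≤ 1 :=
    eventually_mul_rpow_le hx _ one_pos
  filter_upwards [eventually_mem_Ioc, hbig, eventually_mul_rpow_le P.γ_pos |K| one_pos,
    eventually_mul_rpow_le one_pos C hs] with ε ⟨h0, h1⟩ hε hK hCε ρ₀ n h
  have hcut := one_le_cutoff hx h0 h1
  have hLc : L ≤ cutoff x ε := by
    have h2 := rpow_neg_le_two_mul_cutoff hx h0 h1
    rw [Real.rpow_neg h0.le] at h2
    have h3 : 2 * (L : ℝ) ≤ (ε ^ x)⁻¹ := by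
      rw [← one_div, le_div_iff₀ (by positivity)]
      exact hε
    have : (L : ℝ) ≤ cutoff x ε := by linarith
    exact_mod_cast this
  rw [freeEnergyResc_eq_tsum ε h0, P.macEnergy_macMeasure hx h0 h1, ← ENNReal.tsum_mul_left]
  refine le_trans ?_ (add_le_add le_rfl ((hmain ε h0 h1).trans (ENNReal.ofReal_le_ofReal hCε)))
  rw [← ENNReal.tsum_add]
  refine ENNReal.tsum_le_tsum fun l => ?_
  have hl : cutoff x ε ≤ (l : ℕ) := l.2
  have hn := h.nonneg l (by omega)
  have hw := P.ω_pos hz l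
  obtain ⟨hw1, hwl, -⟩ := hL l (by omega)
  rw [← ENNReal.ofReal_mul (by positivity), ← ENNReal.ofReal_add (by positivity) (by positivity)]
  refine ENNReal.ofReal_le_ofReal ?_
  rw [zero_mul, Real.exp_zero, mul_one]
  have hne : n l ≤ Real.exp 1 := by
    have := h.le_of_energy_le_one h0 hK (l := l) (by omega)
    have he1 : 0 < Real.exp 1 - 1 := by linarith [Real.add_one_le_exp (1 : ℝ)]
    nlinarith
  have hlogw : -Real.log (P.ω P.zs l) ≤ (1 + s) * P.decay * (l : ℝ) ^ (1 - P.γ) := by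
    have := (Real.le_log_iff_exp_le hw).2 hwl
    linarith
  have hterm : P.ω P.zs l * psi (n l / P.ω P.zs l)
      ≤ (1 + s) * (P.decay * (l : ℝ) ^ (1 - P.γ) * n l) + P.ω P.zs l := by
    have e : P.ω P.zs l * psi (n l / P.ω P.zs l)
        = n l * Real.log (n l / P.ω P.zs l) - n l + P.ω P.zs l := by
      unfold psi
      field_simp
    rw [e]
    rcases hn.eq_or_lt with hn0 | hn0
    · rw [← hn0]; simp
    · rw [Real.log_div hn0.ne' hw.ne']
      have h5 : Real.log (n l) ≤ 1 := (Real.log_le_iff_le_exp hn0).2 hne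
      nlinarith
  calc P.zs * ε ^ (-P.γ) * (P.ω P.zs l * psi (n l / P.ω P.zs l))
      ≤ P.zs * ε ^ (-P.γ) * ((1 + s) * (P.decay * (l : ℝ) ^ (1 - P.γ) * n l) + P.ω P.zs l) := by
        gcongr
    _ = _ := by ring

variable (P) in
-- Fenchel's inequality with `y = (1-s) c l^{1-γ}`, `c` the decay rate: this is strictly
-- subcritical, so the exponential moment is negligible over large sizes.
lemma eventually_le_freeEnergyResc_mac (K : ℝ) {x s : ℝ} (hx : 0 < x) (hs : 0 < s) (hs1 : s < 1) :
    ∀ᶠ ε : ℝ in 𝓝[>] 0, ∀ ρ₀ n, P.IsState ρ₀ K ε n →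
      ENNReal.ofReal (1 - s) * P.macEnergy (macMeasure x ε n)
        ≤ P.freeEnergyResc ε (macSizes x ε) n + ENNReal.ofReal s := by
  have hz := P.zs_pos
  have hd := P.decay_pos
  obtain ⟨C, hC, hmain⟩ := P.exists_tsum_ω_mul_exp_le (s := (1 - s) * P.decay) (by nlinarith) hx
  filter_upwards [eventually_mem_Ioc, eventually_mul_rpow_le one_pos C hs] with ε ⟨h0, h1⟩ hCε ρ₀ n h
  have hcut := one_le_cutoff hx h0 h1
  rw [freeEnergyResc_eq_tsum ε h0, P.macEnergy_macMeasure hx h0 h1, ← ENNReal.tsum_mul_left]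
  refine le_trans ?_ (add_le_add le_rfl ((hmain ε h0 h1).trans (ENNReal.ofReal_le_ofReal hCε)))
  rw [← ENNReal.tsum_add]
  refine ENNReal.tsum_le_tsum fun l => ?_
  have hl : cutoff x ε ≤ (l : ℕ) := l.2
  have hn := h.nonneg l (by omega)
  have hw := P.ω_pos hz l
  have ht := h.term_nonneg (l := l) (by omega)
  rw [← ENNReal.ofReal_mul (by linarith), ← ENNReal.ofReal_add (by positivity) (by positivity)]
  refine ENNReal.ofReal_le_ofReal ?_
  have hf := mul_le_mul_psi_add hn hw ((1 - s) * P.decay * (l : ℝ) ^ (1 - P.γ))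
  have hX : 0 < P.zs * ε ^ (-P.γ) := by positivity
  have := mul_le_mul_of_nonneg_left hf hX.le
  nlinarith [mul_pos hX hw]

end Rates

namespace Rates

/-! ### Consequences of a bound on the dissipation -/

variable {P : Rates} {ρ₀ K ε : ℝ} {n : ℕ → ℝ}

variable (P) in
lemma b_le_mul_a {l : ℕ} (hl : 1 ≤ l) : P.b l ≤ (2 * P.zs + P.q) * P.a l := by
  have hz := P.zs_pos
  have hq := P.q_pos
  have hl' : (1 : ℝ) ≤ l := by exact_mod_cast hl
  have ha := P.a_pos hl
  have hu : (l : ℝ) ^ (-P.γ) ≤ 1 :=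
    Real.rpow_le_one_of_one_le_of_nonpos hl' (by linarith [P.γ_pos])
  rw [P.b_succ, mul_comm]
  refine mul_le_mul_of_nonneg_right ?_ ha.le
  nlinarith

variable (P) in
lemma dissipationOn_term_ne_top (hD : P.dissipationOn (Set.Ici 1) n ≠ ⊤) {l : ℕ} (hl : 1 ≤ l) :
    dissipationTerm (P.a l * n 1 * n l) (P.b (l + 1) * n (l + 1)) ≠ ⊤ :=
  ENNReal.ne_top_of_tsum_ne_top hD ⟨l, hl⟩

variable (P) in
lemma sum_dissipationTerm_le (hD : P.dissipationOn (Set.Ici 1) n ≠ ⊤) (S : Finset ℕ)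
    (hS : ∀ l ∈ S, 1 ≤ l) :
    ∑ l ∈ S, (dissipationTerm (P.a l * n 1 * n l) (P.b (l + 1) * n (l + 1))).toReal
      ≤ (P.dissipationOn (Set.Ici 1) n).toReal := by
  rw [← ENNReal.toReal_sum fun l hl => P.dissipationOn_term_ne_top hD (hS l hl)]
  refine ENNReal.toReal_mono hD ?_
  unfold dissipationOn
  rw [tsum_subtype (Set.Ici 1)
    (fun l => dissipationTerm (P.a l * n 1 * n l) (P.b (l + 1) * n (l + 1)))]
  refine le_trans (le_of_eq ?_) (ENNReal.sum_le_tsum S)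
  exact Finset.sum_congr rfl fun l hl => by
    rw [Set.indicator_of_mem (Set.mem_Ici.2 (hS l hl))]

lemma sum_mul_shift {f g : ℕ → ℝ} {N : ℕ} (h0 : g 0 = 0) (hN : g N = 0) :
    ∑ l ∈ Finset.Ico 1 N, g l * f (l + 1) = ∑ l ∈ Finset.Ico 1 (N + 1), g (l - 1) * f l := by
  have h1 := Finset.sum_Ico_add' (fun l => g (l - 1) * f l) 1 N 1
  simp only [Nat.add_sub_cancel] at h1
  rw [h1]
  rcases Nat.eq_zero_or_pos N with rfl | hpos
  · simp
  · rw [Finset.sum_eq_sum_Ico_succ_bot (a := 1) (by omega : 1 < N + 1)]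
    simp [h0]

/-- A weighted flux is controlled by the dissipation. -/
lemma IsState.abs_sum_flux_le (h : P.IsState ρ₀ K ε n) (hn1 : n 1 ≤ 2 * P.zs)
    (hD : P.dissipationOn (Set.Ici 1) n ≠ ⊤) {χ : ℕ → ℝ} {N : ℕ} (h0 : χ 0 = 0) (hN : χ N = 0)
    {τ : ℝ} (hτ : 0 < τ) :
    |∑ l ∈ Finset.Ico 1 (N + 1), P.a l * n l *
        (χ l * n 1 - χ (l - 1) * (P.zs + P.q * (l : ℝ) ^ (-P.γ)))|
      ≤ τ * (2 * P.zs + P.q) *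
          ∑ l ∈ Finset.Ico 1 (N + 1), (χ l ^ 2 + χ (l - 1) ^ 2) * (P.a l * n l)
        + (P.dissipationOn (Set.Ici 1) n).toReal / τ := by
  have hz := P.zs_pos
  have hq := P.q_pos
  have hn : ∀ l, 1 ≤ l → 0 ≤ n l := h.nonneg
  have hA : ∀ l, 1 ≤ l → 0 ≤ P.a l * n 1 * n l := fun l hl =>
    mul_nonneg (mul_nonneg (P.a_nonneg l) (hn 1 le_rfl)) (hn l hl)
  have hB : ∀ l, 0 ≤ P.b (l + 1) * n (l + 1) := fun l =>
    mul_nonneg (P.b_nonneg _) (hn _ (by omega))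
  have htop : ∀ f : ℕ → ℝ, ∑ l ∈ Finset.Ico 1 N, χ l * f l = ∑ l ∈ Finset.Ico 1 (N + 1), χ l * f l := by
    intro f
    rcases Nat.eq_zero_or_pos N with rfl | hpos
    · simp
    · rw [Finset.sum_Ico_succ_top hpos, hN, zero_mul, add_zero]
  have htop2 : ∀ f : ℕ → ℝ,
      ∑ l ∈ Finset.Ico 1 N, χ l ^ 2 * f l = ∑ l ∈ Finset.Ico 1 (N + 1), χ l ^ 2 * f l := by
    intro f
    rcases Nat.eq_zero_or_pos N with rfl | hpos
    · simp
    · rw [Finset.sum_Ico_succ_top hpos, hN, zero_pow two_ne_zero, zero_mul, add_zero]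
  -- Summation by parts, moving the weight of the fragmentation rate from size `l + 1` to size `l`;
  -- there are no boundary terms as `χ` vanishes at both ends.
  have e1 : ∑ l ∈ Finset.Ico 1 (N + 1), P.a l * n l *
        (χ l * n 1 - χ (l - 1) * (P.zs + P.q * (l : ℝ) ^ (-P.γ)))
      = ∑ l ∈ Finset.Ico 1 N, χ l * (P.a l * n 1 * n l - P.b (l + 1) * n (l + 1)) := by
    simp only [mul_sub (χ _)]
    rw [Finset.sum_sub_distrib, sum_mul_shift (f := fun l => P.b l * n l) h0 hN, htop,
      ← Finset.sum_sub_distrib]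
    refine Finset.sum_congr rfl fun l _ => ?_
    rw [P.b_succ]
    ring
  rw [e1]
  refine (Finset.abs_sum_le_sum_abs _ _).trans ?_
  refine (Finset.sum_le_sum fun l hl => abs_mul_sub_le_dissipationTerm
    (hA l (Finset.mem_Ico.1 hl).1) (hB l)
    (P.dissipationOn_term_ne_top hD (Finset.mem_Ico.1 hl).1) (χ l) hτ).trans ?_
  rw [Finset.sum_add_distrib, ← Finset.sum_div]
  refine add_le_add ?_ (div_le_div_of_nonneg_right
    (P.sum_dissipationTerm_le hD _ fun l hl => (Finset.mem_Ico.1 hl).1) hτ.le)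
  have e2 : ∑ l ∈ Finset.Ico 1 (N + 1), (χ l ^ 2 + χ (l - 1) ^ 2) * (P.a l * n l)
      = ∑ l ∈ Finset.Ico 1 N, χ l ^ 2 * (P.a l * n l + P.a (l + 1) * n (l + 1)) := by
    simp only [mul_add, add_mul]
    rw [Finset.sum_add_distrib, Finset.sum_add_distrib,
      sum_mul_shift (f := fun l => P.a l * n l) (g := fun l => χ l ^ 2) (by simp [h0]) (by simp [hN]),
      htop2]
  rw [e2, mul_assoc, Finset.mul_sum, Finset.mul_sum]
  refine Finset.sum_le_sum fun l hl => ?_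
  have hl' := (Finset.mem_Ico.1 hl).1
  have h2 : P.a l * n 1 * n l ≤ (2 * P.zs + P.q) * (P.a l * n l) := by
    have := mul_nonneg (P.a_nonneg l) (hn l hl')
    nlinarith
  have h3 : P.b (l + 1) * n (l + 1) ≤ (2 * P.zs + P.q) * (P.a (l + 1) * n (l + 1)) := by
    have := mul_le_mul_of_nonneg_right (P.b_le_mul_a (l := l + 1) (by omega)) (hn (l + 1) (by omega))
    linarith
  have : 0 ≤ τ * χ l ^ 2 := by positivity
  nlinarith

lemma IsState.sum_mass_le (h : P.IsState ρ₀ K ε n) (S : Finset ℕ) :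
    ∑ l ∈ S, (l : ℝ) * n l ≤ ρ₀ := by
  refine sum_le_hasSum S (fun l _ => ?_) h.mass
  rcases Nat.eq_zero_or_pos l with rfl | hl
  · simp
  · exact mul_nonneg (Nat.cast_nonneg l) (h.nonneg l hl)

lemma IsState.mass_nonneg (h : P.IsState ρ₀ K ε n) : 0 ≤ ρ₀ := by
  simpa using h.sum_mass_le ∅

variable (P) in
lemma dissipationOn_eq {I : Set ℕ} (hε : 0 < ε) (n : ℕ → ℝ) :
    (P.dissipationOn I n).toReal
      = ε ^ (1 - P.α + 2 * P.γ) / P.zs * (P.dissipationResc ε I n).toReal := by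
  have hz := P.zs_pos
  unfold dissipationResc
  rw [ENNReal.toReal_mul, ENNReal.toReal_ofReal (by positivity), Real.rpow_neg hε.le]
  field_simp

variable (P) in
lemma dissipationOn_ne_top {I : Set ℕ} (hε : 0 < ε) {n : ℕ → ℝ}
    (h : P.dissipationResc ε I n ≠ ⊤) : P.dissipationOn I n ≠ ⊤ := by
  have hz := P.zs_pos
  intro htop
  apply h
  unfold dissipationResc
  rw [htop, ENNReal.mul_top]
  simpa using by positivity

/-- A piecewise linear cut-off, equal to `1` on `[δ, R]` and supported in `[δ/2, 2R]`. -/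
def plateau (δ R y : ℝ) : ℝ := max 0 (min 1 (min (2 * y / δ - 1) (2 - y / R)))

lemma plateau_nonneg (δ R y : ℝ) : 0 ≤ plateau δ R y := le_max_left _ _

lemma plateau_le_one (δ R y : ℝ) : plateau δ R y ≤ 1 := max_le zero_le_one (min_le_left _ _)

lemma plateau_eq_one {δ R y : ℝ} (hδ : 0 < δ) (hR : 0 < R) (h1 : δ ≤ y) (h2 : y ≤ R) :
    plateau δ R y = 1 := by
  have a1 : 1 ≤ y / δ := (one_le_div hδ).2 h1
  have a2 : y / R ≤ 1 := (div_le_one hR).2 h2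
  unfold plateau
  rw [min_eq_left, max_eq_right zero_le_one]
  refine le_min ?_ (by linarith)
  rw [mul_div_assoc]
  linarith

lemma plateau_eq_zero_of_le {δ R y : ℝ} (hδ : 0 < δ) (h : y ≤ δ / 2) : plateau δ R y = 0 := by
  unfold plateau
  refine max_eq_left ((min_le_right _ _).trans ((min_le_left _ _).trans ?_))
  have : 2 * y / δ ≤ 1 := (div_le_one hδ).2 (by linarith)
  linarith

lemma plateau_eq_zero_of_ge {δ R y : ℝ} (hR : 0 < R) (h : 2 * R ≤ y) : plateau δ R y = 0 := by
  unfold plateau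
  refine max_eq_left ((min_le_right _ _).trans ((min_le_right _ _).trans ?_))
  have : 2 ≤ y / R := (le_div_iff₀ hR).2 h
  linarith

lemma abs_plateau_sub_le {δ R : ℝ} (hδ : 0 < δ) (hR : δ ≤ R) (y y' : ℝ) :
    |plateau δ R y - plateau δ R y'| ≤ 2 / δ * |y - y'| := by
  have hR0 : 0 < R := hδ.trans_le hR
  have h1 : |(2 * y / δ - 1) - (2 * y' / δ - 1)| ≤ 2 / δ * |y - y'| := by
    have : (2 * y / δ - 1) - (2 * y' / δ - 1) = 2 / δ * (y - y') := by ring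
    rw [this, abs_mul, abs_of_pos (by positivity)]
  have h2 : |(2 - y / R) - (2 - y' / R)| ≤ 2 / δ * |y - y'| := by
    have : (2 - y / R) - (2 - y' / R) = (1 / R) * (y' - y) := by ring
    rw [this, abs_mul, abs_of_pos (by positivity), abs_sub_comm y' y]
    refine mul_le_mul_of_nonneg_right ?_ (abs_nonneg _)
    rw [div_le_div_iff₀ hR0 hδ]
    linarith
  have h3 := (abs_min_sub_min_le_max (2 * y / δ - 1) (2 - y / R) (2 * y' / δ - 1) (2 - y' / R)).trans
    (max_le h1 h2)
  have h4 := (abs_min_sub_min_le_max 1 (min (2 * y / δ - 1) (2 - y / R)) 1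
    (min (2 * y' / δ - 1) (2 - y' / R))).trans (max_le (by rw [sub_self, abs_zero]; positivity) h3)
  exact (abs_max_sub_max_le_max 0 _ 0 _).trans (max_le (by rw [sub_self, abs_zero]; positivity) h4)

set_option maxHeartbeats 1000000 in
variable (P) in
/-- The excess monomer density is of order `ε^γ` up to the dissipation. -/
lemma exists_abs_sub_zs_le {δ R m₀ ρ₀ : ℝ} (hδ : 0 < δ) (hR : δ ≤ R) (hm : 0 < m₀)
    (hρ : 0 < ρ₀) :
    ∃ C : ℝ, 0 < C ∧ ∀ K ε n, 0 < ε → ε ≤ 1 → P.IsState ρ₀ K ε n → n 1 ≤ 2 * P.zs →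
      P.dissipationResc ε (Set.Ici 1) n ≠ ⊤ →
      ∀ S : Finset ℕ, (∀ l ∈ S, δ ≤ ε * l ∧ ε * l ≤ R) → m₀ ≤ ∑ l ∈ S, (l : ℝ) * n l →
      |n 1 - P.zs| ≤ C * ε ^ P.γ * (1 + (P.dissipationResc ε (Set.Ici 1) n).toReal) := by
  have hz := P.zs_pos
  have hq := P.q_pos
  have hγ := P.γ_pos
  have hγ1 := P.γ_lt_one
  have hα := P.α_nonneg
  have hα1 := P.α_lt_one
  have hR0 : 0 < R := hδ.trans_le hR
  set G := (δ / 2) ^ (P.α - 1) * ρ₀ with hG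
  have hG0 : 0 < G := by positivity
  set C₁ := 2 * (2 * P.zs + P.q) * G + 2 * P.zs / δ * G + P.q * (δ / 2) ^ (-P.γ) * G + 1 / P.zs with hC₁
  have hC₁0 : 0 < C₁ := by positivity
  refine ⟨C₁ / (R ^ (P.α - 1) * m₀), by positivity, fun K ε n h0 h1 h hn1 hDt S hS hSm => ?_⟩
  set D := (P.dissipationResc ε (Set.Ici 1) n).toReal with hD
  have hD0 : 0 ≤ D := ENNReal.toReal_nonneg
  have hDne := P.dissipationOn_ne_top h0 hDt
  set χ : ℕ → ℝ := fun l => plateau δ R (ε * l) with hχ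
  set N := ⌈2 * R / ε⌉₊ with hN
  have hNR : ∀ l : ℕ, N ≤ l → 2 * R ≤ ε * l := by
    intro l hl
    have h2 : 2 * R / ε ≤ l := (Nat.le_ceil _).trans (by exact_mod_cast hl)
    rw [div_le_iff₀ h0] at h2
    linarith
  have hχ0 : χ 0 = 0 := by
    simp only [hχ, Nat.cast_zero, mul_zero]
    exact plateau_eq_zero_of_le hδ (by positivity)
  have hχN : χ N = 0 := plateau_eq_zero_of_ge hR0 (hNR N le_rfl)
  have hX : 0 < ε ^ P.γ := by positivity
  -- With `τ = ε^γ` the mobility part and the dissipation part `ε^{1-α+2γ} D / τ` are both of order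
  -- `ε^{1-α} ε^γ`.
  have hflux := h.abs_sum_flux_le hn1 hDne hχ0 hχN hX
  rw [P.dissipationOn_eq h0, ← hD] at hflux
  set I := Finset.Ico 1 (N + 1) with hI
  have hnn : ∀ l ∈ I, 0 ≤ n l := fun l hl => h.nonneg l (Finset.mem_Ico.1 hl).1
  have hχn : ∀ l, 0 ≤ χ l := fun l => plateau_nonneg _ _ _
  have hχ1 : ∀ l, χ l ≤ 1 := fun l => plateau_le_one _ _ _
  have hsmall : ∀ l : ℕ, ε * l ≤ δ / 2 → χ l = 0 ∧ χ (l - 1) = 0 := by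
    intro l hl
    refine ⟨plateau_eq_zero_of_le hδ hl, plateau_eq_zero_of_le hδ (le_trans ?_ hl)⟩
    have : ((l - 1 : ℕ) : ℝ) ≤ l := by exact_mod_cast Nat.sub_le l 1
    gcongr
  have hweight : ∀ l ∈ I, δ / 2 < ε * l → P.a l * n l ≤ (δ / 2) ^ (P.α - 1) * ε ^ (1 - P.α) * (l * n l) := by
    intro l hl hlδ
    have hl0 : (0 : ℝ) < l := by exact_mod_cast (Finset.mem_Ico.1 hl).1
    have h3 : (ε * l) ^ (P.α - 1) ≤ (δ / 2) ^ (P.α - 1) :=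
      Real.rpow_le_rpow_of_nonpos (by positivity) hlδ.le (by linarith)
    have e : P.a l = (ε * l) ^ (P.α - 1) * ε ^ (1 - P.α) * l := by
      unfold a
      rw [Real.mul_rpow h0.le hl0.le, Real.rpow_sub hl0, Real.rpow_one,
        show 1 - P.α = -(P.α - 1) by ring, Real.rpow_neg h0.le]
      field_simp
    rw [e]
    have := hnn l hl
    calc _ = (ε * l) ^ (P.α - 1) * (ε ^ (1 - P.α) * (l * n l)) := by ring
      _ ≤ (δ / 2) ^ (P.α - 1) * (ε ^ (1 - P.α) * (l * n l)) := by gcongr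
      _ = _ := by ring
  have hbound : ∀ (f : ℕ → ℝ) (c : ℝ), 0 ≤ c → (∀ l ∈ I, ε * l ≤ δ / 2 → f l = 0) →
      (∀ l ∈ I, δ / 2 < ε * l → f l ≤ c) →
      ∑ l ∈ I, f l * (P.a l * n l) ≤ c * (G * ε ^ (1 - P.α)) := by
    intro f c hc hf0 hfc
    calc ∑ l ∈ I, f l * (P.a l * n l)
        ≤ ∑ l ∈ I, c * ((δ / 2) ^ (P.α - 1) * ε ^ (1 - P.α)) * (l * n l) := by
          refine Finset.sum_le_sum fun l hl => ?_
          have hl0 : (0 : ℝ) ≤ l := Nat.cast_nonneg l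
          have := hnn l hl
          rcases le_or_gt (ε * l) (δ / 2) with h2 | h2
          · rw [hf0 l hl h2, zero_mul]
            positivity
          · rw [mul_assoc]
            exact mul_le_mul (hfc l hl h2) (hweight l hl h2)
              (mul_nonneg (P.a_nonneg l) this) hc
      _ ≤ c * ((δ / 2) ^ (P.α - 1) * ε ^ (1 - P.α)) * ρ₀ := by
          rw [← Finset.mul_sum]
          exact mul_le_mul_of_nonneg_left (h.sum_mass_le I) (by positivity)
      _ = _ := by rw [hG]; ring
  have hs2 := hbound (fun l => χ l ^ 2 + χ (l - 1) ^ 2) 2 (by norm_num)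
    (fun l _ hl => by simp [hsmall l hl]) (fun l _ _ => by
      have := hχn l
      have := hχ1 l
      have := hχn (l - 1)
      have := hχ1 (l - 1)
      nlinarith)
  have hs3 := hbound (fun l => |χ (l - 1) - χ l|) (2 / δ * ε) (by positivity)
    (fun l _ hl => by simp [hsmall l hl]) (fun l hl _ => by
      refine (abs_plateau_sub_le hδ hR _ _).trans (le_of_eq ?_)
      have : ((l - 1 : ℕ) : ℝ) = l - 1 := by
        rw [Nat.cast_sub (Finset.mem_Ico.1 hl).1, Nat.cast_one]
      rw [this, ← mul_sub, abs_mul, abs_of_pos h0]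
      norm_num)
  have hs4 := hbound (fun l => χ (l - 1) * (l : ℝ) ^ (-P.γ)) ((δ / 2) ^ (-P.γ) * ε ^ P.γ) (by positivity)
    (fun l _ hl => by simp [hsmall l hl]) (fun l hl hlδ => by
      have hl0 : (0 : ℝ) < l := by exact_mod_cast (Finset.mem_Ico.1 hl).1
      have h2 : (l : ℝ) ^ (-P.γ) ≤ (δ / 2 / ε) ^ (-P.γ) := by
        refine Real.rpow_le_rpow_of_nonpos (by positivity) ?_ (by linarith)
        rw [div_le_iff₀ h0]
        linarith
      rw [Real.div_rpow (by positivity) h0.le, Real.rpow_neg h0.le, div_inv_eq_mul] at h2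
      have h3 : 0 ≤ (l : ℝ) ^ (-P.γ) := by positivity
      have := hχ1 (l - 1)
      nlinarith)
  -- The tested flux is solved for `n_1 - z_s`. Its coefficient is at least a multiple of `ε^{1-α}`
  -- by the mass assumed in `[δ, R]`. Increments of `χ` are `O(ε)`, hence `O(ε^γ)`, and `l^{-γ} =
  -- O(ε^γ)` on the support of the weights.
  have hident : (n 1 - P.zs) * ∑ l ∈ I, χ l * (P.a l * n l)
      = ∑ l ∈ I, P.a l * n l * (χ l * n 1 - χ (l - 1) * (P.zs + P.q * (l : ℝ) ^ (-P.γ)))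
        + P.zs * ∑ l ∈ I, (χ (l - 1) - χ l) * (P.a l * n l)
        + P.q * ∑ l ∈ I, χ (l - 1) * (l : ℝ) ^ (-P.γ) * (P.a l * n l) := by
    rw [Finset.mul_sum, Finset.mul_sum, Finset.mul_sum, ← Finset.sum_add_distrib,
      ← Finset.sum_add_distrib]
    exact Finset.sum_congr rfl fun l _ => by ring
  have habs3 : |∑ l ∈ I, (χ (l - 1) - χ l) * (P.a l * n l)|
      ≤ ∑ l ∈ I, |χ (l - 1) - χ l| * (P.a l * n l) := by
    refine (Finset.abs_sum_le_sum_abs _ _).trans (Finset.sum_le_sum fun l hl => ?_)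
    rw [abs_mul, abs_of_nonneg (mul_nonneg (P.a_nonneg l) (hnn l hl))]
  have habs4 : 0 ≤ ∑ l ∈ I, χ (l - 1) * (l : ℝ) ^ (-P.γ) * (P.a l * n l) :=
    Finset.sum_nonneg fun l hl => mul_nonneg (mul_nonneg (hχn _) (by positivity))
      (mul_nonneg (P.a_nonneg l) (hnn l hl))
  have hlow : R ^ (P.α - 1) * m₀ * ε ^ (1 - P.α) ≤ ∑ l ∈ I, χ l * (P.a l * n l) := by
    have hSI : S ⊆ I := by
      intro l hl
      obtain ⟨ha, hb⟩ := hS l hl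
      rw [hI, Finset.mem_Ico]
      constructor
      · by_contra hcon
        have : l = 0 := by omega
        rw [this] at ha
        simp at ha
        linarith
      · by_contra hcon
        have := hNR l (by omega)
        linarith
    calc R ^ (P.α - 1) * m₀ * ε ^ (1 - P.α)
        ≤ R ^ (P.α - 1) * ε ^ (1 - P.α) * ∑ l ∈ S, (l : ℝ) * n l := by
          have : 0 ≤ R ^ (P.α - 1) * ε ^ (1 - P.α) := by positivity
          nlinarith
      _ ≤ ∑ l ∈ S, χ l * (P.a l * n l) := by
          rw [Finset.mul_sum]
          refine Finset.sum_le_sum fun l hl => ?_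
          obtain ⟨ha, hb⟩ := hS l hl
          have hl0 : (0 : ℝ) < l := by exact_mod_cast (Finset.mem_Ico.1 (hSI hl)).1
          rw [show χ l = 1 from plateau_eq_one hδ hR0 ha hb, one_mul]
          have h3 : R ^ (P.α - 1) ≤ (ε * l) ^ (P.α - 1) :=
            Real.rpow_le_rpow_of_nonpos (by positivity) hb (by linarith)
          have e : P.a l = (ε * l) ^ (P.α - 1) * ε ^ (1 - P.α) * l := by
            unfold a
            rw [Real.mul_rpow h0.le hl0.le, Real.rpow_sub hl0, Real.rpow_one,
              show 1 - P.α = -(P.α - 1) by ring, Real.rpow_neg h0.le]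
            field_simp
          rw [e, mul_assoc _ (l : ℝ)]
          have := hnn l (hSI hl)
          gcongr
      _ ≤ _ := Finset.sum_le_sum_of_subset_of_nonneg hSI fun l hl _ =>
          mul_nonneg (hχn l) (mul_nonneg (P.a_nonneg l) (hnn l hl))
  have hE : 0 < ε ^ (1 - P.α) := by positivity
  have hεγ : ε ≤ ε ^ P.γ := by
    have := Real.rpow_le_rpow_of_exponent_ge h0 h1 hγ1.le
    rwa [Real.rpow_one] at this
  have eD : ε ^ (1 - P.α + 2 * P.γ) / P.zs * D / ε ^ P.γ = ε ^ (1 - P.α) * (ε ^ P.γ * (1 / P.zs * D)) := by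
    rw [show 1 - P.α + 2 * P.γ = 1 - P.α + P.γ + P.γ by ring, Real.rpow_add h0, Real.rpow_add h0]
    field_simp
  rw [eD] at hflux
  have hfin : |n 1 - P.zs| * (R ^ (P.α - 1) * m₀ * ε ^ (1 - P.α))
      ≤ ε ^ (1 - P.α) * (ε ^ P.γ * (C₁ * (1 + D))) := by
    have hsum0 : 0 ≤ ∑ l ∈ I, χ l * (P.a l * n l) := le_trans (by positivity) hlow
    calc |n 1 - P.zs| * (R ^ (P.α - 1) * m₀ * ε ^ (1 - P.α))
        ≤ |n 1 - P.zs| * ∑ l ∈ I, χ l * (P.a l * n l) := by gcongr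
      _ = |(n 1 - P.zs) * ∑ l ∈ I, χ l * (P.a l * n l)| := by
          rw [abs_mul, abs_of_nonneg hsum0]
      _ ≤ (ε ^ P.γ * (2 * P.zs + P.q) * (2 * (G * ε ^ (1 - P.α)))
            + ε ^ (1 - P.α) * (ε ^ P.γ * (1 / P.zs * D)))
          + P.zs * (2 / δ * ε ^ P.γ * (G * ε ^ (1 - P.α)))
          + P.q * ((δ / 2) ^ (-P.γ) * ε ^ P.γ * (G * ε ^ (1 - P.α))) := by
          rw [hident]
          refine (abs_add_three _ _ _).trans (add_le_add (add_le_add ?_ ?_) ?_)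
          · refine hflux.trans ?_
            gcongr
          · rw [abs_mul, abs_of_pos hz]
            have : ∑ l ∈ I, |χ (l - 1) - χ l| * (P.a l * n l)
                ≤ 2 / δ * ε ^ P.γ * (G * ε ^ (1 - P.α)) := hs3.trans (by gcongr)
            gcongr
            exact habs3.trans this
          · rw [abs_mul, abs_of_pos hq, abs_of_nonneg habs4]
            gcongr
      _ = ε ^ (1 - P.α) * (ε ^ P.γ * ((C₁ - 1 / P.zs) + 1 / P.zs * D)) := by
          rw [hC₁]; ring
      _ ≤ _ := by
          gcongr
          have a1 : 0 < 1 / P.zs := by positivity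
          have a2 : 1 / P.zs ≤ C₁ := by
            rw [hC₁]
            have : 0 ≤ 2 * (2 * P.zs + P.q) * G + 2 * P.zs / δ * G + P.q * (δ / 2) ^ (-P.γ) * G := by
              positivity
            linarith
          nlinarith
  have hRm : 0 < R ^ (P.α - 1) * m₀ := by positivity
  rw [div_mul_eq_mul_div, div_mul_eq_mul_div, le_div_iff₀ hRm]
  refine le_of_mul_le_mul_right ?_ hE
  linarith

end Rates

/-! ### Energy of clusters between the cut-off and the macroscopic scale -/

namespace Rates

variable {P : Rates} {ρ₀ K ε : ℝ} {n : ℕ → ℝ}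

variable (P) in
/-- The weight `(l - m)₊ l^{-α}`, cut off above `N`. -/
def rampWeight (m : ℝ) (N l : ℕ) : ℝ := if l ≤ N then max (l - m) 0 * (l : ℝ) ^ (-P.α) else 0

lemma rampWeight_nonneg (m : ℝ) (N l : ℕ) : 0 ≤ P.rampWeight m N l := by
  unfold rampWeight
  split_ifs
  · exact mul_nonneg (le_max_right _ _) (by positivity)
  · exact le_rfl

lemma rampWeight_eq_zero {m : ℝ} {l : ℕ} (N : ℕ) (hl : (l : ℝ) ≤ m) : P.rampWeight m N l = 0 := by
  unfold rampWeight
  rw [max_eq_right (by linarith)]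
  simp

lemma rampWeight_le {m : ℝ} (hm : 0 ≤ m) (N l : ℕ) :
    P.rampWeight m N l ≤ (l : ℝ) ^ (1 - P.α) := by
  have h1 := P.α_lt_one
  unfold rampWeight
  split_ifs with h
  · rcases Nat.eq_zero_or_pos l with rfl | hl
    · have : max ((0 : ℕ) - m : ℝ) 0 = 0 := max_eq_right (by simpa using hm)
      rw [this, zero_mul]
      positivity
    · have hl0 : (0 : ℝ) < l := by exact_mod_cast hl
      rw [sub_eq_add_neg 1, Real.rpow_add hl0, Real.rpow_one]
      gcongr
      exact max_le (by linarith) hl0.le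
  · positivity

/-- The weighted increments of `rampWeight` are at most one. -/
lemma a_mul_rampWeight_sub_le {m : ℝ} (hm : 0 ≤ m) (N : ℕ) {l : ℕ} (hl : 1 ≤ l) :
    P.a l * (P.rampWeight m N l - P.rampWeight m N (l - 1)) ≤ 1 := by
  have hα := P.α_nonneg
  have hl0 : (0 : ℝ) < l := by exact_mod_cast hl
  have ha := P.a_pos hl
  have haa : P.a l * (l : ℝ) ^ (-P.α) = 1 := by
    unfold a
    rw [← Real.rpow_add hl0]; simp
  by_cases hlN : l ≤ N
  · have e1 : P.rampWeight m N l = max (l - m) 0 * (l : ℝ) ^ (-P.α) := if_pos hlN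
    have e2 : P.rampWeight m N (l - 1) = max (((l - 1 : ℕ) : ℝ) - m) 0 * ((l - 1 : ℕ) : ℝ) ^ (-P.α) :=
      if_pos (by omega)
    have e3 : ((l - 1 : ℕ) : ℝ) = l - 1 := by rw [Nat.cast_sub hl, Nat.cast_one]
    have h2 : max (((l - 1 : ℕ) : ℝ) - m) 0 * (l : ℝ) ^ (-P.α) ≤ P.rampWeight m N (l - 1) := by
      rw [e2]
      rcases Nat.eq_zero_or_pos (l - 1) with h0 | h0
      · rw [h0, max_eq_right (by simpa using hm)]
        simp
      · refine mul_le_mul_of_nonneg_left ?_ (le_max_right _ _)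
        exact Real.rpow_le_rpow_of_nonpos (by exact_mod_cast h0)
          (by exact_mod_cast Nat.sub_le l 1) (by linarith)
    have h3 : max ((l : ℝ) - m) 0 ≤ max (((l - 1 : ℕ) : ℝ) - m) 0 + 1 := by
      rw [e3]
      refine max_le ?_ ?_
      · linarith [le_max_left ((l : ℝ) - 1 - m) 0]
      · linarith [le_max_right ((l : ℝ) - 1 - m) 0]
    have h4 : 0 < (l : ℝ) ^ (-P.α) := by positivity
    calc P.a l * (P.rampWeight m N l - P.rampWeight m N (l - 1))
        ≤ P.a l * (max ((l : ℝ) - m) 0 * (l : ℝ) ^ (-P.α)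
            - max (((l - 1 : ℕ) : ℝ) - m) 0 * (l : ℝ) ^ (-P.α)) := by
          rw [e1]; gcongr
      _ = (P.a l * (l : ℝ) ^ (-P.α)) * (max ((l : ℝ) - m) 0 - max (((l - 1 : ℕ) : ℝ) - m) 0) := by ring
      _ ≤ 1 := by rw [haa]; linarith
  · have e1 : P.rampWeight m N l = 0 := if_neg hlN
    have := rampWeight_nonneg (P := P) m N (l - 1)
    rw [e1]
    nlinarith

set_option maxHeartbeats 1000000 in
variable (P) in
/-- The energy of clusters of macroscopic size at most `δ` is small, up to the dissipation. -/
lemma exists_sum_rpow_mul_le_dissipation (K : ℝ) {x C₀ : ℝ} (hx : 0 < x) (hC₀ : 0 < C₀) :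
    ∃ C : ℝ, 0 < C ∧ ∀ ρ₀ ε n, 0 < ε → ε ≤ 1 → 3 ≤ cutoff x ε → P.IsState ρ₀ K ε n →
      n 1 ≤ 2 * P.zs → P.dissipationResc ε (Set.Ici 1) n ≠ ⊤ →
      |n 1 - P.zs| ≤ C₀ * ε ^ P.γ * (1 + (P.dissipationResc ε (Set.Ici 1) n).toReal) →
      ∀ δ, 0 < δ → δ ≤ 1 → ∀ S : Finset ℕ, (∀ l ∈ S, cutoff x ε ≤ l ∧ ε * l ≤ δ) →
      ∑ l ∈ S, (l : ℝ) ^ (1 - P.γ) * n l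
        ≤ C * ε ^ P.γ * ((1 + (P.dissipationResc ε (Set.Ici 1) n).toReal) * δ ^ (P.γ / 2)
            + ε ^ (x * (1 - P.γ))) := by
  have hz := P.zs_pos
  have hq := P.q_pos
  have hγ := P.γ_pos
  have hγ1 := P.γ_lt_one
  have hα := P.α_nonneg
  have hα1 := P.α_lt_one
  obtain ⟨CY, hCY, hY⟩ := P.exists_sum_rpow_mul_le K hx
  obtain ⟨CM, hCM, hM⟩ := P.exists_sum_mass_le K hx
  set β := 1 - P.α + P.γ with hβ
  have hβ0 : 0 < β := by linarith
  set B := 2 * P.zs + P.q with hB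
  have hB0 : 0 < B := by positivity
  set C₁ := B * (2 * 2 ^ β * CY) + 1 / P.zs + C₀ * CM with hC₁
  set C₂ := P.zs * (6 ^ (1 - P.γ) * CY) with hC₂
  have hC₁0 : 0 < C₁ := by positivity
  have hC₂0 : 0 < C₂ := by positivity
  refine ⟨3 / P.q * (C₁ + C₂), by positivity,
    fun ρ₀ ε n h0 h1 hcut3 h hn1 hDt hw δ hδ hδ1 S hS => ?_⟩
  set D := (P.dissipationResc ε (Set.Ici 1) n).toReal with hD
  have hD0 : 0 ≤ D := ENNReal.toReal_nonneg
  have hDne := P.dissipationOn_ne_top h0 hDt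
  -- Starting the ramp at `l_0/3` ensures `l - 1 - m ≥ l/3` for all `l ≥ l_0`, given `l_0 ≥ 3`.
  set m : ℝ := (cutoff x ε : ℝ) / 3 with hm
  have hm1 : 1 ≤ m := by
    have : (3 : ℝ) ≤ cutoff x ε := by exact_mod_cast hcut3
    rw [hm]; linarith
  have hm0 : 0 ≤ m := by linarith
  set N' := ⌊δ / ε⌋₊ with hN'
  set χ : ℕ → ℝ := P.rampWeight m N' with hχ
  have hχ0 : χ 0 = 0 := rampWeight_eq_zero _ (by simpa using hm0)
  have hχN : χ (N' + 1) = 0 := if_neg (by omega)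
  have hχn : ∀ l, 0 ≤ χ l := fun l => rampWeight_nonneg _ _ _
  -- The quadratic term is of order `τ (δ/ε)^β ε^γ` and the dissipation term of order `ε^{γ+β} D /
  -- τ`. This `τ` gives both the factor `ε^γ δ^{β/2}`.
  set τ := ε ^ β * δ ^ (-(β / 2)) with hτ
  have hτ0 : 0 < τ := by positivity
  have hflux := h.abs_sum_flux_le hn1 hDne hχ0 hχN hτ0
  rw [P.dissipationOn_eq h0, ← hD] at hflux
  set I := Finset.Ico 1 (N' + 1 + 1) with hI
  have hnn : ∀ l ∈ I, 0 ≤ n l := fun l hl => h.nonneg l (Finset.mem_Ico.1 hl).1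
  have hNle : ∀ l : ℕ, l ≤ N' → ε * l ≤ δ := by
    intro l hl
    have h2 : (l : ℝ) ≤ δ / ε :=
      (by exact_mod_cast hl : (l : ℝ) ≤ N').trans (Nat.floor_le (by positivity))
    rw [le_div_iff₀ h0] at h2
    linarith
  have hleN : ∀ l : ℕ, ε * l ≤ δ → l ≤ N' := by
    intro l hl
    refine Nat.le_floor ?_
    rw [le_div_iff₀ h0]
    linarith
  set Im := I.filter (fun l : ℕ => m ≤ (l : ℝ)) with hIm
  have hImm : ∀ l ∈ Im, (cutoff x ε : ℝ) / 3 ≤ l := fun l hl => (Finset.mem_filter.1 hl).2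
  have hYm := hY ε h0 h1 ρ₀ n h Im hImm
  set Y := ∑ l ∈ Im, (l : ℝ) ^ (1 - P.γ) * n l with hYdef
  -- restricting sums to `Im`
  have hrestrict : ∀ f g : ℕ → ℝ, (∀ l ∈ I, (l : ℝ) < m → f l = 0) → (∀ l ∈ Im, f l ≤ g l) →
      ∑ l ∈ I, f l ≤ ∑ l ∈ Im, g l := by
    intro f g hf hfg
    refine le_trans (le_of_eq ?_) (Finset.sum_le_sum hfg)
    rw [hIm, Finset.sum_filter]
    refine Finset.sum_congr rfl fun l hl => ?_
    split_ifs with h2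
    · rfl
    · exact hf l hl (not_le.1 h2)
  have hzero : ∀ l : ℕ, (l : ℝ) < m → χ l = 0 ∧ χ (l - 1) = 0 := by
    intro l hl
    refine ⟨rampWeight_eq_zero _ hl.le, rampWeight_eq_zero _ (le_trans ?_ hl.le)⟩
    exact_mod_cast Nat.sub_le l 1
  -- the quadratic term
  have hs2 : ∑ l ∈ I, (χ l ^ 2 + χ (l - 1) ^ 2) * (P.a l * n l)
      ≤ 2 * (2 * δ / ε) ^ β * Y := by
    rw [hYdef, Finset.mul_sum]
    refine hrestrict _ _ (fun l _ hl => by simp [hzero l hl]) fun l hl => ?_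
    have hlI := (Finset.mem_filter.1 hl).1
    have hl1 := (Finset.mem_Ico.1 hlI).1
    have hl0 : (0 : ℝ) < l := by exact_mod_cast hl1
    have hn := hnn l hlI
    -- The range extends to `N' + 1`, where the shifted weight may still be nonzero. The bound `l ≤
    -- 2 N'` fails only in this case, and then both weights vanish.
    by_cases hl2 : l = 1 ∧ N' = 0
    · have : χ l = 0 := if_neg (by omega)
      rw [this, hl2.1, Nat.sub_self, hχ0]
      have := h.nonneg 1 le_rfl
      have : 0 ≤ 2 * (2 * δ / ε) ^ β := by positivity
      simp
      positivity
    have hlδ : (l : ℝ) ≤ 2 * δ / ε := by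
      have h3 : l ≤ 2 * N' := by
        have := (Finset.mem_Ico.1 hlI).2
        omega
      have h4 := hNle N' le_rfl
      rw [le_div_iff₀ h0]
      have : (l : ℝ) ≤ 2 * N' := by exact_mod_cast h3
      nlinarith
    have h5 : ∀ k : ℕ, k ≤ l → χ k ^ 2 ≤ (l : ℝ) ^ (2 - 2 * P.α) := by
      intro k hk
      have h6 : χ k ≤ (l : ℝ) ^ (1 - P.α) := (rampWeight_le hm0 _ _).trans
        (Real.rpow_le_rpow (Nat.cast_nonneg _) (by exact_mod_cast hk) (by linarith))
      have e : (l : ℝ) ^ (2 - 2 * P.α) = ((l : ℝ) ^ (1 - P.α)) ^ 2 := by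
        rw [← Real.rpow_natCast, ← Real.rpow_mul hl0.le]
        congr 1
        push_cast
        ring
      rw [e]
      exact pow_le_pow_left₀ (hχn k) h6 2
    have e1 : (l : ℝ) ^ (2 - 2 * P.α) * P.a l = (l : ℝ) ^ β * (l : ℝ) ^ (1 - P.γ) := by
      unfold a
      rw [← Real.rpow_add hl0, ← Real.rpow_add hl0, hβ]
      congr 1
      ring
    have ha := P.a_nonneg l
    calc (χ l ^ 2 + χ (l - 1) ^ 2) * (P.a l * n l)
        ≤ ((l : ℝ) ^ (2 - 2 * P.α) + (l : ℝ) ^ (2 - 2 * P.α)) * (P.a l * n l) := by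
          gcongr
          · exact h5 l le_rfl
          · exact h5 (l - 1) (Nat.sub_le _ _)
      _ = 2 * ((l : ℝ) ^ (2 - 2 * P.α) * P.a l) * n l := by ring
      _ = 2 * (l : ℝ) ^ β * ((l : ℝ) ^ (1 - P.γ) * n l) := by rw [e1]; ring
      _ ≤ 2 * (2 * δ / ε) ^ β * ((l : ℝ) ^ (1 - P.γ) * n l) := by gcongr
  -- the increment term
  have hs3 : ∑ l ∈ I, (χ l - χ (l - 1)) * (P.a l * n l) ≤ m ^ (P.γ - 1) * Y := by
    rw [hYdef, Finset.mul_sum]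
    refine hrestrict _ _ (fun l _ hl => by simp [hzero l hl]) fun l hl => ?_
    have hlI := (Finset.mem_filter.1 hl).1
    have hl1 := (Finset.mem_Ico.1 hlI).1
    have hn := hnn l hlI
    have hml := hImm l hl
    have h2 : 1 ≤ m ^ (P.γ - 1) * (l : ℝ) ^ (1 - P.γ) := by
      have h3 := Real.rpow_le_rpow hm0 hml (by linarith : 0 ≤ 1 - P.γ)
      have h4 : m ^ (P.γ - 1) * m ^ (1 - P.γ) = 1 := by
        rw [← Real.rpow_add (by linarith)]; simp
      have h5 : 0 < m ^ (P.γ - 1) := by positivity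
      nlinarith
    have h3 := a_mul_rampWeight_sub_le (P := P) hm0 N' hl1
    calc (χ l - χ (l - 1)) * (P.a l * n l) = (P.a l * (χ l - χ (l - 1))) * n l := by ring
      _ ≤ 1 * n l := by gcongr
      _ ≤ m ^ (P.γ - 1) * (l : ℝ) ^ (1 - P.γ) * n l := by gcongr
      _ = _ := by ring
  -- the excess term
  have hs1 : ∑ l ∈ I, χ l * (P.a l * n l) ≤ CM * δ ^ P.γ := by
    refine le_trans ?_ (hM ε h0 h1 ρ₀ n h δ hδ (Im.filter (fun l => l ≤ N'))
      (fun l hl => hImm l (Finset.mem_filter.1 hl).1)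
      (fun l hl => hNle l (Finset.mem_filter.1 hl).2))
    rw [Finset.sum_filter]
    refine hrestrict _ _ (fun l _ hl => by simp [hzero l hl]) fun l hl => ?_
    have hlI := (Finset.mem_filter.1 hl).1
    have hl0 : (0 : ℝ) < l := by exact_mod_cast (Finset.mem_Ico.1 hlI).1
    have hn := hnn l hlI
    split_ifs with h2
    · have h3 : χ l * P.a l ≤ l := by
        have := mul_le_mul_of_nonneg_right (rampWeight_le (P := P) hm0 N' l) (P.a_nonneg l)
        refine this.trans (le_of_eq ?_)
        unfold a
        rw [← Real.rpow_add hl0]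
        simp
      rw [← mul_assoc]
      gcongr
    · have : χ l = 0 := if_neg h2
      rw [this, zero_mul]
  have hs10 : 0 ≤ ∑ l ∈ I, χ l * (P.a l * n l) := Finset.sum_nonneg fun l hl =>
    mul_nonneg (hχn l) (mul_nonneg (P.a_nonneg l) (hnn l hl))
  -- The tested flux is now solved for the surplus fragmentation, which is coercive since `χ (l - 1)
  -- * a_l ≥ l/3` above the cut-off. Only an upper bound on the increments of `χ` is needed, so its
  -- drop to zero beyond `N'` has the favourable sign.
  have hident : P.q * ∑ l ∈ I, χ (l - 1) * (l : ℝ) ^ (-P.γ) * (P.a l * n l)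
      = -∑ l ∈ I, P.a l * n l * (χ l * n 1 - χ (l - 1) * (P.zs + P.q * (l : ℝ) ^ (-P.γ)))
        + (n 1 - P.zs) * ∑ l ∈ I, χ l * (P.a l * n l)
        + P.zs * ∑ l ∈ I, (χ l - χ (l - 1)) * (P.a l * n l) := by
    rw [Finset.mul_sum, Finset.mul_sum, Finset.mul_sum, ← Finset.sum_neg_distrib,
      ← Finset.sum_add_distrib, ← Finset.sum_add_distrib]
    exact Finset.sum_congr rfl fun l _ => by ring
  -- the lower bound
  have hlow : 1 / 3 * ∑ l ∈ S, (l : ℝ) ^ (1 - P.γ) * n l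
      ≤ ∑ l ∈ I, χ (l - 1) * (l : ℝ) ^ (-P.γ) * (P.a l * n l) := by
    have hSI : S ⊆ I := by
      intro l hl
      obtain ⟨ha, hb⟩ := hS l hl
      have := hleN l hb
      rw [hI, Finset.mem_Ico]
      omega
    refine le_trans ?_ (Finset.sum_le_sum_of_subset_of_nonneg hSI fun l hl _ =>
      mul_nonneg (mul_nonneg (hχn _) (by positivity)) (mul_nonneg (P.a_nonneg l) (hnn l hl)))
    rw [Finset.mul_sum]
    refine Finset.sum_le_sum fun l hl => ?_
    obtain ⟨ha, hb⟩ := hS l hl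
    have hl3 : 3 ≤ l := hcut3.trans ha
    have hl0 : (3 : ℝ) ≤ l := by exact_mod_cast hl3
    have hn := hnn l (hSI hl)
    have hlN := hleN l hb
    have e3 : ((l - 1 : ℕ) : ℝ) = l - 1 := by rw [Nat.cast_sub (by omega), Nat.cast_one]
    have hml : m ≤ (l : ℝ) / 3 := by
      rw [hm]
      have : (cutoff x ε : ℝ) ≤ l := by exact_mod_cast ha
      linarith
    have e2 : χ (l - 1) = (l - 1 - m) * ((l : ℝ) - 1) ^ (-P.α) := by
      have : χ (l - 1) = max (((l - 1 : ℕ) : ℝ) - m) 0 * ((l - 1 : ℕ) : ℝ) ^ (-P.α) :=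
        if_pos (by omega)
      rw [this, e3, max_eq_left (by linarith)]
    have h4 : (l : ℝ) ^ (-P.α) ≤ ((l : ℝ) - 1) ^ (-P.α) :=
      Real.rpow_le_rpow_of_nonpos (by linarith) (by linarith) (by linarith)
    have haa : (l : ℝ) ^ (-P.α) * P.a l = 1 := by
      unfold a
      rw [← Real.rpow_add (by linarith)]; simp
    have h5 : 1 / 3 * (l : ℝ) ≤ χ (l - 1) * P.a l := by
      calc 1 / 3 * (l : ℝ) ≤ (l - 1 - m) * ((l : ℝ) ^ (-P.α) * P.a l) := by
            rw [haa]; linarith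
        _ ≤ _ := by
            rw [e2, ← mul_assoc]
            have := P.a_nonneg l
            have : 0 ≤ (l : ℝ) - 1 - m := by linarith
            gcongr
    calc 1 / 3 * ((l : ℝ) ^ (1 - P.γ) * n l) = 1 / 3 * (l : ℝ) * ((l : ℝ) ^ (-P.γ) * n l) := by
          rw [sub_eq_add_neg, Real.rpow_add (by linarith), Real.rpow_one]
          ring
      _ ≤ χ (l - 1) * P.a l * ((l : ℝ) ^ (-P.γ) * n l) := by gcongr
      _ = _ := by ring
  -- collecting the terms
  have hX : 0 < ε ^ P.γ := by positivity
  have hδγ : δ ^ P.γ ≤ δ ^ (P.γ / 2) := Real.rpow_le_rpow_of_exponent_ge hδ hδ1 (by linarith)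
  have hδβ : δ ^ (β / 2) ≤ δ ^ (P.γ / 2) := Real.rpow_le_rpow_of_exponent_ge hδ hδ1 (by linarith)
  have hΔ : 0 < δ ^ (P.γ / 2) := by positivity
  have hmx : m ^ (P.γ - 1) ≤ 6 ^ (1 - P.γ) * ε ^ (x * (1 - P.γ)) := by
    have h2 := rpow_neg_le_two_mul_cutoff hx h0 h1
    have h3 : ε ^ (-x) / 6 ≤ m := by rw [hm]; linarith
    have h4 := Real.rpow_le_rpow_of_nonpos (by positivity) h3 (by linarith : P.γ - 1 ≤ 0)
    refine h4.trans (le_of_eq ?_)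
    rw [Real.div_rpow (by positivity) (by norm_num), ← Real.rpow_mul h0.le,
      show -x * (P.γ - 1) = x * (1 - P.γ) by ring, show P.γ - 1 = -(1 - P.γ) by ring,
      Real.rpow_neg (by norm_num : (0 : ℝ) ≤ 6)]
    field_simp
  have t1 : τ * B * ∑ l ∈ I, (χ l ^ 2 + χ (l - 1) ^ 2) * (P.a l * n l)
      ≤ ε ^ P.γ * (B * (2 * 2 ^ β * CY) * δ ^ (P.γ / 2)) := by
    calc τ * B * ∑ l ∈ I, (χ l ^ 2 + χ (l - 1) ^ 2) * (P.a l * n l)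
        ≤ τ * B * (2 * (2 * δ / ε) ^ β * (CY * ε ^ P.γ)) := by
          have : 2 * (2 * δ / ε) ^ β * Y ≤ 2 * (2 * δ / ε) ^ β * (CY * ε ^ P.γ) := by gcongr
          gcongr
          exact hs2.trans this
      _ = ε ^ P.γ * (B * (2 * 2 ^ β * CY) * δ ^ (β / 2)) := by
          have e : δ ^ β = δ ^ (β / 2) * δ ^ (β / 2) := by
            rw [← Real.rpow_add hδ]; congr 1; ring
          rw [hτ, Real.div_rpow (by positivity) h0.le, Real.mul_rpow (by norm_num) hδ.le, e,
            Real.rpow_neg hδ.le]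
          have := Real.rpow_pos_of_pos hδ (β / 2)
          field_simp
      _ ≤ _ := by gcongr
  have t2 : ε ^ (1 - P.α + 2 * P.γ) / P.zs * D / τ ≤ ε ^ P.γ * (1 / P.zs * D * δ ^ (P.γ / 2)) := by
    have e : ε ^ (1 - P.α + 2 * P.γ) / P.zs * D / τ = ε ^ P.γ * (1 / P.zs * D * δ ^ (β / 2)) := by
      rw [hτ, show 1 - P.α + 2 * P.γ = P.γ + β by rw [hβ]; ring, Real.rpow_add h0,
        Real.rpow_neg hδ.le]
      field_simp
    rw [e]
    gcongr
  have t3 : (n 1 - P.zs) * ∑ l ∈ I, χ l * (P.a l * n l)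
      ≤ ε ^ P.γ * (C₀ * CM * (1 + D) * δ ^ (P.γ / 2)) := by
    calc (n 1 - P.zs) * ∑ l ∈ I, χ l * (P.a l * n l)
        ≤ (C₀ * ε ^ P.γ * (1 + D)) * (CM * δ ^ (P.γ / 2)) := by
          refine mul_le_mul ((le_abs_self _).trans hw) (hs1.trans (by gcongr)) hs10 (by positivity)
      _ = _ := by ring
  have t4 : P.zs * ∑ l ∈ I, (χ l - χ (l - 1)) * (P.a l * n l)
      ≤ ε ^ P.γ * (C₂ * ε ^ (x * (1 - P.γ))) := by
    have hY0 : 0 ≤ Y := Finset.sum_nonneg fun l hl =>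
      mul_nonneg (by positivity) (hnn l (Finset.mem_filter.1 hl).1)
    calc P.zs * ∑ l ∈ I, (χ l - χ (l - 1)) * (P.a l * n l)
        ≤ P.zs * (6 ^ (1 - P.γ) * ε ^ (x * (1 - P.γ)) * (CY * ε ^ P.γ)) := by
          gcongr
          refine hs3.trans ?_
          gcongr
      _ = _ := by rw [hC₂]; ring
  have hflux' := (neg_le_abs _).trans hflux
  have hfin : P.q * (1 / 3 * ∑ l ∈ S, (l : ℝ) ^ (1 - P.γ) * n l)
      ≤ ε ^ P.γ * (C₁ * ((1 + D) * δ ^ (P.γ / 2)) + C₂ * ε ^ (x * (1 - P.γ))) := by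
    have h2 := mul_le_mul_of_nonneg_left hlow hq.le
    rw [hident] at h2
    have h3 : ε ^ P.γ * (B * (2 * 2 ^ β * CY) * δ ^ (P.γ / 2)) + ε ^ P.γ * (1 / P.zs * D * δ ^ (P.γ / 2))
        + ε ^ P.γ * (C₀ * CM * (1 + D) * δ ^ (P.γ / 2))
        ≤ ε ^ P.γ * (C₁ * ((1 + D) * δ ^ (P.γ / 2))) := by
      have e : ε ^ P.γ * (C₁ * ((1 + D) * δ ^ (P.γ / 2)))
          - (ε ^ P.γ * (B * (2 * 2 ^ β * CY) * δ ^ (P.γ / 2)) + ε ^ P.γ * (1 / P.zs * D * δ ^ (P.γ / 2))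
            + ε ^ P.γ * (C₀ * CM * (1 + D) * δ ^ (P.γ / 2)))
          = ε ^ P.γ * δ ^ (P.γ / 2) * (B * (2 * 2 ^ β * CY) * D + 1 / P.zs) := by
        rw [hC₁]; ring
      have : 0 ≤ ε ^ P.γ * δ ^ (P.γ / 2) * (B * (2 * 2 ^ β * CY) * D + 1 / P.zs) := by positivity
      linarith
    rw [mul_add (ε ^ P.γ)]
    linarith
  set Z := ∑ l ∈ S, (l : ℝ) ^ (1 - P.γ) * n l
  set U := (1 + D) * δ ^ (P.γ / 2)
  set V := ε ^ (x * (1 - P.γ))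
  have hU : 0 ≤ U := by positivity
  have hV : 0 ≤ V := by positivity
  have hlast : P.q / 3 * Z ≤ P.q / 3 * (3 / P.q * (C₁ + C₂) * ε ^ P.γ * (U + V)) := by
    have e : P.q / 3 * (3 / P.q * (C₁ + C₂) * ε ^ P.γ * (U + V)) = ε ^ P.γ * ((C₁ + C₂) * (U + V)) := by
      field_simp
    rw [e]
    have : ε ^ P.γ * (C₁ * U + C₂ * V) ≤ ε ^ P.γ * ((C₁ + C₂) * (U + V)) := by
      gcongr
      nlinarith [mul_nonneg hC₁0.le hV, mul_nonneg hC₂0.le hU]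
    linarith
  exact le_of_mul_le_mul_left hlast (by positivity)

end Rates

namespace Rates

/-! ### Time regularity from the continuity equation -/

variable {P : Rates} {ρ₀ K T ε : ℝ} {n φ : ℝ → ℕ → ℝ}

open intervalIntegral in
/-- The strong form of the continuity equation. -/
lemma IsRescaledCurve.ae_deriv_eq (h : P.IsRescaledCurve ρ₀ K T ε n φ) (hT : 0 < T) {i : ℕ}
    (hi : 1 ≤ i) : ∀ᵐ t ∂(volume : Measure ℝ), t ∈ Set.Ioo 0 T →
      deriv (fun t => n t i) t = -P.onsagerResc ε (n t) (φ t) i := by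
  have hac := h.absCont i hi
  have hint := hac.intervalIntegrable_deriv
  have hint' : IntegrableOn (deriv fun t => n t i) (Set.Ioo 0 T) :=
    ((intervalIntegrable_iff_integrableOn_Ioc_of_le hT.le).1 hint).mono_set Set.Ioo_subset_Ioc_self
  have hloc : LocallyIntegrableOn (fun t => deriv (fun t => n t i) t + P.onsagerResc ε (n t) (φ t) i)
      (Set.Ioo 0 T) := hint'.locallyIntegrableOn.add (h.locallyIntegrable i hi)
  have hcont : ContinuousOn (fun t => n t i) (Set.uIcc 0 T) := hac.continuousOn
  have key := isOpen_Ioo.ae_eq_zero_of_integral_contDiff_smul_eq_zero hloc ?_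
  · filter_upwards [key] with t ht hmem
    linarith [ht hmem]
  intro g hg hgc hgs
  have hg1 : ContDiff ℝ 1 g := hg.of_le (by exact_mod_cast le_top)
  have hgac : AbsolutelyContinuousOnInterval g 0 T := hg1.contDiffOn.absolutelyContinuousOnInterval
  have hg0 : g 0 = 0 := image_eq_zero_of_notMem_tsupport fun hh => (hgs hh).1.false
  have hgT : g T = 0 := image_eq_zero_of_notMem_tsupport fun hh => (hgs hh).2.false
  have hparts := AbsolutelyContinuousOnInterval.integral_mul_deriv_eq_deriv_mul hgac hac
  rw [hg0, hgT, zero_mul, zero_mul, sub_zero, zero_sub, integral_of_le hT.le, integral_of_le hT.le,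
    integral_Ioc_eq_integral_Ioo, integral_Ioc_eq_integral_Ioo] at hparts
  have hzero : ∀ t, t ∉ Set.Ioo 0 T → g t = 0 := fun t ht =>
    image_eq_zero_of_notMem_tsupport fun hh => ht (hgs hh)
  have e : ∫ t, g t • (deriv (fun t => n t i) t + P.onsagerResc ε (n t) (φ t) i)
      = ∫ t in Set.Ioo 0 T, g t • (deriv (fun t => n t i) t + P.onsagerResc ε (n t) (φ t) i) := by
    rw [setIntegral_eq_integral_of_forall_compl_eq_zero]
    intro t ht
    rw [hzero t ht, zero_smul]
  have hons : IntegrableOn (fun t => g t * P.onsagerResc ε (n t) (φ t) i) (Set.Ioo 0 T) := by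
    have hK : IntegrableOn (fun t => P.onsagerResc ε (n t) (φ t) i) (tsupport g) :=
      (h.locallyIntegrable i hi).integrableOn_compact_subset hgs hgc
    have h2 : IntegrableOn (fun t => g t * P.onsagerResc ε (n t) (φ t) i) (tsupport g) :=
      hK.continuousOn_mul hg.continuous.continuousOn hgc
    refine Integrable.integrableOn ?_
    refine (integrableOn_iff_integrable_of_support_subset ?_).1 h2
    intro t ht
    refine subset_tsupport g ?_
    intro h0
    apply ht
    simp only [h0, zero_mul]
  have hgd : IntegrableOn (fun t => g t * deriv (fun t => n t i) t) (Set.Ioo 0 T) := by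
    have := hint.continuousOn_mul hg.continuous.continuousOn
    exact ((intervalIntegrable_iff_integrableOn_Ioc_of_le hT.le).1 this).mono_set
      Set.Ioo_subset_Ioc_self
  have hdn : IntegrableOn (fun t => deriv g t * n t i) (Set.Ioo 0 T) := by
    have hd : IntervalIntegrable (deriv g) volume 0 T :=
      (hg1.continuous_deriv le_rfl).intervalIntegrable _ _
    exact ((intervalIntegrable_iff_integrableOn_Ioc_of_le hT.le).1 (hd.mul_continuousOn hcont)).mono_set
      Set.Ioo_subset_Ioc_self
  have hweak := h.continuityEq i hi g hg1 hgc hgs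
  rw [integral_sub hdn hons] at hweak
  rw [e]
  simp only [smul_eq_mul, mul_add]
  rw [integral_add hgd hons]
  linarith

variable (P) in
-- The logarithmic mean is at most the sum of its arguments, and `k^l = a_l ω_1 ω_l = b_{l+1}
-- ω_{l+1}` turns that sum into the two reaction rates.
lemma k_mul_nHat_mem {m : ℕ → ℝ} (hm : ∀ l, 1 ≤ l → 0 ≤ m l) {l : ℕ} (hl : 1 ≤ l) :
    0 ≤ P.k l * P.nHat m l ∧
      P.k l * P.nHat m l ≤ P.a l * m 1 * m l + P.b (l + 1) * m (l + 1) := by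
  have hz := P.zs_pos
  have ha := P.a_pos hl
  have hw := P.ω_pos hz l
  have hw' := P.ω_pos hz (l + 1)
  have hw1 := P.ω_pos hz 1
  have hb := P.b_mul_ω_succ P.zs hl
  have h1 : 0 ≤ m 1 * m l / (P.ω P.zs 1 * P.ω P.zs l) :=
    div_nonneg (mul_nonneg (hm 1 le_rfl) (hm l hl)) (by positivity)
  have h2 : 0 ≤ m (l + 1) / P.ω P.zs (l + 1) := div_nonneg (hm _ (by omega)) hw'.le
  have hk : 0 ≤ P.k l := by unfold k; positivity
  refine ⟨mul_nonneg hk (logMean_nonneg h1 h2), ?_⟩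
  refine (mul_le_mul_of_nonneg_left (logMean_le h1 h2) hk).trans (le_of_eq ?_)
  rw [mul_add]
  congr 1
  · unfold k
    field_simp
  · have e : P.k l = P.b (l + 1) * P.ω P.zs (l + 1) := by
      rw [hb]; unfold k; rw [P.ω_one]; ring
    rw [e]
    field_simp

lemma sum_mul_reactionVec {g : ℕ → ℝ} {N l : ℕ} (h0 : g 0 = 0) (hN : ∀ l, N ≤ l → g l = 0) :
    ∑ i ∈ Finset.Ico 1 N, g i * reactionVec l i = -nabla g l := by
  have hsum : ∀ j, ∑ i ∈ Finset.Ico 1 N, g i * (if i = j then (1 : ℝ) else 0) = g j := by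
    intro j
    simp only [mul_ite, mul_one, mul_zero]
    rw [Finset.sum_ite_eq']
    split_ifs with hj
    · rfl
    · rw [Finset.mem_Ico, not_and_or, not_le, not_lt] at hj
      rcases hj with hj | hj
      · rw [show j = 0 by omega, h0]
      · rw [hN j hj]
  unfold reactionVec nabla
  simp only [mul_add, mul_sub, Finset.sum_add_distrib, Finset.sum_sub_distrib, hsum]
  ring

variable (P) in
/-- Summation of the equilibrium mobility against squared discrete gradients. -/
lemma tsum_k_mul_nHat_le {m g : ℕ → ℝ} {G : ℝ} (hε : 0 < ε)
    (h : P.IsState ρ₀ K ε m) (hm1 : m 1 ≤ 2 * P.zs) (hG0 : 0 ≤ G)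
    (hG : ∀ l, 1 ≤ l → nabla g l ^ 2 ≤ G * (ε * ((l : ℝ) + 1)) ^ (1 - P.α)) :
    ∑' l : Set.Ici 1, ENNReal.ofReal (P.k l * P.nHat m l * nabla g l ^ 2)
      ≤ ENNReal.ofReal (3 * (2 * P.zs + P.q) * G * ρ₀ * ε ^ (1 - P.α)) := by
  have hz := P.zs_pos
  have hq := P.q_pos
  have hα := P.α_nonneg
  have hα1 := P.α_lt_one
  refine tsum_subtype_ofReal_le (f := fun l => P.k l * P.nHat m l * nabla g l ^ 2)
    (fun l hl => mul_nonneg (P.k_mul_nHat_mem h.nonneg hl).1 (sq_nonneg _)) fun S hS => ?_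
  have hterm : ∀ l ∈ S, P.k l * P.nHat m l * nabla g l ^ 2
      ≤ (2 * P.zs + P.q) * G * ε ^ (1 - P.α) *
        (2 * ((l : ℝ) * m l) + ((l + 1 : ℕ) : ℝ) * m (l + 1)) := by
    intro l hl
    have hl1 : 1 ≤ l := hS l hl
    have hl0 : (1 : ℝ) ≤ l := by exact_mod_cast hl1
    have hn := h.nonneg l hl1
    have hn' := h.nonneg (l + 1) (by omega)
    have ha := P.a_pos hl1
    have hk := P.k_mul_nHat_mem h.nonneg hl1
    have h2 : P.k l * P.nHat m l ≤ (2 * P.zs + P.q) * (P.a l * m l + P.a (l + 1) * m (l + 1)) := by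
      refine hk.2.trans ?_
      have h3 : P.a l * m 1 * m l ≤ (2 * P.zs + P.q) * (P.a l * m l) := by
        have := mul_nonneg ha.le hn
        nlinarith
      have h4 := mul_le_mul_of_nonneg_right (P.b_le_mul_a (l := l + 1) (by omega)) hn'
      linarith
    -- The growth allowed for the squared gradient is just what the total mass can pay for.
    have e1 : P.a l * ((l : ℝ) + 1) ^ (1 - P.α) ≤ 2 * l := by
      calc P.a l * ((l : ℝ) + 1) ^ (1 - P.α) ≤ P.a l * (2 * (l : ℝ)) ^ (1 - P.α) := by
            gcongr
            linarith
        _ = 2 ^ (1 - P.α) * l := by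
            unfold a
            rw [Real.mul_rpow (by norm_num) (by linarith), Real.rpow_sub (by linarith : (0 : ℝ) < l),
              Real.rpow_one]
            field_simp
        _ ≤ 2 ^ (1 : ℝ) * l := by
            gcongr
            · norm_num
            · linarith
        _ = _ := by norm_num
    have e2 : P.a (l + 1) * ((l : ℝ) + 1) ^ (1 - P.α) = ((l + 1 : ℕ) : ℝ) := by
      unfold a
      push_cast
      rw [← Real.rpow_add (by linarith)]
      simp
    have h5 := hG l hl1
    rw [Real.mul_rpow hε.le (by linarith)] at h5
    have hs : 0 ≤ (2 * P.zs + P.q) * (P.a l * m l + P.a (l + 1) * m (l + 1)) := hk.1.trans h2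
    have hE : 0 < ε ^ (1 - P.α) := by positivity
    calc P.k l * P.nHat m l * nabla g l ^ 2
        ≤ ((2 * P.zs + P.q) * (P.a l * m l + P.a (l + 1) * m (l + 1))) *
          (G * (ε ^ (1 - P.α) * ((l : ℝ) + 1) ^ (1 - P.α))) :=
          mul_le_mul h2 h5 (sq_nonneg _) hs
      _ = (2 * P.zs + P.q) * G * ε ^ (1 - P.α) *
          (P.a l * ((l : ℝ) + 1) ^ (1 - P.α) * m l + P.a (l + 1) * ((l : ℝ) + 1) ^ (1 - P.α) * m (l + 1)) := by
          ring
      _ ≤ (2 * P.zs + P.q) * G * ε ^ (1 - P.α) * (2 * l * m l + ((l + 1 : ℕ) : ℝ) * m (l + 1)) := by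
          rw [e2]
          gcongr
      _ = _ := by ring
  refine (Finset.sum_le_sum hterm).trans ?_
  rw [← Finset.mul_sum, Finset.sum_add_distrib, ← Finset.mul_sum]
  have h1 := h.sum_mass_le S
  have h2 : ∑ l ∈ S, ((l + 1 : ℕ) : ℝ) * m (l + 1) ≤ ρ₀ := by
    have := h.sum_mass_le (S.map ⟨(· + 1), add_left_injective 1⟩)
    rwa [Finset.sum_map] at this
  have hE : 0 < ε ^ (1 - P.α) := by positivity
  calc (2 * P.zs + P.q) * G * ε ^ (1 - P.α) * (2 * ∑ l ∈ S, (l : ℝ) * m l + ∑ l ∈ S, ((l + 1 : ℕ) : ℝ) * m (l + 1))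
      ≤ (2 * P.zs + P.q) * G * ε ^ (1 - P.α) * (2 * ρ₀ + ρ₀) := by gcongr
    _ = _ := by ring

/-- The pairing of a finitely supported sequence with the flux is controlled by the action. -/
lemma enorm_sum_onsagerResc_le {m ψ g : ℕ → ℝ} {G θ : ℝ} {N : ℕ} (hε : 0 < ε)
    (h : P.IsState ρ₀ K ε m) (hm1 : m 1 ≤ 2 * P.zs)
    (hsum : Summable fun l : Set.Ici 1 => P.k l * P.nHat m l * nabla ψ l)
    (hG0 : 0 ≤ G) (hG : ∀ l, 1 ≤ l → nabla g l ^ 2 ≤ G * (ε * ((l : ℝ) + 1)) ^ (1 - P.α))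
    (h0 : g 0 = 0) (hN : ∀ l, N ≤ l → g l = 0) (hθ : 0 < θ) :
    ‖∑ i ∈ Finset.Ico 1 N, g i * P.onsagerResc ε m ψ i‖ₑ
      ≤ ENNReal.ofReal (3 * (2 * P.zs + P.q) * G * ρ₀ * θ)
        + ENNReal.ofReal (1 / (P.zs * θ)) * P.actionResc ε m ψ := by
  have hz := P.zs_pos
  have hq := P.q_pos
  set β := 1 - P.α + P.γ with hβ
  have hsr : ∀ i, Summable fun l : Set.Ici 1 =>
      P.k l * P.nHat m l * (-nabla ψ l) * reactionVec l i := by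
    intro i
    refine Summable.of_norm_bounded (g := fun l : Set.Ici 1 => 3 * |P.k l * P.nHat m l * nabla ψ l|)
      (hsum.abs.mul_left 3) fun l => ?_
    have hr : |reactionVec l i| ≤ 3 := by
      unfold reactionVec
      split_ifs <;> norm_num
    rw [Real.norm_eq_abs, abs_mul, mul_neg, abs_neg, mul_comm]
    gcongr
  have e1 : ∑ i ∈ Finset.Ico 1 N, g i * P.onsagerResc ε m ψ i
      = ε ^ (-β) * ∑' l : Set.Ici 1, P.k l * P.nHat m l * nabla ψ l * nabla g l := by
    have : ∀ i, g i * P.onsagerResc ε m ψ i = ε ^ (-β) *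
        ∑' l : Set.Ici 1, g i * (P.k l * P.nHat m l * (-nabla ψ l) * reactionVec l i) := by
      intro i
      rw [tsum_mul_left]
      unfold onsagerResc onsager
      ring
    simp only [this]
    rw [← Finset.mul_sum, ← Summable.tsum_finsetSum fun i _ => (hsr i).mul_left (g i)]
    congr 1
    refine tsum_congr fun l => ?_
    have h2 := sum_mul_reactionVec (l := l) h0 hN
    have : ∀ i, g i * (P.k l * P.nHat m l * (-nabla ψ l) * reactionVec l i)
        = -(P.k l * P.nHat m l * nabla ψ l) * (g i * reactionVec l i) := fun i => by ring
    simp only [this]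
    rw [← Finset.mul_sum, h2]
    ring
  -- In Young's inequality the parameter `θ ε^γ` cancels all powers of `ε` in the mobility part and
  -- produces exactly the scaling of the action in the other.
  have hτ : 0 < θ * ε ^ P.γ := by positivity
  set τ := θ * ε ^ P.γ with hτdef
  rw [e1, enorm_mul, Real.enorm_of_nonneg (by positivity : 0 ≤ ε ^ (-β))]
  have hbound : ‖∑' l : Set.Ici 1, P.k l * P.nHat m l * nabla ψ l * nabla g l‖ₑ
      ≤ ENNReal.ofReal τ * ENNReal.ofReal (3 * (2 * P.zs + P.q) * G * ρ₀ * ε ^ (1 - P.α))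
        + ENNReal.ofReal (1 / τ) * P.action m ψ := by
    refine enorm_tsum_le_tsum_enorm.trans ?_
    refine le_trans ?_ (add_le_add
      (mul_le_mul_right (P.tsum_k_mul_nHat_le hε h hm1 hG0 hG) _) le_rfl)
    unfold action
    rw [← ENNReal.tsum_mul_left, ← ENNReal.tsum_mul_left, ← ENNReal.tsum_add]
    refine ENNReal.tsum_le_tsum fun l => ?_
    have hk := (P.k_mul_nHat_mem h.nonneg (l := l) l.2).1
    rw [← ENNReal.ofReal_mul hτ.le, ← ENNReal.ofReal_mul (by positivity),
      ← ENNReal.ofReal_add (by positivity) (by positivity), Real.enorm_eq_ofReal_abs]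
    refine ENNReal.ofReal_le_ofReal ?_
    rw [mul_assoc, abs_mul, abs_of_nonneg hk, abs_mul]
    set X := |nabla ψ l| with hX
    set Y := |nabla g l| with hY
    have hXY : X * Y ≤ τ * Y ^ 2 + 1 / τ * X ^ 2 := by
      have h3 : 0 ≤ (τ * Y - X) ^ 2 := sq_nonneg _
      have h4 : τ * (X * Y) ≤ τ * (τ * Y ^ 2 + 1 / τ * X ^ 2) := by
        have : τ * (τ * Y ^ 2 + 1 / τ * X ^ 2) = (τ * Y) ^ 2 + X ^ 2 := by field_simp
        rw [this]
        nlinarith [sq_nonneg (τ * Y + X), abs_nonneg (nabla ψ l), abs_nonneg (nabla g l)]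
      exact le_of_mul_le_mul_left h4 hτ
    rw [← sq_abs (nabla g l), ← sq_abs (nabla ψ l), ← hX, ← hY]
    have := mul_le_mul_of_nonneg_left hXY hk
    linarith
  refine (mul_le_mul_right hbound _).trans (le_of_eq ?_)
  rw [mul_add]
  congr 1
  · have hρ := h.mass_nonneg
    rw [← ENNReal.ofReal_mul (by positivity), ← ENNReal.ofReal_mul (by positivity)]
    congr 1
    have e : ε ^ (-β) * (ε ^ P.γ * ε ^ (1 - P.α)) = 1 := by
      rw [← Real.rpow_add hε, ← Real.rpow_add hε,
        show -β + (P.γ + (1 - P.α)) = 0 by rw [hβ]; ring, Real.rpow_zero]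
    rw [hτdef]
    linear_combination (3 * (2 * P.zs + P.q) * G * ρ₀ * θ) * e
  · unfold actionResc
    rw [← mul_assoc, ← mul_assoc, ← ENNReal.ofReal_mul (by positivity),
      ← ENNReal.ofReal_mul (by positivity)]
    congr 2
    rw [hτdef, show -(1 - P.α + 2 * P.γ) = -β + -P.γ by rw [hβ]; ring, Real.rpow_add hε,
      Real.rpow_neg hε.le P.γ]
    field_simp

/-- Time regularity of linear functionals of a curve of finite action. -/
lemma IsRescaledCurve.abs_sum_sub_le (h : P.IsRescaledCurve ρ₀ K T ε n φ) (hT : 0 < T) (hε : 0 < ε)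
    (hn1 : ∀ t ∈ Set.Icc 0 T, n t 1 ≤ 2 * P.zs) {g : ℕ → ℝ} {G θ : ℝ} {N : ℕ}
    (hG0 : 0 ≤ G) (hG : ∀ l, 1 ≤ l → nabla g l ^ 2 ≤ G * (ε * ((l : ℝ) + 1)) ^ (1 - P.α))
    (h0 : g 0 = 0) (hN : ∀ l, N ≤ l → g l = 0) (hθ : 0 < θ) {s t : ℝ} (hs : 0 ≤ s) (hst : s ≤ t)
    (ht : t ≤ T) :
    |∑ l ∈ Finset.Ico 1 N, g l * n t l - ∑ l ∈ Finset.Ico 1 N, g l * n s l|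
      ≤ 3 * (2 * P.zs + P.q) * G * ρ₀ * θ * (t - s)
        + 1 / (P.zs * θ) * (∫⁻ t in Set.Icc 0 T, P.actionResc ε (n t) (φ t)).toReal := by
  have hz := P.zs_pos
  have hq := P.q_pos
  have hρ := (h.state 0 ⟨le_rfl, hT.le⟩).mass_nonneg
  have hsub : Set.uIcc s t ⊆ Set.uIcc 0 T := by
    rw [Set.uIcc_of_le hst, Set.uIcc_of_le hT.le]
    exact Set.Icc_subset_Icc hs ht
  have hac : ∀ l ∈ Finset.Ico 1 N, AbsolutelyContinuousOnInterval (fun r => n r l) s t :=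
    fun l hl => (h.absCont l (Finset.mem_Ico.1 hl).1).mono hsub
  have e1 : ∑ l ∈ Finset.Ico 1 N, g l * n t l - ∑ l ∈ Finset.Ico 1 N, g l * n s l
      = ∫ r in s..t, ∑ l ∈ Finset.Ico 1 N, g l * deriv (fun r => n r l) r := by
    rw [intervalIntegral.integral_finsetSum fun l hl => (hac l hl).intervalIntegrable_deriv.const_mul _,
      ← Finset.sum_sub_distrib]
    refine Finset.sum_congr rfl fun l hl => ?_
    rw [intervalIntegral.integral_const_mul, (hac l hl).integral_deriv_eq_sub]
    ring
  set A := ∫⁻ t in Set.Icc 0 T, P.actionResc ε (n t) (φ t) with hA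
  have hAtop : A ≠ ⊤ := h.finite_action.ne
  have hae : ∀ᵐ r ∂(volume.restrict (Set.Ioc s t)),
      ‖∑ l ∈ Finset.Ico 1 N, g l * deriv (fun r => n r l) r‖ₑ
      ≤ ENNReal.ofReal (3 * (2 * P.zs + P.q) * G * ρ₀ * θ)
        + ENNReal.ofReal (1 / (P.zs * θ)) * P.actionResc ε (n r) (φ r) := by
    have h1 : ∀ᵐ r ∂(volume : Measure ℝ), ∀ i, 1 ≤ i → r ∈ Set.Ioo 0 T →
        deriv (fun t => n t i) r = -P.onsagerResc ε (n r) (φ r) i :=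
      ae_all_iff.2 fun i => by
        by_cases hi : 1 ≤ i
        · filter_upwards [h.ae_deriv_eq hT hi] with r hr _ using hr
        · exact Eventually.of_forall fun r hi' => absurd hi' hi
    have h2 := (ae_restrict_iff' measurableSet_Icc).1 h.covector
    have h3 : ∀ᵐ r ∂(volume : Measure ℝ), r ≠ T := by
      simp [ae_iff, measure_singleton]
    rw [ae_restrict_iff' measurableSet_Ioc]
    filter_upwards [h1, h2, h3] with r hr1 hr2 hr3 hmem
    have hr0 : 0 < r := hs.trans_lt hmem.1
    have hrT : r ≤ T := hmem.2.trans ht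
    have hrI : r ∈ Set.Icc 0 T := ⟨hr0.le, hrT⟩
    have e2 : ∑ l ∈ Finset.Ico 1 N, g l * deriv (fun r => n r l) r
        = -∑ l ∈ Finset.Ico 1 N, g l * P.onsagerResc ε (n r) (φ r) l := by
      rw [← Finset.sum_neg_distrib]
      refine Finset.sum_congr rfl fun l hl => ?_
      rw [hr1 l (Finset.mem_Ico.1 hl).1 ⟨hr0, lt_of_le_of_ne hrT hr3⟩]
      ring
    rw [e2, enorm_neg]
    exact enorm_sum_onsagerResc_le hε (h.state r hrI) (hn1 r hrI) (hr2 hrI) hG0 hG h0 hN hθ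
  have hbound : ‖∫ r in s..t, ∑ l ∈ Finset.Ico 1 N, g l * deriv (fun r => n r l) r‖ₑ
      ≤ ENNReal.ofReal (3 * (2 * P.zs + P.q) * G * ρ₀ * θ * (t - s)
        + 1 / (P.zs * θ) * A.toReal) := by
    rw [intervalIntegral.integral_of_le hst]
    refine (enorm_integral_le_lintegral_enorm _).trans ((lintegral_mono_ae hae).trans ?_)
    rw [lintegral_add_left measurable_const, lintegral_const_mul' _ _ ENNReal.ofReal_ne_top,
      lintegral_const, Measure.restrict_apply_univ, Real.volume_Ioc,
      ENNReal.ofReal_add (by have := sub_nonneg.2 hst; positivity) (by positivity),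
      ENNReal.ofReal_mul (p := 3 * (2 * P.zs + P.q) * G * ρ₀ * θ) (by positivity),
      ENNReal.ofReal_mul (p := 1 / (P.zs * θ)) (by positivity), ENNReal.ofReal_toReal hAtop]
    refine add_le_add le_rfl (mul_le_mul_right ?_ _)
    refine lintegral_mono_set ?_
    exact (Set.Ioc_subset_Ioc hs ht).trans Set.Ioc_subset_Icc_self
  rw [e1, ← Real.norm_eq_abs]
  rw [← ofReal_norm] at hbound
  refine (ENNReal.ofReal_le_ofReal_iff ?_).1 hbound
  have := sub_nonneg.2 hst
  positivity

end Rates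

/-! ### Piecewise linear test functions and compactness of curves of probability measures -/

/-- The continuous function which is `1` on `(-∞, a]`, `0` on `[b, ∞)` and affine in between. -/
def trap (a b y : ℝ) : ℝ := max 0 (min 1 ((b - y) / (b - a)))

lemma trap_nonneg (a b y : ℝ) : 0 ≤ trap a b y := le_max_left _ _

lemma trap_le_one (a b y : ℝ) : trap a b y ≤ 1 := max_le zero_le_one (min_le_left _ _)

lemma trap_of_le {a b y : ℝ} (hab : a < b) (hy : y ≤ a) : trap a b y = 1 := by
  unfold trap
  have : 1 ≤ (b - y) / (b - a) := by
    rw [le_div_iff₀ (by linarith)]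
    linarith
  rw [min_eq_left this, max_eq_right zero_le_one]

lemma trap_of_ge {a b y : ℝ} (hab : a < b) (hy : b ≤ y) : trap a b y = 0 := by
  unfold trap
  have : (b - y) / (b - a) ≤ 0 := div_nonpos_of_nonpos_of_nonneg (by linarith) (by linarith)
  exact max_eq_left ((min_le_right _ _).trans this)

lemma continuous_trap (a b : ℝ) : Continuous (trap a b) := by
  unfold trap
  fun_prop

lemma abs_trap_le (a b y : ℝ) : |trap a b y| ≤ 1 := by
  rw [abs_of_nonneg (trap_nonneg a b y)]
  exact trap_le_one a b y

lemma abs_trap_sub_le {a b : ℝ} (hab : a < b) (y z : ℝ) :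
    |trap a b y - trap a b z| ≤ |y - z| / (b - a) := by
  have h : 0 < b - a := by linarith
  unfold trap
  calc |max 0 (min 1 ((b - y) / (b - a))) - max 0 (min 1 ((b - z) / (b - a)))|
      ≤ |min 1 ((b - y) / (b - a)) - min 1 ((b - z) / (b - a))| := by
        have := abs_max_sub_max_le_max 0 (min 1 ((b - y) / (b - a))) 0 (min 1 ((b - z) / (b - a)))
        simpa using this
    _ ≤ |(b - y) / (b - a) - (b - z) / (b - a)| := by
        have := abs_min_sub_min_le_max 1 ((b - y) / (b - a)) 1 ((b - z) / (b - a))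
        simpa using this
    _ = |y - z| / (b - a) := by
        rw [← sub_div, abs_div, abs_of_pos h, ← abs_neg]
        congr 2
        ring

lemma integrable_trap (a b : ℝ) (μ : Measure ℝ) [IsFiniteMeasure μ] : Integrable (trap a b) μ :=
  Integrable.of_bound (continuous_trap a b).aestronglyMeasurable 1
    (Eventually.of_forall fun y => abs_trap_le a b y)

/-- `trap a b` as a bounded continuous function. -/
def trapBCF (a b : ℝ) : BoundedContinuousFunction ℝ ℝ :=
  BoundedContinuousFunction.ofNormedAddCommGroup (trap a b) (continuous_trap a b) 1 (abs_trap_le a b)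

lemma tendsto_trap_inv (a y : ℝ) :
    Tendsto (fun m : ℕ => trap a (a + 1 / ((m : ℝ) + 1)) y) atTop
      (𝓝 ((Set.Iic a).indicator (fun _ => 1) y)) := by
  have hpos : ∀ m : ℕ, a < a + 1 / ((m : ℝ) + 1) := fun m => by
    have : (0 : ℝ) < 1 / ((m : ℝ) + 1) := by positivity
    linarith
  by_cases hy : y ≤ a
  · rw [Set.indicator_of_mem (Set.mem_Iic.2 hy)]
    refine tendsto_const_nhds.congr fun m => (trap_of_le (hpos m) hy).symm
  · rw [Set.indicator_of_notMem (by simpa using hy)]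
    push Not at hy
    refine tendsto_const_nhds.congr' ?_
    have h := (tendsto_one_div_add_atTop_nhds_zero_nat (𝕜 := ℝ)).eventually
      (gt_mem_nhds (sub_pos.2 hy))
    filter_upwards [h] with m hm
    exact (trap_of_ge (hpos m) (by linarith)).symm

/-- These functions approximate the indicators of half-lines, which determine a finite measure. -/
lemma ext_of_integral_trap {μ ν : Measure ℝ} [IsFiniteMeasure μ] [IsFiniteMeasure ν]
    (h : ∀ a b : ℝ, a < b → ∫ y, trap a b y ∂μ = ∫ y, trap a b y ∂ν) : μ = ν := by
  have key : ∀ (κ : Measure ℝ) [IsFiniteMeasure κ] (a : ℝ),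
      Tendsto (fun m : ℕ => ∫ y, trap a (a + 1 / ((m : ℝ) + 1)) y ∂κ) atTop
        (𝓝 (κ.real (Set.Iic a))) := by
    intro κ _ a
    have e : κ.real (Set.Iic a) = ∫ y, (Set.Iic a).indicator (fun _ => (1 : ℝ)) y ∂κ := by
      rw [integral_indicator measurableSet_Iic]
      simp
    rw [e]
    refine tendsto_integral_of_dominated_convergence (fun _ => 1)
      (fun m => (continuous_trap _ _).aestronglyMeasurable) (integrable_const 1)
      (fun m => Eventually.of_forall fun y => abs_trap_le _ _ y)
      (Eventually.of_forall fun y => tendsto_trap_inv a y)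
  refine Measure.ext_of_Iic μ ν fun a => ?_
  have h1 := key μ a
  have h2 := key ν a
  have h3 : (fun m : ℕ => ∫ y, trap a (a + 1 / ((m : ℝ) + 1)) y ∂μ)
      = fun m : ℕ => ∫ y, trap a (a + 1 / ((m : ℝ) + 1)) y ∂ν := by
    funext m
    refine h _ _ ?_
    have : (0 : ℝ) < 1 / ((m : ℝ) + 1) := by positivity
    linarith
  rw [h3] at h1
  exact (measureReal_eq_measureReal_iff).1 (tendsto_nhds_unique h1 h2)

/-- An Arzelà–Ascoli theorem for curves of probability measures on the line. -/
theorem exists_subseq_tendsto_probabilityMeasure {T : ℝ} (hT : 0 < T)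
    (p : ℕ → ℝ → ProbabilityMeasure ℝ)
    (htight : ∀ η : ℝ, 0 < η → ∃ R : ℝ, ∀ j, ∀ t ∈ Set.Icc 0 T,
      (p j t : Measure ℝ) (Set.Icc (-R) R)ᶜ ≤ ENNReal.ofReal η)
    (hequi : ∀ a b : ℝ, a < b → ∀ η : ℝ, 0 < η → ∃ d : ℝ, 0 < d ∧ ∀ j, ∀ s ∈ Set.Icc 0 T,
      ∀ t ∈ Set.Icc 0 T, |t - s| ≤ d →
        |∫ y, trap a b y ∂(p j t : Measure ℝ) - ∫ y, trap a b y ∂(p j s : Measure ℝ)| ≤ η) :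
    ∃ (σ : ℕ → ℕ) (μ : ℝ → ProbabilityMeasure ℝ), StrictMono σ ∧
      ∀ t ∈ Set.Icc 0 T, Tendsto (fun j => p (σ j) t) atTop (𝓝 (μ t)) := by
  choose! R hR using fun m : ℕ => htight ((1 / 2) ^ m) (by positivity)
  set 𝒦 : Set (ProbabilityMeasure ℝ) :=
    {μ | ∀ m, μ (Set.Icc (-R m) (R m))ᶜ ≤ (1 / 2 : NNReal) ^ m} with h𝒦
  have hcomp : IsCompact 𝒦 :=
    isCompact_setOfPred_probabilityMeasure_mass_eq_compl_isCompact_le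
      (NNReal.tendsto_pow_atTop_nhds_zero_of_lt_one (by norm_num))
      (fun m => isCompact_Icc) (Or.inl inferInstance)
  have hmem : ∀ j, ∀ t ∈ Set.Icc 0 T, p j t ∈ 𝒦 := by
    intro j t ht m
    have h := hR m j t ht
    rw [← ENNReal.coe_le_coe, ProbabilityMeasure.ennreal_coeFn_eq_coeFn_toMeasure]
    refine h.trans (le_of_eq ?_)
    rw [ENNReal.ofReal_pow (by norm_num)]
    push_cast
    congr 1
    rw [ENNReal.ofReal_div_of_pos (by norm_num)]
    simp
  have hne : Nonempty (Set.Icc 0 T) := ⟨⟨0, le_rfl, hT.le⟩⟩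
  set D : ℕ → Set.Icc 0 T := TopologicalSpace.denseSeq (Set.Icc 0 T) with hD
  have hDd : DenseRange D := TopologicalSpace.denseRange_denseSeq _
  -- Compactness of the countable product replaces a diagonal argument: one subsequence converges at
  -- all times of a dense set.
  have hpi : IsCompact (Set.pi Set.univ fun _ : ℕ => 𝒦) := isCompact_univ_pi fun _ => hcomp
  obtain ⟨_, -, σ, hσ, hlim⟩ := hpi.tendsto_subseq (x := fun j i => p j (D i))
    fun j i _ => hmem j _ (D i).2
  rw [tendsto_pi_nhds] at hlim
  have hcau : ∀ t ∈ Set.Icc 0 T, ∀ a b : ℝ, a < b → ∃ L, Tendsto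
      (fun j => ∫ y, trap a b y ∂(p (σ j) t : Measure ℝ)) atTop (𝓝 L) := by
    intro t ht a b hab
    refine cauchySeq_tendsto_of_complete ?_
    rw [Metric.cauchySeq_iff]
    intro η hη
    obtain ⟨d, hd, hdd⟩ := hequi a b hab (η / 4) (by positivity)
    obtain ⟨i, hi⟩ := hDd.exists_dist_lt ⟨t, ht⟩ hd
    have hi' : |(D i : ℝ) - t| ≤ d := by
      rw [dist_comm] at hi
      exact hi.le
    have hc := (ProbabilityMeasure.tendsto_iff_forall_integral_tendsto.1 (hlim i)
      (trapBCF a b)).cauchySeq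
    obtain ⟨J, hJ⟩ := Metric.cauchySeq_iff.1 hc (η / 4) (by positivity)
    refine ⟨J, fun j hj k hk => ?_⟩
    have h1 := hJ j hj k hk
    have h2 := hdd (σ j) t ht _ (D i).2 hi'
    have h3 := hdd (σ k) t ht _ (D i).2 hi'
    rw [Real.dist_eq] at h1 ⊢
    change |∫ y, trap a b y ∂(p (σ j) (D i) : Measure ℝ)
      - ∫ y, trap a b y ∂(p (σ k) (D i) : Measure ℝ)| < η / 4 at h1
    rw [abs_lt] at h1 ⊢
    rw [abs_le] at h2 h3
    constructor <;> linarith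
  -- Tightness supplies a cluster point at every time; convergence of the integrals of all `trap`
  -- functions makes it unique.
  have hlimt : ∀ t, ∃ μ, t ∈ Set.Icc 0 T → Tendsto (fun j => p (σ j) t) atTop (𝓝 μ) := by
    intro t
    by_cases ht : t ∈ Set.Icc 0 T
    swap
    · exact ⟨p 0 0, fun h => absurd h ht⟩
    have hev : ∀ᶠ j in atTop, p (σ j) t ∈ 𝒦 := Eventually.of_forall fun j => hmem _ t ht
    obtain ⟨μ, hμ, hcl⟩ := hcomp.exists_mapClusterPt (f := atTop) (u := fun j => p (σ j) t)
      (le_principal_iff.2 hev)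
    refine ⟨μ, fun _ => hcomp.tendsto_nhds_of_unique_mapClusterPt hev fun μ' _ hcl' => ?_⟩
    have huniq : ∀ κ : ProbabilityMeasure ℝ, MapClusterPt κ atTop (fun j => p (σ j) t) →
        ∀ a b L, Tendsto (fun j => ∫ y, trap a b y ∂(p (σ j) t : Measure ℝ)) atTop (𝓝 L) →
        ∫ y, trap a b y ∂(κ : Measure ℝ) = L := by
      intro κ hκ a b L hL
      have hcont : Continuous fun κ : ProbabilityMeasure ℝ => ∫ y, trap a b y ∂(κ : Measure ℝ) :=
        ProbabilityMeasure.continuous_integral_boundedContinuousFunction (trapBCF a b)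
      have h1 := hκ.tendsto_comp (hcont.tendsto κ)
      exact (neBot_of_le (f := 𝓝 _ ⊓ map _ atTop) (hf := h1) (inf_le_inf_left _ hL)) |> eq_of_nhds_neBot
    have he : (μ' : Measure ℝ) = (μ : Measure ℝ) := ext_of_integral_trap fun a b hab => by
      obtain ⟨L, hL⟩ := hcau t ht a b hab
      rw [huniq μ hcl a b L hL]
      exact huniq μ' hcl' a b L hL
    exact Subtype.ext he
  choose μ hμ using hlimt
  exact ⟨σ, μ, hσ, fun t ht => hμ t ht⟩

/-! ### The mass distribution on the macroscopic scale -/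

/-- The probability measure `ϱ₀⁻¹ ∑ l n_l δ_{εl}`. -/
def massMeasure (ρ₀ ε : ℝ) (n : ℕ → ℝ) : Measure ℝ :=
  Measure.sum fun l : ℕ => ENNReal.ofReal (l * n l / ρ₀) • Measure.dirac (ε * (l : ℕ))

lemma lintegral_massMeasure (ρ₀ ε : ℝ) (n : ℕ → ℝ) (f : ℝ → ℝ≥0∞) :
    ∫⁻ y, f y ∂(massMeasure ρ₀ ε n)
      = ∑' l : ℕ, ENNReal.ofReal (l * n l / ρ₀) * f (ε * (l : ℕ)) := by
  unfold massMeasure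
  rw [lintegral_sum_measure]
  refine tsum_congr fun l => ?_
  rw [lintegral_smul_measure, lintegral_dirac, smul_eq_mul]

/-- The sequence `l ↦ l χ(εl)`. -/
def massTest (ε : ℝ) (χ : ℝ → ℝ) (l : ℕ) : ℝ := l * χ (ε * l)

lemma nabla_massTest (ε : ℝ) (χ : ℝ → ℝ) (l : ℕ) :
    nabla (massTest ε χ) l = l * (χ (ε * (l + 1)) - χ (ε * l)) + (χ (ε * (l + 1)) - χ ε) := by
  unfold nabla massTest
  push_cast
  rw [mul_one]
  ring

/-- By mass conservation `nabla` annihilates `l ↦ l`, so only the variation of the cut-off function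
counts. With `Y = ε(l+1)` it is `O(Y)` for `Y ≤ 1` by Lipschitz continuity and `O(1)` for `Y ≥ 1`
because the function vanishes from `b` on; either is at most a multiple of `Y^{p/2}`. -/
lemma nabla_massTest_trap_sq_le {a b : ℝ} (hab : a < b) {ε : ℝ} (h0 : 0 < ε) {p : ℝ}
    (hp0 : 0 ≤ p) (hp1 : p ≤ 1) (l : ℕ) :
    nabla (massTest ε (trap a b)) l ^ 2
      ≤ (4 / (b - a) ^ 2 + (|b| / (b - a) + 1) ^ 2) * (ε * ((l : ℝ) + 1)) ^ p := by
  have hd : 0 < b - a := by linarith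
  have hl : (0 : ℝ) ≤ l := Nat.cast_nonneg l
  rw [nabla_massTest]
  set Y := ε * ((l : ℝ) + 1) with hY
  have hYpos : 0 < Y := by positivity
  have h1 : |trap a b Y - trap a b (ε * l)| ≤ ε / (b - a) := by
    have := abs_trap_sub_le hab Y (ε * l)
    rwa [show Y - ε * l = ε by rw [hY]; ring, abs_of_pos h0] at this
  have h2 : |trap a b Y - trap a b ε| ≤ ε * l / (b - a) := by
    have := abs_trap_sub_le hab Y ε
    rwa [show Y - ε = ε * l by rw [hY]; ring, abs_of_nonneg (by positivity : 0 ≤ ε * (l : ℝ))] at this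
  have h3 : |trap a b Y - trap a b ε| ≤ 1 := by
    rw [abs_le]
    have := trap_nonneg a b Y
    have := trap_nonneg a b ε
    have := trap_le_one a b Y
    have := trap_le_one a b ε
    constructor <;> linarith
  have h4 : |l * (trap a b Y - trap a b (ε * l))| ≤ ε * l / (b - a) := by
    rw [abs_mul, abs_of_nonneg hl]
    calc l * |trap a b Y - trap a b (ε * l)| ≤ l * (ε / (b - a)) := by gcongr
      _ = _ := by ring
  have h5 : |l * (trap a b Y - trap a b (ε * l))| ≤ |b| / (b - a) := by
    rcases le_total b (ε * l) with hb | hb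
    · rw [trap_of_ge hab hb, trap_of_ge hab (hb.trans (by rw [hY]; nlinarith))]
      simp only [sub_self, mul_zero, abs_zero]
      positivity
    · refine h4.trans ?_
      have := hb.trans (le_abs_self b)
      gcongr
  have h6 := abs_add_le (l * (trap a b Y - trap a b (ε * l))) (trap a b Y - trap a b ε)
  rw [← sq_abs]
  rcases le_total Y 1 with hY1 | hY1
  · have h7 : |l * (trap a b Y - trap a b (ε * l)) + (trap a b Y - trap a b ε)| ≤ 2 / (b - a) * Y := by
      have : ε * l / (b - a) ≤ Y / (b - a) := by
        gcongr
        rw [hY]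
        nlinarith
      have e : 2 / (b - a) * Y = Y / (b - a) + Y / (b - a) := by ring
      rw [e]
      linarith
    have h8 : Y ^ 2 ≤ Y ^ p := by
      rw [← Real.rpow_natCast]
      exact Real.rpow_le_rpow_of_exponent_ge hYpos hY1 (by push_cast; linarith)
    calc _ ≤ (2 / (b - a) * Y) ^ 2 := by gcongr
      _ = 4 / (b - a) ^ 2 * Y ^ 2 := by rw [mul_pow, div_pow]; norm_num
      _ ≤ 4 / (b - a) ^ 2 * Y ^ p := by gcongr
      _ ≤ _ := by
        refine mul_le_mul_of_nonneg_right ?_ (by positivity)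
        have := sq_nonneg (|b| / (b - a) + 1)
        linarith
  · have h7 := h6.trans (add_le_add h5 h3)
    have h8 : 1 ≤ Y ^ p := Real.one_le_rpow hY1 hp0
    have h9 : 0 ≤ 4 / (b - a) ^ 2 := by positivity
    calc _ ≤ (|b| / (b - a) + 1) ^ 2 := by gcongr
      _ ≤ 4 / (b - a) ^ 2 + (|b| / (b - a) + 1) ^ 2 := by linarith
      _ ≤ _ := le_mul_of_one_le_right (by positivity) h8

/-- The gradient vanishes while `ε(l+1) ≤ R` and is at most `3` afterwards. The factor `R^{-p}`
makes transport of mass to large sizes slow. -/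
lemma nabla_massTest_trap_tail_sq_le {R : ℝ} (hR : 0 < R) {ε : ℝ} (h0 : 0 < ε) {p : ℝ}
    (hp0 : 0 ≤ p) (l : ℕ) :
    nabla (massTest ε (trap R (2 * R))) l ^ 2 ≤ 9 * R ^ (-p) * (ε * ((l : ℝ) + 1)) ^ p := by
  have hab : R < 2 * R := by linarith
  have hl : (0 : ℝ) ≤ l := Nat.cast_nonneg l
  have hlY : ε * l ≤ ε * ((l : ℝ) + 1) := by nlinarith
  have hεY : ε ≤ ε * ((l : ℝ) + 1) := by nlinarith
  rw [nabla_massTest]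
  set Y := ε * ((l : ℝ) + 1) with hY
  have hYpos : 0 < Y := by positivity
  rcases le_total Y R with hYR | hYR
  · rw [trap_of_le hab hYR, trap_of_le hab (hlY.trans hYR), trap_of_le hab (hεY.trans hYR)]
    rw [sub_self, mul_zero, add_zero, zero_pow two_ne_zero]
    positivity
  · have h3 : |trap R (2 * R) Y - trap R (2 * R) ε| ≤ 1 := by
      rw [abs_le]
      have := trap_nonneg R (2 * R) Y
      have := trap_nonneg R (2 * R) ε
      have := trap_le_one R (2 * R) Y
      have := trap_le_one R (2 * R) ε
      constructor <;> linarith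
    have h5 : |l * (trap R (2 * R) Y - trap R (2 * R) (ε * l))| ≤ 2 := by
      rcases le_total (2 * R) (ε * l) with hb | hb
      · rw [trap_of_ge hab hb, trap_of_ge hab (hb.trans hlY)]
        simp
      · have h1 := abs_trap_sub_le hab Y (ε * l)
        rw [show Y - ε * l = ε by rw [hY]; ring, abs_of_pos h0, show 2 * R - R = R by ring] at h1
        rw [abs_mul, abs_of_nonneg hl]
        calc l * |trap R (2 * R) Y - trap R (2 * R) (ε * l)| ≤ l * (ε / R) := by gcongr
          _ = ε * l / R := by ring
          _ ≤ 2 := by rwa [div_le_iff₀ hR]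
    have h6 := (abs_add_le (l * (trap R (2 * R) Y - trap R (2 * R) (ε * l)))
      (trap R (2 * R) Y - trap R (2 * R) ε)).trans (add_le_add h5 h3)
    have h7 : 1 ≤ R ^ (-p) * Y ^ p := by
      rw [Real.rpow_neg hR.le, ← div_eq_inv_mul, ← Real.div_rpow hYpos.le hR.le]
      exact Real.one_le_rpow ((one_le_div hR).2 hYR) hp0
    rw [← sq_abs, mul_assoc]
    calc _ ≤ ((2 : ℝ) + 1) ^ 2 := by gcongr
      _ = 9 * 1 := by norm_num
      _ ≤ _ := by gcongr

namespace Rates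

variable {P : Rates} {ρ₀ K ε : ℝ} {n : ℕ → ℝ}

lemma IsState.mass_term_nonneg (h : P.IsState ρ₀ K ε n) (l : ℕ) : 0 ≤ (l : ℝ) * n l := by
  rcases Nat.eq_zero_or_pos l with rfl | hl
  · simp
  · exact mul_nonneg (Nat.cast_nonneg l) (h.nonneg l hl)

lemma IsState.isProbabilityMeasure_massMeasure (h : P.IsState ρ₀ K ε n) (hρ : 0 < ρ₀) :
    IsProbabilityMeasure (massMeasure ρ₀ ε n) := by
  constructor
  have h1 := lintegral_massMeasure ρ₀ ε n (fun _ => 1)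
  rw [lintegral_one] at h1
  rw [h1]
  simp only [mul_one]
  rw [← ENNReal.ofReal_tsum_of_nonneg (fun l => div_nonneg (h.mass_term_nonneg l) hρ.le)
    (h.mass.div_const ρ₀).summable, (h.mass.div_const ρ₀).tsum_eq, div_self hρ.ne', ENNReal.ofReal_one]

lemma IsState.hasSum_integral_massMeasure (h : P.IsState ρ₀ K ε n) (hρ : 0 < ρ₀) {f : ℝ → ℝ}
    {C : ℝ} (hf : ∀ y, |f y| ≤ C) :
    HasSum (fun l : ℕ => (l : ℝ) * n l * f (ε * l)) (ρ₀ * ∫ y, f y ∂(massMeasure ρ₀ ε n)) := by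
  have hw : ∀ l : ℕ, 0 ≤ (l : ℝ) * n l / ρ₀ := fun l => div_nonneg (h.mass_term_nonneg l) hρ.le
  have hs : Summable fun l : ℕ => (ENNReal.ofReal (l * n l / ρ₀)).toReal * ‖f (ε * l)‖ := by
    refine Summable.of_nonneg_of_le (fun l => by positivity) (fun l => ?_)
      ((h.mass.div_const ρ₀).mul_right C).summable
    rw [ENNReal.toReal_ofReal (hw l)]
    exact mul_le_mul_of_nonneg_left (hf _) (hw l)
  have h1 := (hasSum_integral_sum_dirac (fun l => ENNReal.ofReal_ne_top) hs).mul_left ρ₀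
  refine h1.congr_fun ?_
  intro l
  simp only [smul_eq_mul]
  rw [ENNReal.toReal_ofReal (hw l)]
  field_simp

lemma IsState.integral_trap_eq_sum (h : P.IsState ρ₀ K ε n) (hρ : 0 < ρ₀) (h0 : 0 < ε) {a b : ℝ}
    (hab : a < b) {N : ℕ} (hN : b ≤ ε * N) :
    ρ₀ * ∫ y, trap a b y ∂(massMeasure ρ₀ ε n)
      = ∑ l ∈ Finset.Ico 1 N, massTest ε (trap a b) l * n l := by
  have h1 := h.hasSum_integral_massMeasure hρ (abs_trap_le a b)
  refine h1.unique ?_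
  have e : (fun l : ℕ => (l : ℝ) * n l * trap a b (ε * l))
      = fun l => massTest ε (trap a b) l * n l := by
    funext l
    unfold massTest
    ring
  rw [e]
  refine hasSum_sum_of_ne_finset_zero fun l hl => ?_
  rw [Finset.mem_Ico, not_and_or, not_le, not_lt] at hl
  unfold massTest
  rcases hl with hl | hl
  · rw [show l = 0 by omega]
    simp
  · have : (N : ℝ) ≤ l := by exact_mod_cast hl
    rw [trap_of_ge hab (hN.trans (by gcongr))]
    simp

variable {T : ℝ} {n φ : ℝ → ℕ → ℝ}

/-- Time regularity of the mass distribution. -/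
lemma IsRescaledCurve.abs_integral_trap_sub_le (h : P.IsRescaledCurve ρ₀ K T ε n φ) (hT : 0 < T)
    (h0 : 0 < ε) (hρ : 0 < ρ₀) (hn1 : ∀ t ∈ Set.Icc 0 T, n t 1 ≤ 2 * P.zs) {a b : ℝ} (hab : a < b)
    {G θ A : ℝ} (hG0 : 0 ≤ G)
    (hG : ∀ l, 1 ≤ l → nabla (massTest ε (trap a b)) l ^ 2 ≤ G * (ε * ((l : ℝ) + 1)) ^ (1 - P.α))
    (hθ : 0 < θ) (hA : (∫⁻ t in Set.Icc 0 T, P.actionResc ε (n t) (φ t)).toReal ≤ A)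
    {s t : ℝ} (hs : s ∈ Set.Icc 0 T) (ht : t ∈ Set.Icc 0 T) :
    |∫ y, trap a b y ∂(massMeasure ρ₀ ε (n t)) - ∫ y, trap a b y ∂(massMeasure ρ₀ ε (n s))|
      ≤ 3 * (2 * P.zs + P.q) * G * θ * |t - s| + 1 / (ρ₀ * P.zs * θ) * A := by
  have hz := P.zs_pos
  wlog hst : s ≤ t generalizing s t
  · rw [abs_sub_comm, abs_sub_comm t s]
    exact this ht hs (le_of_not_ge hst)
  obtain ⟨N, hN⟩ := exists_nat_ge (b / ε)
  rw [div_le_iff₀' h0] at hN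
  have h1 := h.abs_sum_sub_le hT h0 hn1 (g := massTest ε (trap a b)) (N := N) hG0 hG
    (by simp [massTest]) (fun l hl => by
      have : (N : ℝ) ≤ l := by exact_mod_cast hl
      unfold massTest
      rw [trap_of_ge hab (hN.trans (by gcongr))]
      simp) hθ hs.1 hst ht.2
  rw [← (h.state t ht).integral_trap_eq_sum hρ h0 hab hN,
    ← (h.state s hs).integral_trap_eq_sum hρ h0 hab hN, ← mul_sub, abs_mul, abs_of_pos hρ] at h1
  rw [abs_of_nonneg (sub_nonneg.2 hst)]
  refine le_of_mul_le_mul_left (h1.trans ?_) hρ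
  have h2 : 1 / (P.zs * θ) * (∫⁻ t in Set.Icc 0 T, P.actionResc ε (n t) (φ t)).toReal
      ≤ 1 / (P.zs * θ) * A := by gcongr
  refine (add_le_add le_rfl h2).trans (le_of_eq ?_)
  field_simp

variable {n : ℕ → ℝ}

/-- Mass far away controls, and is controlled by, the tail test functions. -/
lemma IsState.one_sub_integral_trap_le (h : P.IsState ρ₀ K ε n) (hρ : 0 < ρ₀) (h0 : 0 < ε)
    (h1 : ε ≤ 1) {x : ℝ} (hx : 0 < x) (hx1 : x < 1) {R δ : ℝ} (hδ : 0 ≤ δ) (hR : 1 ≤ R)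
    (htail : ∫⁻ y in Set.Ioi R, ENNReal.ofReal y ∂(macMeasure x ε n) ≤ ENNReal.ofReal δ) :
    1 - ∫ y, trap R (2 * R) y ∂(massMeasure ρ₀ ε n) ≤ δ / ρ₀ := by
  have hab : R < 2 * R := by linarith
  have hp := h.isProbabilityMeasure_massMeasure hρ
  -- As `R ≥ 1`, sizes with `ε l > R` lie above the cut-off and are seen by `macMeasure`.
  have hcut : ε * (cutoff x ε : ℝ) ≤ 1 := by
    calc ε * (cutoff x ε : ℝ) ≤ ε * ε ^ (-x) := by
          gcongr
          exact cutoff_le h0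
      _ = ε ^ (1 - x) := by rw [sub_eq_add_neg, Real.rpow_add h0, Real.rpow_one]
      _ ≤ 1 := Real.rpow_le_one h0.le h1 (by linarith)
  have hs := h.mass.sub (h.hasSum_integral_massMeasure hρ (abs_trap_le R (2 * R)))
  have hnn : ∀ l : ℕ, 0 ≤ (l : ℝ) * n l - l * n l * trap R (2 * R) (ε * l) := fun l => by
    have := mul_nonneg (h.mass_term_nonneg l) (sub_nonneg.2 (trap_le_one R (2 * R) (ε * l)))
    linarith
  rw [setLIntegral_macMeasure _ _ _ _ measurableSet_Ioi,
    tsum_subtype (macSizes x ε) (fun l => ENNReal.ofReal (n l / ε) *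
      (Set.Ioi R).indicator (fun y => ENNReal.ofReal y) (ε * (l : ℕ)))] at htail
  have h2 : ENNReal.ofReal (ρ₀ - ρ₀ * ∫ y, trap R (2 * R) y ∂(massMeasure ρ₀ ε n))
      ≤ ENNReal.ofReal δ := by
    rw [← hs.tsum_eq, ENNReal.ofReal_tsum_of_nonneg hnn hs.summable]
    refine le_trans (ENNReal.tsum_le_tsum fun l => ?_) htail
    rcases le_or_gt (ε * l) R with hl | hl
    · rw [trap_of_le hab hl]
      simp
    · have hl2 : l ∈ macSizes x ε := by
        change cutoff x ε ≤ l
        by_contra hlt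
        push Not at hlt
        have h3 : (l : ℝ) ≤ cutoff x ε := by exact_mod_cast hlt.le
        have : ε * l ≤ ε * cutoff x ε := by gcongr
        linarith
      have hl0 : 0 < l := by
        rcases Nat.eq_zero_or_pos l with rfl | hl0
        · simp at hl
          linarith
        · exact hl0
      have hn := h.nonneg l hl0
      rw [Set.indicator_of_mem hl2, Set.indicator_of_mem (Set.mem_Ioi.2 hl),
        ← ENNReal.ofReal_mul (by positivity)]
      refine ENNReal.ofReal_le_ofReal ?_
      have e : n l / ε * (ε * l) = l * n l := by field_simp
      rw [e]
      have := mul_nonneg (h.mass_term_nonneg l) (trap_nonneg R (2 * R) (ε * l))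
      linarith
  have h3 := (ENNReal.ofReal_le_ofReal_iff hδ).1 h2
  rw [le_div_iff₀ hρ]
  linarith

lemma massMeasure_compl_Icc_le {ρ₀ ε : ℝ} {n : ℕ → ℝ} [IsProbabilityMeasure (massMeasure ρ₀ ε n)]
    (h0 : 0 < ε) {R η : ℝ} (hR : 0 < R)
    (h : 1 - ∫ y, trap R (2 * R) y ∂(massMeasure ρ₀ ε n) ≤ η) :
    massMeasure ρ₀ ε n (Set.Icc (-(2 * R)) (2 * R))ᶜ ≤ ENNReal.ofReal η := by
  have hab : R < 2 * R := by linarith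
  have h1 : massMeasure ρ₀ ε n (Set.Icc (-(2 * R)) (2 * R))ᶜ
      ≤ ∫⁻ y, ENNReal.ofReal (1 - trap R (2 * R) y) ∂(massMeasure ρ₀ ε n) := by
    rw [← lintegral_indicator_one measurableSet_Icc.compl, lintegral_massMeasure,
      lintegral_massMeasure]
    refine ENNReal.tsum_le_tsum fun l => mul_le_mul_right ?_ _
    by_cases hl : ε * (l : ℝ) ∈ (Set.Icc (-(2 * R)) (2 * R))ᶜ
    · have h2 : 2 * R ≤ ε * l := by
        by_contra hlt
        push Not at hlt
        have : 0 ≤ ε * (l : ℝ) := by positivity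
        exact hl ⟨by linarith, hlt.le⟩
      rw [Set.indicator_of_mem hl, trap_of_ge hab h2]
      simp
    · rw [Set.indicator_of_notMem hl]
      exact zero_le
  refine h1.trans ?_
  rw [← ofReal_integral_eq_lintegral_ofReal (f := fun y => 1 - trap R (2 * R) y)
    ((integrable_const 1).sub (integrable_trap _ _ _))
    (Eventually.of_forall fun y => sub_nonneg.2 (trap_le_one _ _ y)),
    integral_sub (integrable_const 1) (integrable_trap _ _ _)]
  refine ENNReal.ofReal_le_ofReal ?_
  simpa using h

/-- Integrals against the empirical measure in terms of the mass distribution. -/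
lemma IsState.integral_macMeasure_eq (h : P.IsState ρ₀ K ε n) (hρ : 0 < ρ₀) (h0 : 0 < ε)
    {x : ℝ} {ζ : ℝ → ℝ} {C c : ℝ} (hc : 0 < c) (hζ : ∀ y, |ζ y| ≤ C) (hζc : ∀ y, y ≤ c → ζ y = 0)
    (hcut : ε * cutoff x ε ≤ c) :
    ∫ y, ζ y ∂(macMeasure x ε n) = ρ₀ * ∫ y, ζ y / y ∂(massMeasure ρ₀ ε n) := by
  have hbd : ∀ y, |ζ y / y| ≤ C / c := by
    intro y
    have hC : 0 ≤ C := (abs_nonneg _).trans (hζ 0)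
    rcases le_or_gt y c with hy | hy
    · rw [hζc y hy, zero_div, abs_zero]
      positivity
    · rw [abs_div, abs_of_pos (hc.trans hy)]
      exact div_le_div₀ hC (hζ y) hc hy.le
  have h1 := h.hasSum_integral_massMeasure hρ hbd
  have hterm : ∀ l : ℕ, l ∈ macSizes x ε → 0 < l → (ENNReal.ofReal (n l / ε)).toReal * ζ (ε * l)
      = (l : ℝ) * n l * (ζ (ε * l) / (ε * l)) := by
    intro l _ hl
    have hl' : (0 : ℝ) < l := by exact_mod_cast hl
    rw [ENNReal.toReal_ofReal (div_nonneg (h.nonneg l hl) h0.le)]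
    field_simp
  have hsupp : ∀ l : ℕ, l ∉ macSizes x ε ∨ l = 0 → ζ (ε * l) = 0 := by
    intro l hl
    refine hζc _ ?_
    rcases hl with hl | rfl
    · have h2 : l < cutoff x ε := not_le.1 hl
      have h3 : (l : ℝ) ≤ cutoff x ε := by exact_mod_cast h2.le
      exact le_trans (by gcongr) hcut
    · simpa using hc.le
  have hterm' : ∀ l : macSizes x ε, (ENNReal.ofReal (n l / ε)).toReal * ζ (ε * (l : ℕ))
      = ((l : ℕ) : ℝ) * n l * (ζ (ε * (l : ℕ)) / (ε * (l : ℕ))) := by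
    intro l
    rcases Nat.eq_zero_or_pos (l : ℕ) with hl | hl
    · rw [hsupp l (Or.inr hl)]
      simp
    · exact hterm l l.2 hl
  have h2 : HasSum (fun l : macSizes x ε => (ENNReal.ofReal (n l / ε)).toReal * ζ (ε * (l : ℕ)))
      (ρ₀ * ∫ y, ζ y / y ∂(massMeasure ρ₀ ε n)) := by
    simp only [hterm']
    refine (hasSum_subtype_iff_of_support_subset
      (f := fun l : ℕ => (l : ℝ) * n l * (ζ (ε * l) / (ε * l))) ?_).2 h1
    intro l hl
    by_contra hlm
    apply hl
    simp only [hsupp l (Or.inl hlm), zero_div, mul_zero]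
  have h3 : Summable fun l : macSizes x ε => (ENNReal.ofReal (n l / ε)).toReal * ‖ζ (ε * (l : ℕ))‖ := by
    refine h2.summable.norm.congr fun l => ?_
    rw [norm_mul, Real.norm_of_nonneg ENNReal.toReal_nonneg]
  have h4 := hasSum_integral_sum_dirac (fun l : macSizes x ε => ENNReal.ofReal_ne_top) h3
  exact h4.unique h2

end Rates

/-! ### Compactness of sequences of rescaled curves -/

lemma tendsto_cutoff {x : ℝ} (hx : 0 < x) : Tendsto (cutoff x) (𝓝[>] 0) atTop := by
  have h : Tendsto (fun ε : ℝ => ε ^ (-x)) (𝓝[>] 0) atTop := by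
    refine ((tendsto_rpow_atTop hx).comp tendsto_inv_nhdsGT_zero).congr' ?_
    filter_upwards [self_mem_nhdsWithin] with ε hε
    rw [Function.comp_apply, Real.inv_rpow (le_of_lt hε), Real.rpow_neg (le_of_lt hε)]
  exact tendsto_nat_floor_atTop.comp h

lemma mul_cutoff_le {x ε : ℝ} (h0 : 0 < ε) : ε * cutoff x ε ≤ ε ^ (1 - x) := by
  calc ε * (cutoff x ε : ℝ) ≤ ε * ε ^ (-x) := by
        gcongr
        exact cutoff_le h0
    _ = ε ^ (1 - x) := by rw [sub_eq_add_neg, Real.rpow_add h0, Real.rpow_one]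

lemma eventually_mul_cutoff_le {x c : ℝ} (hx : x < 1) (hc : 0 < c) :
    ∀ᶠ ε : ℝ in 𝓝[>] 0, ε * cutoff x ε ≤ c := by
  filter_upwards [self_mem_nhdsWithin, eventually_mul_rpow_le (sub_pos.2 hx) 1 hc] with ε h0 h
  rw [one_mul] at h
  exact (mul_cutoff_le h0).trans h

namespace Rates

variable {P : Rates} {ρ₀ K T ε : ℝ}

/-- The initial energy is at most `z_s |K|` and the final one is nonnegative, so the functional
bounds action and dissipation separately. -/
lemma IsRescaledCurve.integral_toReal_le {n φ : ℝ → ℕ → ℝ} {B : ℝ}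
    (h : P.IsRescaledCurve ρ₀ K T ε n φ) (hT : 0 < T) (h0 : 0 < ε)
    (hB : P.gradFunctional T ε n φ ≤ B) :
    (∫⁻ t in Set.Icc 0 T, P.actionResc ε (n t) (φ t)).toReal ≤ 2 * (B + P.zs * |K|) ∧
      (∫⁻ t in Set.Icc 0 T, P.dissipationResc ε (Set.Ici 1) (n t)).toReal
        ≤ 2 * (B + P.zs * |K|) := by
  have hz := P.zs_pos
  have hF : (P.freeEnergyResc ε (Set.Ici 1) (n 0)).toReal ≤ P.zs * |K| := by
    refine ENNReal.toReal_le_of_le_ofReal (by positivity) ?_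
    unfold freeEnergyResc
    refine (mul_le_mul_right (h.state 0 ⟨le_rfl, hT.le⟩).energy _).trans ?_
    rw [← ENNReal.ofReal_mul (by positivity)]
    refine ENNReal.ofReal_le_ofReal ?_
    have e : ε ^ (-P.γ) * ε ^ P.γ = 1 := by rw [← Real.rpow_add h0]; simp
    calc P.zs * ε ^ (-P.γ) * (K * ε ^ P.γ) = P.zs * K * (ε ^ (-P.γ) * ε ^ P.γ) := by ring
      _ = P.zs * K := by rw [e, mul_one]
      _ ≤ _ := by
        gcongr
        exact le_abs_self K
  unfold gradFunctional at hB
  have h1 : 0 ≤ (P.freeEnergyResc ε (Set.Ici 1) (n T)).toReal := ENNReal.toReal_nonneg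
  have h2 : 0 ≤ (∫⁻ t in Set.Icc 0 T, P.actionResc ε (n t) (φ t)).toReal := ENNReal.toReal_nonneg
  have h3 : 0 ≤ (∫⁻ t in Set.Icc 0 T, P.dissipationResc ε (Set.Ici 1) (n t)).toReal :=
    ENNReal.toReal_nonneg
  constructor <;> linarith

variable (P) in
lemma eventually_abs_sum_mic_mass_sub_le (K : ℝ) {x η : ℝ} (hx : 0 < x) (hx1 : x < 1) (hη : 0 < η) :
    ∀ᶠ ε : ℝ in 𝓝[>] 0, ∀ ρ₀ n, P.IsState ρ₀ K ε n →
      |∑ l ∈ Finset.Ico 1 (cutoff x ε), (l : ℝ) * n l - P.criticalMass| ≤ η := by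
  have hγ := P.γ_pos
  obtain ⟨C, hC, hmain⟩ := P.exists_abs_sum_mic_mass_le
  have hlim : Tendsto (fun N : ℕ => ∑ l ∈ Finset.Ico 1 N, (l : ℝ) * P.ω P.zs l) atTop
      (𝓝 P.criticalMass) := by
    refine P.summable_criticalMass.hasSum.tendsto_sum_nat.congr' ?_
    filter_upwards [eventually_ge_atTop 1] with N hN
    rw [Finset.sum_range_eq_add_Ico _ (by omega)]
    simp
  have h3 := (hlim.comp (tendsto_cutoff hx)).eventually (Metric.closedBall_mem_nhds _
    (by positivity : 0 < η / 3))
  filter_upwards [eventually_mem_Ioc, h3,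
    eventually_mul_rpow_le (mul_pos hγ (sub_pos.2 hx1)) (C * (|K| + 1)) (by positivity : 0 < η / 3),
    eventually_mul_rpow_le (mul_pos hx hγ) (C * (|K| + 1)) (by positivity : 0 < η / 3)]
    with ε ⟨h0, h1⟩ h4 h5 h6 ρ₀ n h
  have h7 := hmain K x hx ε h0 h1 ρ₀ n h
  rw [Real.dist_eq] at h4
  simp only [Function.comp_apply] at h4
  have h8 : ∑ l ∈ Finset.Ico 1 (cutoff x ε), (l : ℝ) * (n l - P.ω P.zs l)
      = ∑ l ∈ Finset.Ico 1 (cutoff x ε), (l : ℝ) * n l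
        - ∑ l ∈ Finset.Ico 1 (cutoff x ε), (l : ℝ) * P.ω P.zs l := by
    rw [← Finset.sum_sub_distrib]
    exact Finset.sum_congr rfl fun l _ => mul_sub _ _ _
  rw [h8, mul_add] at h7
  rw [abs_le] at h4 h7 ⊢
  constructor <;> linarith

/-- The test function is `1` below the cut-off; the sizes above it that meet its support carry mass
at most `M`. -/
lemma IsState.abs_integral_trap_sub_mic_mass_le {n : ℕ → ℝ} (h : P.IsState ρ₀ K ε n) (hρ : 0 < ρ₀)
    (h0 : 0 < ε) (h1 : ε ≤ 1) {x δ M : ℝ} (hx : 0 < x) (hδ : 0 < δ) (hcut : ε * cutoff x ε ≤ δ)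
    (hM : ∀ S : Finset ℕ, (∀ l ∈ S, (cutoff x ε : ℝ) / 3 ≤ l) → (∀ l ∈ S, ε * l ≤ 2 * δ) →
      ∑ l ∈ S, (l : ℝ) * n l ≤ M) :
    |ρ₀ * ∫ y, trap δ (2 * δ) y ∂(massMeasure ρ₀ ε n)
      - ∑ l ∈ Finset.Ico 1 (cutoff x ε), (l : ℝ) * n l| ≤ M := by
  have hab : δ < 2 * δ := by linarith
  have hc1 := one_le_cutoff hx h0 h1
  obtain ⟨N₀, hN₀⟩ := exists_nat_ge (2 * δ / ε)
  rw [div_le_iff₀' h0] at hN₀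
  have hN : 2 * δ ≤ ε * ((max N₀ (cutoff x ε) : ℕ) : ℝ) := by
    refine hN₀.trans ?_
    gcongr
    exact le_max_left _ _
  rw [h.integral_trap_eq_sum hρ h0 hab hN,
    ← Finset.sum_Ico_consecutive _ hc1 (le_max_right N₀ (cutoff x ε))]
  have e1 : ∑ l ∈ Finset.Ico 1 (cutoff x ε), massTest ε (trap δ (2 * δ)) l * n l
      = ∑ l ∈ Finset.Ico 1 (cutoff x ε), (l : ℝ) * n l := by
    refine Finset.sum_congr rfl fun l hl => ?_
    have h2 : (l : ℝ) ≤ cutoff x ε := by exact_mod_cast (Finset.mem_Ico.1 hl).2.le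
    unfold massTest
    rw [trap_of_le hab (le_trans (by gcongr) hcut), mul_one]
  rw [e1, add_sub_cancel_left]
  set S := (Finset.Ico (cutoff x ε) (max N₀ (cutoff x ε))).filter fun l : ℕ => ε * (l : ℝ) ≤ 2 * δ
  have hS := hM S (fun l hl => third_le_of_mem_macSizes
      (Finset.mem_Ico.1 (Finset.mem_filter.1 hl).1).1) fun l hl => (Finset.mem_filter.1 hl).2
  have hnn : ∀ l : ℕ, 0 ≤ massTest ε (trap δ (2 * δ)) l * n l := fun l => by
    have := mul_nonneg (h.mass_term_nonneg l) (trap_nonneg δ (2 * δ) (ε * l))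
    unfold massTest
    linarith
  rw [abs_of_nonneg (Finset.sum_nonneg fun l _ => hnn l)]
  refine le_trans ?_ hS
  rw [Finset.sum_filter]
  refine Finset.sum_le_sum fun l _ => ?_
  have h3 := h.mass_term_nonneg l
  split_ifs with hl
  · have := mul_le_mul_of_nonneg_left (trap_le_one δ (2 * δ) (ε * l)) h3
    unfold massTest
    linarith
  · unfold massTest
    rw [trap_of_ge hab (not_le.1 hl).le]
    simp

/-- The difference of the two test functions is at most `1` and vanishes outside the window `[δ,
2R]`. This supplies the macroscopic mass needed to control `n_1 - z_s`. -/
lemma IsState.exists_sum_mass_ge {n : ℕ → ℝ} (h : P.IsState ρ₀ K ε n) (hρ : 0 < ρ₀)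
    (h0 : 0 < ε) {δ R : ℝ} (hδ : 0 < δ) (hδR : δ ≤ R) :
    ∃ S : Finset ℕ, (∀ l ∈ S, δ ≤ ε * l ∧ ε * l ≤ 2 * R) ∧
      ρ₀ * (∫ y, trap R (2 * R) y ∂(massMeasure ρ₀ ε n)
        - ∫ y, trap δ (2 * δ) y ∂(massMeasure ρ₀ ε n)) ≤ ∑ l ∈ S, (l : ℝ) * n l := by
  obtain ⟨N, hN⟩ := exists_nat_ge (2 * R / ε)
  rw [div_le_iff₀' h0] at hN
  refine ⟨(Finset.Ico 1 N).filter fun l => δ ≤ ε * (l : ℝ) ∧ ε * l ≤ 2 * R,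
    fun l hl => (Finset.mem_filter.1 hl).2, ?_⟩
  have hδ' : δ < 2 * δ := by linarith
  have hR' : R < 2 * R := by linarith
  rw [mul_sub, h.integral_trap_eq_sum hρ h0 hR' hN,
    h.integral_trap_eq_sum hρ h0 hδ' (le_trans (by linarith) hN), ← Finset.sum_sub_distrib,
    Finset.sum_filter]
  refine Finset.sum_le_sum fun l _ => ?_
  have h3 := h.mass_term_nonneg l
  have e : massTest ε (trap R (2 * R)) l * n l - massTest ε (trap δ (2 * δ)) l * n l
      = (l : ℝ) * n l * (trap R (2 * R) (ε * l) - trap δ (2 * δ) (ε * l)) := by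
    unfold massTest
    ring
  rw [e]
  split_ifs with hl
  · refine mul_le_of_le_one_right h3 ?_
    have := trap_le_one R (2 * R) (ε * l)
    have := trap_nonneg δ (2 * δ) (ε * l)
    linarith
  · rw [not_and_or, not_le, not_le] at hl
    rcases hl with hl | hl
    · rw [trap_of_le hδ' hl.le, trap_of_le hR' (by linarith)]
      simp
    · rw [trap_of_ge hδ' (by linarith), trap_of_ge hR' hl.le]
      simp

/-- Sequences of rescaled curves with bounded action and dissipation, and uniformly integrable
initial mass. -/
structure IsBoundedSeq (P : Rates) (ρ₀ K T A x : ℝ) (e : ℕ → ℝ) (n φ : ℕ → ℝ → ℕ → ℝ) : Prop where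
  pos : ∀ j, 0 < e j
  le_one : ∀ j, e j ≤ 1
  tendsto : Tendsto e atTop (𝓝 0)
  curve : ∀ j, P.IsRescaledCurve ρ₀ K T (e j) (n j) (φ j)
  action_le : ∀ j, (∫⁻ t in Set.Icc 0 T, P.actionResc (e j) (n j t) (φ j t)).toReal ≤ A
  dissipation_le : ∀ j,
    (∫⁻ t in Set.Icc 0 T, P.dissipationResc (e j) (Set.Ici 1) (n j t)).toReal ≤ A
  monomer_le : ∀ j, ∀ t ∈ Set.Icc 0 T, n j t 1 ≤ 2 * P.zs
  tail : ∀ δ : ℝ, 0 < δ → ∃ R₀ : ℝ, ∀ R, R₀ ≤ R → ∀ j,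
    ∫⁻ y in Set.Ioi R, ENNReal.ofReal y ∂(macMeasure x (e j) (n j 0)) ≤ ENNReal.ofReal δ

variable {A x : ℝ} {e : ℕ → ℝ} {n φ : ℕ → ℝ → ℕ → ℝ}

lemma IsBoundedSeq.comp (h : P.IsBoundedSeq ρ₀ K T A x e n φ) {σ : ℕ → ℕ} (hσ : StrictMono σ) :
    P.IsBoundedSeq ρ₀ K T A x (fun j => e (σ j)) (fun j => n (σ j)) (fun j => φ (σ j)) where
  pos j := h.pos _
  le_one j := h.le_one _
  tendsto := h.tendsto.comp hσ.tendsto_atTop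
  curve j := h.curve _
  action_le j := h.action_le _
  dissipation_le j := h.dissipation_le _
  monomer_le j := h.monomer_le _
  tail δ hδ := by
    obtain ⟨R₀, hR₀⟩ := h.tail δ hδ
    exact ⟨R₀, fun R hR j => hR₀ R hR _⟩

lemma IsBoundedSeq.tendsto_nhdsGT (h : P.IsBoundedSeq ρ₀ K T A x e n φ) :
    Tendsto e atTop (𝓝[>] 0) :=
  tendsto_nhdsWithin_iff.2 ⟨h.tendsto, Eventually.of_forall h.pos⟩

/-- The mass distributions are tight, uniformly in time. -/
lemma IsBoundedSeq.exists_tail (h : P.IsBoundedSeq ρ₀ K T A x e n φ) (hT : 0 < T) (hρ : 0 < ρ₀)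
    (hx : 0 < x) (hx1 : x < 1) (R₁ : ℝ) {η : ℝ} (hη : 0 < η) :
    ∃ R : ℝ, 1 ≤ R ∧ R₁ ≤ R ∧ ∀ j, ∀ t ∈ Set.Icc 0 T,
      1 - ∫ y, trap R (2 * R) y ∂(massMeasure ρ₀ (e j) (n j t)) ≤ η := by
  have hz := P.zs_pos
  have hq := P.q_pos
  have hα := P.α_nonneg
  have hα1 := P.α_lt_one
  have hT0 : (0 : ℝ) ∈ Set.Icc 0 T := ⟨le_rfl, hT.le⟩
  have hA : 0 ≤ A := ENNReal.toReal_nonneg.trans (h.action_le 0)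
  obtain ⟨R₀, hR₀⟩ := h.tail (ρ₀ * (η / 2)) (by positivity)
  -- With `θ = R^p` the mobility part `θ R^{-(1-α)}` and the action part `1/θ` both decay like
  -- `R^{-p}`; positivity of `p` uses `α < 1`.
  set p := (1 - P.α) / 2 with hp
  have hp0 : 0 < p := by rw [hp]; linarith
  set C := 27 * (2 * P.zs + P.q) * T + 1 / (ρ₀ * P.zs) * A with hC
  have hlim : Tendsto (fun R : ℝ => C * R ^ (-p)) atTop (𝓝 0) := by
    simpa using (tendsto_rpow_neg_atTop hp0).const_mul C
  obtain ⟨R, hR1, hR2, hR3, hR4⟩ := ((eventually_ge_atTop (1 : ℝ)).and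
    ((eventually_ge_atTop R₀).and ((eventually_ge_atTop R₁).and
      (hlim.eventually (ge_mem_nhds (by positivity : 0 < η / 2)))))).exists
  refine ⟨R, hR1, hR3, fun j t ht => ?_⟩
  have hRpos : 0 < R := by linarith
  have h0 := h.pos j
  have h2 := ((h.curve j).state 0 hT0).one_sub_integral_trap_le hρ h0 (h.le_one j) hx hx1
    (by positivity) hR1 (hR₀ R hR2 j)
  rw [mul_div_assoc, ← mul_div_assoc, mul_div_cancel_left₀ _ hρ.ne'] at h2
  have h3 := (h.curve j).abs_integral_trap_sub_le hT h0 hρ (h.monomer_le j)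
    (by linarith : R < 2 * R) (G := 9 * R ^ (-(1 - P.α))) (θ := R ^ p) (by positivity)
    (fun l _ => nabla_massTest_trap_tail_sq_le hRpos h0 (by linarith) l) (by positivity)
    (h.action_le j) hT0 ht
  have h4 : 3 * (2 * P.zs + P.q) * (9 * R ^ (-(1 - P.α))) * R ^ p * |t - 0|
      + 1 / (ρ₀ * P.zs * R ^ p) * A ≤ C * R ^ (-p) := by
    have e1 : R ^ (-(1 - P.α)) * R ^ p = R ^ (-p) := by
      rw [← Real.rpow_add hRpos]
      congr 1
      rw [hp]
      ring
    have e2 : R ^ (-p) = 1 / R ^ p := by rw [Real.rpow_neg hRpos.le, one_div]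
    have ht' : |t - 0| ≤ T := by
      rw [sub_zero, abs_of_nonneg ht.1]
      exact ht.2
    calc _ = 27 * (2 * P.zs + P.q) * (R ^ (-(1 - P.α)) * R ^ p) * |t - 0|
          + 1 / (ρ₀ * P.zs) * A * (1 / R ^ p) := by
          field_simp
          ring
      _ ≤ 27 * (2 * P.zs + P.q) * R ^ (-p) * T + 1 / (ρ₀ * P.zs) * A * R ^ (-p) := by
          rw [e1, ← e2]
          gcongr
      _ = _ := by rw [hC]; ring
  have h5 := (abs_le.1 (h3.trans (h4.trans hR4))).1
  linarith

/-- Compactness of the mass distributions at all times. -/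
lemma IsBoundedSeq.exists_subseq_tendsto (h : P.IsBoundedSeq ρ₀ K T A x e n φ) (hT : 0 < T)
    (hρ : 0 < ρ₀) (hx : 0 < x) (hx1 : x < 1) :
    ∃ (σ : ℕ → ℕ) (μ : ℝ → ProbabilityMeasure ℝ), StrictMono σ ∧ ∀ t ∈ Set.Icc 0 T,
      ∀ f : ℝ → ℝ, Continuous f → ∀ C : ℝ, (∀ y, |f y| ≤ C) →
        Tendsto (fun j => ∫ y, f y ∂(massMeasure ρ₀ (e (σ j)) (n (σ j) t))) atTop
          (𝓝 (∫ y, f y ∂(μ t : Measure ℝ))) := by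
  have hz := P.zs_pos
  have hq := P.q_pos
  have hα := P.α_nonneg
  have hα1 := P.α_lt_one
  have hprob : ∀ j, ∀ t ∈ Set.Icc 0 T, IsProbabilityMeasure (massMeasure ρ₀ (e j) (n j t)) :=
    fun j t ht => ((h.curve j).state t ht).isProbabilityMeasure_massMeasure hρ
  have hex : ∀ j t, ∃ p : ProbabilityMeasure ℝ, t ∈ Set.Icc 0 T →
      (p : Measure ℝ) = massMeasure ρ₀ (e j) (n j t) := by
    intro j t
    by_cases ht : t ∈ Set.Icc 0 T
    · exact ⟨⟨_, hprob j t ht⟩, fun _ => rfl⟩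
    · exact ⟨⟨Measure.dirac 0, inferInstance⟩, fun h => absurd h ht⟩
  choose p hpe using hex
  have hA : 0 ≤ A := ENNReal.toReal_nonneg.trans (h.action_le 0)
  obtain ⟨σ, μ, hσ, hμ⟩ := exists_subseq_tendsto_probabilityMeasure hT p (fun η hη => by
    obtain ⟨R, hR1, -, hR⟩ := h.exists_tail hT hρ hx hx1 0 hη
    refine ⟨2 * R, fun j t ht => ?_⟩
    rw [hpe j t ht]
    have := hprob j t ht
    exact massMeasure_compl_Icc_le (h.pos j) (by linarith) (hR j t ht)) (fun a b hab η hη => by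
    set G := 4 / (b - a) ^ 2 + (|b| / (b - a) + 1) ^ 2 with hG
    have hG0 : 0 ≤ G := by positivity
    -- This `θ` brings the action part below `η/2` irrespective of the time step; the step is then
    -- chosen small. The summands `1` in `A + 1` and `G + 1` only ensure positivity.
    set θ := 2 / (η * ρ₀ * P.zs) * (A + 1) with hθ
    have hθ0 : 0 < θ := by positivity
    have hc : 0 < 3 * (2 * P.zs + P.q) * (G + 1) * θ := by positivity
    refine ⟨η / 2 / (3 * (2 * P.zs + P.q) * (G + 1) * θ), by positivity, fun j s hs t ht hst => ?_⟩
    rw [hpe j t ht, hpe j s hs]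
    refine ((h.curve j).abs_integral_trap_sub_le hT (h.pos j) hρ (h.monomer_le j) hab hG0
      (fun l _ => nabla_massTest_trap_sq_le hab (h.pos j) (by linarith) (by linarith) l)
      hθ0 (h.action_le j) hs ht).trans ?_
    have h1 : 3 * (2 * P.zs + P.q) * G * θ * |t - s| ≤ η / 2 := by
      rw [le_div_iff₀ hc] at hst
      have : 0 ≤ 3 * (2 * P.zs + P.q) * θ * |t - s| := by positivity
      nlinarith
    have h2 : 1 / (ρ₀ * P.zs * θ) * A ≤ η / 2 := by
      have e1 : ρ₀ * P.zs * θ = 2 * (A + 1) / η := by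
        rw [hθ]
        field_simp
      rw [e1, one_div_div, div_mul_eq_mul_div, div_le_div_iff₀ (by positivity) (by norm_num)]
      nlinarith
    linarith)
  refine ⟨σ, μ, hσ, fun t ht f hf C hC => ?_⟩
  have h1 := ProbabilityMeasure.tendsto_iff_forall_integral_tendsto.1 (hμ t ht)
    (BoundedContinuousFunction.ofNormedAddCommGroup f hf C hC)
  refine (h1.congr fun j => ?_)
  rw [hpe _ t ht]
  rfl

end Rates

/-! ### Identification of the macroscopic limit -/

/-- The macroscopic measure with mass distribution `ϱ₀ μ` on `(0,∞)`. -/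
def macLimit (ρ₀ : ℝ) (μ : Measure ℝ) : Measure ℝ :=
  ENNReal.ofReal ρ₀ • (μ.restrict (Set.Ioi 0)).withDensity fun y => ENNReal.ofReal y⁻¹

lemma measurable_ofReal_inv : Measurable fun y : ℝ => ENNReal.ofReal y⁻¹ :=
  measurable_inv.ennreal_ofReal

lemma lintegral_macLimit (ρ₀ : ℝ) (μ : Measure ℝ) {f : ℝ → ℝ≥0∞} (hf : Measurable f) :
    ∫⁻ y, f y ∂(macLimit ρ₀ μ)
      = ENNReal.ofReal ρ₀ * ∫⁻ y in Set.Ioi 0, ENNReal.ofReal y⁻¹ * f y ∂μ := by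
  unfold macLimit
  rw [lintegral_smul_measure, smul_eq_mul,
    lintegral_withDensity_eq_lintegral_mul _ measurable_ofReal_inv hf]
  rfl

lemma macLimit_Iic (ρ₀ : ℝ) (μ : Measure ℝ) : macLimit ρ₀ μ (Set.Iic 0) = 0 := by
  have h : (μ.restrict (Set.Ioi 0)).withDensity (fun y => ENNReal.ofReal y⁻¹) (Set.Iic 0) = 0 := by
    refine withDensity_absolutelyContinuous _ _ ?_
    rw [Measure.restrict_apply measurableSet_Iic, Set.Iic_inter_Ioi, Set.Ioc_self, measure_empty]
  unfold macLimit
  rw [Measure.smul_apply, h, smul_zero]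

lemma lintegral_ofReal_macLimit (ρ₀ : ℝ) (μ : Measure ℝ) :
    ∫⁻ y, ENNReal.ofReal y ∂(macLimit ρ₀ μ) = ENNReal.ofReal ρ₀ * μ (Set.Ioi 0) := by
  rw [lintegral_macLimit _ _ ENNReal.measurable_ofReal, ← setLIntegral_one]
  congr 1
  refine setLIntegral_congr_fun measurableSet_Ioi fun y hy => ?_
  have hy0 : (0 : ℝ) < y := hy
  rw [← ENNReal.ofReal_mul (by positivity), inv_mul_cancel₀ hy0.ne', ENNReal.ofReal_one]

lemma integral_macLimit {ρ₀ : ℝ} (hρ : 0 ≤ ρ₀) (μ : Measure ℝ) {ζ : ℝ → ℝ}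
    (hζ : ∀ y, y ≤ 0 → ζ y = 0) :
    ∫ y, ζ y ∂(macLimit ρ₀ μ) = ρ₀ * ∫ y, ζ y / y ∂μ := by
  unfold macLimit
  rw [integral_smul_measure, ENNReal.toReal_ofReal hρ, smul_eq_mul,
    integral_withDensity_eq_integral_toReal_smul measurable_ofReal_inv
      (Eventually.of_forall fun y => ENNReal.ofReal_lt_top)]
  congr 1
  rw [← setIntegral_eq_integral_of_forall_compl_eq_zero (s := Set.Ioi 0) (μ := μ)
    (f := fun y => ζ y / y)]
  · refine setIntegral_congr_fun measurableSet_Ioi fun y hy => ?_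
    have hy0 : (0 : ℝ) < y := hy
    rw [ENNReal.toReal_ofReal (by positivity), smul_eq_mul]
    ring
  · intro y hy
    rw [hζ y (not_lt.1 hy), zero_div]

lemma Rates.macEnergy_macLimit (P : Rates) {ρ₀ : ℝ} (μ : Measure ℝ) :
    P.macEnergy (macLimit ρ₀ μ) = ENNReal.ofReal (P.q / (1 - P.γ)) * (ENNReal.ofReal ρ₀ *
      ∫⁻ y in Set.Ioi 0, ENNReal.ofReal (y ^ (-P.γ)) ∂μ) := by
  have hm : Measurable fun y : ℝ => ENNReal.ofReal (y ^ (1 - P.γ)) :=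
    (measurable_id.pow_const _).ennreal_ofReal
  unfold Rates.macEnergy
  rw [← lintegral_indicator measurableSet_Ioi,
    lintegral_macLimit _ _ (hm.indicator measurableSet_Ioi)]
  congr 2
  refine setLIntegral_congr_fun measurableSet_Ioi fun y hy => ?_
  have hy0 : (0 : ℝ) < y := hy
  rw [Set.indicator_of_mem hy, ← ENNReal.ofReal_mul (by positivity), sub_eq_add_neg,
    Real.rpow_add hy0, Real.rpow_one, inv_mul_cancel_left₀ hy0.ne']

lemma tendsto_trap_zero (y : ℝ) :
    Tendsto (fun δ => trap δ (2 * δ) y) (𝓝[>] 0) (𝓝 ((Set.Iic 0).indicator (fun _ => 1) y)) := by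
  by_cases hy : y ≤ 0
  · rw [Set.indicator_of_mem (Set.mem_Iic.2 hy)]
    refine tendsto_const_nhds.congr' ?_
    filter_upwards [self_mem_nhdsWithin] with δ hδ
    have hδ0 : (0 : ℝ) < δ := hδ
    exact (trap_of_le (by linarith) (by linarith)).symm
  · rw [Set.indicator_of_notMem (by simpa using hy)]
    push Not at hy
    refine tendsto_const_nhds.congr' ?_
    filter_upwards [Ioo_mem_nhdsGT (by linarith : 0 < y / 2)] with δ hδ
    exact (trap_of_ge (by linarith [hδ.1]) (by linarith [hδ.2])).symm

lemma tendsto_integral_trap_zero (μ : Measure ℝ) [IsFiniteMeasure μ] :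
    Tendsto (fun δ => ∫ y, trap δ (2 * δ) y ∂μ) (𝓝[>] 0) (𝓝 (μ.real (Set.Iic 0))) := by
  have e : μ.real (Set.Iic 0) = ∫ y, (Set.Iic 0).indicator (fun _ => (1 : ℝ)) y ∂μ := by
    rw [integral_indicator measurableSet_Iic]
    simp
  rw [e]
  exact tendsto_integral_filter_of_dominated_convergence (fun _ => 1)
    (Eventually.of_forall fun m => (continuous_trap _ _).aestronglyMeasurable)
    (Eventually.of_forall fun m => Eventually.of_forall fun y => abs_trap_le _ _ y)
    (integrable_const 1) (Eventually.of_forall fun y => tendsto_trap_zero y)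

namespace Rates

variable {P : Rates} {ρ₀ K x : ℝ} {e : ℕ → ℝ} {m : ℕ → ℕ → ℝ} {μ : Measure ℝ}

variable (P) in
/-- Test functions at scale `δ` see the critical mass up to an error of order `δ^γ`. -/
lemma exists_abs_integral_trap_sub_le (K : ℝ) (hx : 0 < x) (hx1 : x < 1) :
    ∃ C : ℝ, 0 < C ∧ ∀ δ, 0 < δ → ∀ η, 0 < η → ∀ᶠ ε : ℝ in 𝓝[>] 0, ∀ ρ₀, 0 < ρ₀ →
      ∀ n, P.IsState ρ₀ K ε n →
      |ρ₀ * ∫ y, trap δ (2 * δ) y ∂(massMeasure ρ₀ ε n) - P.criticalMass| ≤ C * δ ^ P.γ + η := by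
  have hγ := P.γ_pos
  obtain ⟨C, hC, hmain⟩ := P.exists_sum_mass_le K hx
  refine ⟨C * 2 ^ P.γ, by positivity, fun δ hδ η hη => ?_⟩
  filter_upwards [eventually_mem_Ioc, eventually_mul_cutoff_le hx1 hδ,
    P.eventually_abs_sum_mic_mass_sub_le K hx hx1 hη] with ε ⟨h0, h1⟩ hcut hmic ρ₀ hρ n h
  have h2 := h.abs_integral_trap_sub_mic_mass_le hρ h0 h1 hx hδ hcut
    (fun S hS hSR => hmain ε h0 h1 ρ₀ n h (2 * δ) (by linarith) S hS hSR)
  have h3 := hmic ρ₀ n h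
  rw [Real.mul_rpow (by norm_num) hδ.le, ← mul_assoc] at h2
  rw [abs_le] at h2 h3 ⊢
  constructor <;> linarith

/-- The mass which is lost in the macroscopic limit is the critical mass. -/
lemma mul_measureReal_Iic_eq (hx : 0 < x) (hx1 : x < 1) (hρ : 0 < ρ₀) [IsFiniteMeasure μ]
    (he : Tendsto e atTop (𝓝[>] 0)) (hm : ∀ j, P.IsState ρ₀ K (e j) (m j))
    (hconv : ∀ f : ℝ → ℝ, Continuous f → ∀ C : ℝ, (∀ y, |f y| ≤ C) →
      Tendsto (fun j => ∫ y, f y ∂(massMeasure ρ₀ (e j) (m j))) atTop (𝓝 (∫ y, f y ∂μ))) :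
    ρ₀ * μ.real (Set.Iic 0) = P.criticalMass := by
  obtain ⟨C, hC, hmain⟩ := P.exists_abs_integral_trap_sub_le K hx hx1
  -- The limit in `j` is taken at fixed `δ`, with admissible error `η = δ`; only then does `δ` tend
  -- to `0`.
  have h1 : ∀ᶠ δ : ℝ in 𝓝[>] 0, |ρ₀ * ∫ y, trap δ (2 * δ) y ∂μ - P.criticalMass|
      ≤ C * δ ^ P.γ + δ := by
    filter_upwards [self_mem_nhdsWithin] with δ hδ
    have h2 := ((hconv _ (continuous_trap δ (2 * δ)) 1 (abs_trap_le _ _)).const_mul ρ₀).sub_const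
      P.criticalMass
    refine le_of_tendsto h2.abs ?_
    filter_upwards [he.eventually (hmain δ hδ δ hδ)] with j hj
    exact hj ρ₀ hρ _ (hm j)
  have h2 := (((tendsto_integral_trap_zero μ).const_mul ρ₀).sub_const P.criticalMass).abs
  have h3 : Tendsto (fun δ : ℝ => C * δ ^ P.γ + δ) (𝓝[>] 0) (𝓝 (0 + 0)) :=
    (tendsto_rpow_nhdsWithin_zero P.γ_pos C).add (tendsto_id.mono_left nhdsWithin_le_nhds)
  have h4 := le_of_tendsto_of_tendsto h2 h3 h1
  rw [add_zero] at h4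
  exact sub_eq_zero.1 (abs_eq_zero.1 (le_antisymm h4 (abs_nonneg _)))

lemma isMacroState_macLimit [IsProbabilityMeasure μ] (hρ : 0 < ρ₀)
    (h : ρ₀ * μ.real (Set.Iic 0) = P.criticalMass) :
    IsMacroState (ρ₀ - P.criticalMass) (macLimit ρ₀ μ) := by
  refine ⟨macLimit_Iic ρ₀ μ, ?_⟩
  have e : μ.real (Set.Ioi 0) = 1 - μ.real (Set.Iic 0) := by
    rw [← Set.compl_Iic, measureReal_compl measurableSet_Iic, probReal_univ]
  rw [lintegral_ofReal_macLimit, ← ofReal_measureReal, ← ENNReal.ofReal_mul hρ.le, e, mul_sub,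
    mul_one, h]

/-- A test function supported away from `0` and divided by `y` is bounded and continuous, hence
admissible for the mass distributions. The rescaled cut-off eventually lies below its support. -/
lemma weakStarTendsto_macLimit (hx1 : x < 1) (hρ : 0 < ρ₀)
    (he : Tendsto e atTop (𝓝[>] 0)) (hm : ∀ j, P.IsState ρ₀ K (e j) (m j))
    (hconv : ∀ f : ℝ → ℝ, Continuous f → ∀ C : ℝ, (∀ y, |f y| ≤ C) →
      Tendsto (fun j => ∫ y, f y ∂(massMeasure ρ₀ (e j) (m j))) atTop (𝓝 (∫ y, f y ∂μ))) :
    WeakStarTendsto (fun j => macMeasure x (e j) (m j)) (macLimit ρ₀ μ) := by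
  intro ζ hζ hζc hζs
  obtain ⟨C, hC⟩ := hζc.exists_bound_of_continuous hζ
  obtain ⟨c, hc, hcs⟩ : ∃ c : ℝ, 0 < c ∧ ∀ y, y ≤ c → ζ y = 0 := by
    rcases (tsupport ζ).eq_empty_or_nonempty with hemp | hne
    · refine ⟨1, one_pos, fun y _ => image_eq_zero_of_notMem_tsupport ?_⟩
      rw [hemp]
      exact Set.notMem_empty y
    · obtain ⟨c, hcm, hcl⟩ := IsCompact.exists_isLeast hζc hne
      have hc0 : 0 < c := hζs hcm
      refine ⟨c / 2, by positivity, fun y hy => image_eq_zero_of_notMem_tsupport fun hym => ?_⟩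
      have := hcl hym
      linarith
  have hcont : Continuous fun y => ζ y / y := by
    rw [continuous_iff_continuousAt]
    intro y
    rcases lt_or_ge y c with hy | hy
    · have h1 : (fun _ : ℝ => (0 : ℝ)) =ᶠ[𝓝 y] fun y => ζ y / y := by
        filter_upwards [Iio_mem_nhds hy] with w hw
        rw [hcs w (le_of_lt hw), zero_div]
      exact continuousAt_const.congr h1
    · exact hζ.continuousAt.div continuousAt_id (hc.trans_le hy).ne'
  have hbd : ∀ y, |ζ y / y| ≤ C / c := by
    intro y
    have hC0 : 0 ≤ C := (norm_nonneg _).trans (hC 0)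
    rcases le_or_gt y c with hy | hy
    · rw [hcs y hy, zero_div, abs_zero]
      positivity
    · rw [abs_div, abs_of_pos (hc.trans hy)]
      exact div_le_div₀ hC0 (hC y) hc hy.le
  rw [integral_macLimit hρ.le μ fun y hy => hcs y (hy.trans hc.le)]
  refine ((hconv _ hcont _ hbd).const_mul ρ₀).congr' ?_
  filter_upwards [he.eventually self_mem_nhdsWithin, he.eventually (eventually_mul_cutoff_le hx1 hc)]
    with j hj hcut
  exact ((hm j).integral_macMeasure_eq hρ hj hc hC hcs hcut).symm

end Rates

/-! ### Truncated macroscopic energies and the energy of small clusters -/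

/-- A bounded continuous truncation of `y ↦ y^{-γ}` on `(0,∞)` at scale `δ`. -/
def energyCut (γ δ y : ℝ) : ℝ := (1 - trap δ (2 * δ) y) * max y δ ^ (-γ)

lemma energyCut_nonneg {γ δ : ℝ} (hδ : 0 < δ) (y : ℝ) : 0 ≤ energyCut γ δ y := by
  have := lt_max_of_lt_right (b := y) hδ
  exact mul_nonneg (sub_nonneg.2 (trap_le_one _ _ _)) (by positivity)

lemma abs_energyCut_le {γ δ : ℝ} (hγ : 0 < γ) (hδ : 0 < δ) (y : ℝ) :
    |energyCut γ δ y| ≤ δ ^ (-γ) := by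
  rw [abs_of_nonneg (energyCut_nonneg hδ y)]
  have h1 : max y δ ^ (-γ) ≤ δ ^ (-γ) :=
    Real.rpow_le_rpow_of_nonpos hδ (le_max_right _ _) (by linarith)
  have h2 : 0 ≤ max y δ ^ (-γ) := by
    have := lt_max_of_lt_right (b := y) hδ
    positivity
  have h3 : 1 - trap δ (2 * δ) y ≤ 1 := by linarith [trap_nonneg δ (2 * δ) y]
  exact (mul_le_of_le_one_left h2 h3).trans h1

lemma continuous_energyCut {γ δ : ℝ} (hδ : 0 < δ) : Continuous (energyCut γ δ) := by
  unfold energyCut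
  refine (continuous_const.sub (continuous_trap _ _)).mul ?_
  exact (continuous_id.max continuous_const).rpow_const fun y =>
    Or.inl (lt_max_of_lt_right hδ).ne'

lemma energyCut_of_le {γ δ y : ℝ} (hδ : 0 < δ) (hy : y ≤ δ) : energyCut γ δ y = 0 := by
  unfold energyCut
  rw [trap_of_le (by linarith) hy, sub_self, zero_mul]

lemma energyCut_of_ge {γ δ y : ℝ} (hy : δ ≤ y) :
    energyCut γ δ y = (1 - trap δ (2 * δ) y) * y ^ (-γ) := by
  unfold energyCut
  rw [max_eq_left hy]

lemma trap_mono_scale {δ δ' y : ℝ} (hδ : 0 < δ) (hδδ' : δ ≤ δ') :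
    trap δ (2 * δ) y ≤ trap δ' (2 * δ') y := by
  have hδ' : 0 < δ' := hδ.trans_le hδδ'
  rcases le_or_gt y 0 with hy | hy
  · rw [trap_of_le (by linarith) (by linarith), trap_of_le (by linarith) (by linarith)]
  · unfold trap
    have e : ∀ s : ℝ, 0 < s → (2 * s - y) / (2 * s - s) = 2 - y / s := fun s hs => by
      rw [show 2 * s - s = s by ring]
      field_simp
    rw [e δ hδ, e δ' hδ']
    have : y / δ' ≤ y / δ := by gcongr
    exact max_le_max le_rfl (min_le_min le_rfl (by linarith))

lemma energyCut_anti {γ δ δ' : ℝ} (hδ : 0 < δ) (hδδ' : δ ≤ δ') (y : ℝ) :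
    energyCut γ δ' y ≤ energyCut γ δ y := by
  rcases le_or_gt y δ' with hy | hy
  · rw [energyCut_of_le (hδ.trans_le hδδ') hy]
    exact energyCut_nonneg hδ y
  · have hy0 : 0 < y := hδ.trans_le (hδδ'.trans hy.le)
    rw [energyCut_of_ge hy.le, energyCut_of_ge (hδδ'.trans hy.le)]
    have := trap_mono_scale (y := y) hδ hδδ'
    have h2 : 0 ≤ y ^ (-γ) := by positivity
    nlinarith

/-- Monotone convergence, as the truncations increase when the scale shrinks. The limit may be
infinite. -/
lemma tendsto_lintegral_energyCut (γ : ℝ) (μ : Measure ℝ) {d : ℕ → ℝ} (hd0 : ∀ k, 0 < d k)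
    (hda : Antitone d) (hdl : Tendsto d atTop (𝓝 0)) :
    Tendsto (fun k => ∫⁻ y, ENNReal.ofReal (energyCut γ (d k) y) ∂μ) atTop
      (𝓝 (∫⁻ y in Set.Ioi 0, ENNReal.ofReal (y ^ (-γ)) ∂μ)) := by
  rw [← lintegral_indicator measurableSet_Ioi]
  refine lintegral_tendsto_of_tendsto_of_monotone
    (fun k => (continuous_energyCut (hd0 k)).measurable.ennreal_ofReal.aemeasurable)
    (Eventually.of_forall fun y i j hij =>
      ENNReal.ofReal_le_ofReal (energyCut_anti (hd0 j) (hda hij) y))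
    (Eventually.of_forall fun y => ?_)
  rcases le_or_gt y 0 with hy | hy
  · rw [Set.indicator_of_notMem (by simpa using hy)]
    refine tendsto_const_nhds.congr fun k => ?_
    rw [energyCut_of_le (hd0 k) (hy.trans (hd0 k).le), ENNReal.ofReal_zero]
  · rw [Set.indicator_of_mem (Set.mem_Ioi.2 hy)]
    refine tendsto_const_nhds.congr' ?_
    filter_upwards [hdl.eventually (gt_mem_nhds (by linarith : 0 < y / 2))] with k hk
    have := hd0 k
    rw [energyCut_of_ge (by linarith), trap_of_ge (by linarith) (by linarith), sub_zero, one_mul]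

namespace Rates

variable (P : Rates)

/-- The macroscopic energy, truncated at scale `δ`, in terms of the mass distribution. -/
def energyAt (ρ₀ δ : ℝ) (μ : Measure ℝ) : ℝ :=
  P.q / (1 - P.γ) * (ρ₀ * ∫ y, energyCut P.γ δ y ∂μ)

lemma energyCoeff_pos : 0 < P.q / (1 - P.γ) := div_pos P.q_pos (by linarith [P.γ_lt_one])

lemma energyAt_nonneg {ρ₀ δ : ℝ} (hρ : 0 < ρ₀) (hδ : 0 < δ) (μ : Measure ℝ) :
    0 ≤ P.energyAt ρ₀ δ μ :=
  mul_nonneg P.energyCoeff_pos.le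
    (mul_nonneg hρ.le (integral_nonneg fun y => energyCut_nonneg hδ y))

lemma integrable_energyCut {δ : ℝ} (hδ : 0 < δ) (μ : Measure ℝ) [IsFiniteMeasure μ] :
    Integrable (energyCut P.γ δ) μ :=
  Integrable.of_bound (continuous_energyCut hδ).aestronglyMeasurable (δ ^ (-P.γ))
    (Eventually.of_forall fun y => abs_energyCut_le P.γ_pos hδ y)

lemma ofReal_energyAt {ρ₀ δ : ℝ} (hρ : 0 < ρ₀) (hδ : 0 < δ) (μ : Measure ℝ) [IsFiniteMeasure μ] :
    ENNReal.ofReal (P.energyAt ρ₀ δ μ) = ENNReal.ofReal (P.q / (1 - P.γ)) *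
      (ENNReal.ofReal ρ₀ * ∫⁻ y, ENNReal.ofReal (energyCut P.γ δ y) ∂μ) := by
  unfold energyAt
  rw [ENNReal.ofReal_mul P.energyCoeff_pos.le, ENNReal.ofReal_mul hρ.le,
    ofReal_integral_eq_lintegral_ofReal (P.integrable_energyCut hδ μ)
      (Eventually.of_forall fun y => energyCut_nonneg hδ y)]

lemma energyAt_le {ρ₀ δ : ℝ} (hρ : 0 < ρ₀) (hδ : 0 < δ) (μ : Measure ℝ) [IsProbabilityMeasure μ] :
    P.energyAt ρ₀ δ μ ≤ P.q / (1 - P.γ) * (ρ₀ * δ ^ (-P.γ)) := by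
  have h : ∫ y, energyCut P.γ δ y ∂μ ≤ δ ^ (-P.γ) := by
    calc ∫ y, energyCut P.γ δ y ∂μ ≤ ∫ _, δ ^ (-P.γ) ∂μ :=
          integral_mono (P.integrable_energyCut hδ μ) (integrable_const _)
            fun y => (le_abs_self _).trans (abs_energyCut_le P.γ_pos hδ y)
      _ = _ := by simp
  have := P.energyCoeff_pos
  unfold energyAt
  gcongr

lemma tendsto_ofReal_energyAt {ρ₀ : ℝ} (hρ : 0 < ρ₀) (μ : Measure ℝ) [IsFiniteMeasure μ]
    {d : ℕ → ℝ} (hd0 : ∀ k, 0 < d k) (hda : Antitone d) (hdl : Tendsto d atTop (𝓝 0)) :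
    Tendsto (fun k => ENNReal.ofReal (P.energyAt ρ₀ (d k) μ)) atTop
      (𝓝 (P.macEnergy (macLimit ρ₀ μ))) := by
  rw [P.macEnergy_macLimit]
  simp only [P.ofReal_energyAt hρ (hd0 _) μ]
  exact ENNReal.Tendsto.const_mul (ENNReal.Tendsto.const_mul
    (tendsto_lintegral_energyCut P.γ μ hd0 hda hdl) (Or.inr ENNReal.ofReal_ne_top))
    (Or.inr ENNReal.ofReal_ne_top)

variable {P} {ρ₀ K ε : ℝ} {n : ℕ → ℝ}

lemma IsState.mul_energyCut_eq {δ : ℝ} (h0 : 0 < ε) (n : ℕ → ℝ) {l : ℕ} (hl : 1 ≤ l)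
    (hlδ : δ ≤ ε * l) :
    P.q / (1 - P.γ) * ((l : ℝ) * n l * energyCut P.γ δ (ε * l))
      = (1 - trap δ (2 * δ) (ε * l)) *
        (P.zs * ε ^ (-P.γ) * (P.decay * (l : ℝ) ^ (1 - P.γ) * n l)) := by
  have hl0 : (0 : ℝ) < l := by exact_mod_cast hl
  have hz := P.zs_pos
  have hγ1 : 1 - P.γ ≠ 0 := by linarith [P.γ_lt_one]
  rw [energyCut_of_ge hlδ, Real.mul_rpow h0.le hl0.le, sub_eq_add_neg 1 P.γ, Real.rpow_add hl0,
    Real.rpow_one, ← sub_eq_add_neg 1 P.γ]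
  unfold decay
  field_simp

/-- Truncation only discards energy, and the truncated integrand vanishes up to `δ`, beyond the
cut-off. -/
lemma IsState.energyAt_le_macEnergy (h : P.IsState ρ₀ K ε n) (hρ : 0 < ρ₀) (h0 : 0 < ε)
    (h1 : ε ≤ 1) {x δ : ℝ} (hx : 0 < x) (hδ : 0 < δ) (hcut : ε * cutoff x ε ≤ δ) :
    ENNReal.ofReal (P.energyAt ρ₀ δ (massMeasure ρ₀ ε n)) ≤ P.macEnergy (macMeasure x ε n) := by
  have hz := P.zs_pos
  have hd := P.decay_pos
  have hc := P.energyCoeff_pos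
  have hs := (h.hasSum_integral_massMeasure hρ (abs_energyCut_le P.γ_pos hδ)).mul_left
    (P.q / (1 - P.γ))
  have hnn : ∀ l : ℕ, 0 ≤ P.q / (1 - P.γ) * ((l : ℝ) * n l * energyCut P.γ δ (ε * l)) := fun l =>
    mul_nonneg hc.le (mul_nonneg (h.mass_term_nonneg l) (energyCut_nonneg hδ _))
  unfold energyAt
  rw [P.macEnergy_macMeasure hx h0 h1, ← hs.tsum_eq, ENNReal.ofReal_tsum_of_nonneg hnn hs.summable,
    tsum_subtype (macSizes x ε) (fun l : ℕ =>
      ENNReal.ofReal (P.zs * ε ^ (-P.γ) * (P.decay * (l : ℝ) ^ (1 - P.γ) * n l)))]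
  refine ENNReal.tsum_le_tsum fun l => ?_
  rcases le_or_gt (ε * l) δ with hl | hl
  · rw [energyCut_of_le hδ hl]
    simp
  · have hlc : cutoff x ε ≤ l := by
      by_contra hlt
      push Not at hlt
      have h3 : (l : ℝ) ≤ cutoff x ε := by exact_mod_cast hlt.le
      have : ε * l ≤ ε * cutoff x ε := by gcongr
      linarith
    have hl1 : 1 ≤ l := (one_le_cutoff hx h0 h1).trans hlc
    have hn := h.nonneg l hl1
    rw [Set.indicator_of_mem (show l ∈ macSizes x ε from hlc), IsState.mul_energyCut_eq h0 n hl1 hl.le]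
    refine ENNReal.ofReal_le_ofReal (mul_le_of_le_one_left (by positivity) ?_)
    linarith [trap_nonneg δ (2 * δ) (ε * l)]

/-- The energy discarded by the truncation sits on `l_0 ≤ l ≤ 2δ/ε`, the range to which `hM`
applies. -/
lemma IsState.macEnergy_le_energyAt_add (h : P.IsState ρ₀ K ε n) (hρ : 0 < ρ₀) (h0 : 0 < ε)
    (h1 : ε ≤ 1) {x δ M : ℝ} (hx : 0 < x) (hδ : 0 < δ)
    (hM : ∀ S : Finset ℕ, (∀ l ∈ S, cutoff x ε ≤ l ∧ ε * l ≤ 2 * δ) →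
      ∑ l ∈ S, (l : ℝ) ^ (1 - P.γ) * n l ≤ M * ε ^ P.γ) :
    P.macEnergy (macMeasure x ε n) ≤ ENNReal.ofReal (P.energyAt ρ₀ δ (massMeasure ρ₀ ε n))
      + ENNReal.ofReal (P.zs * P.decay * M) := by
  have hz := P.zs_pos
  have hd := P.decay_pos
  have hc := P.energyCoeff_pos
  have hδ' : δ < 2 * δ := by linarith
  have hcut1 := one_le_cutoff hx h0 h1
  have hs := (h.hasSum_integral_massMeasure hρ (abs_energyCut_le P.γ_pos hδ)).mul_left
    (P.q / (1 - P.γ))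
  have hnn : ∀ l : ℕ, 0 ≤ P.q / (1 - P.γ) * ((l : ℝ) * n l * energyCut P.γ δ (ε * l)) := fun l =>
    mul_nonneg hc.le (mul_nonneg (h.mass_term_nonneg l) (energyCut_nonneg hδ _))
  set f : ℕ → ℝ := fun l => P.zs * ε ^ (-P.γ) * (P.decay * (l : ℝ) ^ (1 - P.γ) * n l) with hf
  have hf0 : ∀ l, 1 ≤ l → 0 ≤ f l := fun l hl => by
    have := h.nonneg l hl
    rw [hf]
    positivity
  rw [P.macEnergy_macMeasure hx h0 h1]
  calc ∑' l : macSizes x ε, ENNReal.ofReal (f l)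
      ≤ ∑' l : macSizes x ε, (ENNReal.ofReal (P.q / (1 - P.γ) *
          (((l : ℕ) : ℝ) * n l * energyCut P.γ δ (ε * (l : ℕ))))
          + ENNReal.ofReal (trap δ (2 * δ) (ε * (l : ℕ)) * f l)) := by
        refine ENNReal.tsum_le_tsum fun l => ?_
        have hl1 : 1 ≤ (l : ℕ) := hcut1.trans l.2
        have ht := mul_nonneg (trap_nonneg δ (2 * δ) (ε * (l : ℕ))) (hf0 l hl1)
        rw [← ENNReal.ofReal_add (hnn l) ht]
        refine ENNReal.ofReal_le_ofReal ?_
        rcases le_or_gt (ε * (l : ℕ)) δ with hl | hl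
        · rw [trap_of_le hδ' hl, one_mul]
          linarith [hnn l]
        · rw [IsState.mul_energyCut_eq h0 n hl1 hl.le]
          exact le_of_eq (by ring)
    _ ≤ _ := by
        rw [ENNReal.tsum_add]
        refine add_le_add ?_ ?_
        · unfold energyAt
          rw [← hs.tsum_eq, ENNReal.ofReal_tsum_of_nonneg hnn hs.summable]
          exact ENNReal.tsum_comp_le_tsum_of_injective Subtype.val_injective
            (fun l : ℕ => ENNReal.ofReal
              (P.q / (1 - P.γ) * ((l : ℝ) * n l * energyCut P.γ δ (ε * l))))
        · refine tsum_subtype_ofReal_le (f := fun l : ℕ => trap δ (2 * δ) (ε * l) * f l)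
            (fun l hl => mul_nonneg (trap_nonneg _ _ _) (hf0 l (hcut1.trans hl))) fun S hS => ?_
          have h2 := hM (S.filter fun l : ℕ => ε * (l : ℝ) ≤ 2 * δ) fun l hl =>
            ⟨hS l (Finset.mem_filter.1 hl).1, (Finset.mem_filter.1 hl).2⟩
          calc ∑ l ∈ S, trap δ (2 * δ) (ε * l) * f l
              ≤ ∑ l ∈ S, if ε * (l : ℝ) ≤ 2 * δ then f l else 0 := by
                refine Finset.sum_le_sum fun l hl => ?_
                split_ifs with hle
                · exact mul_le_of_le_one_left (hf0 l (hcut1.trans (hS l hl))) (trap_le_one _ _ _)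
                · rw [trap_of_ge hδ' (not_le.1 hle).le, zero_mul]
            _ = P.zs * P.decay * ε ^ (-P.γ) *
                  ∑ l ∈ S.filter (fun l : ℕ => ε * (l : ℝ) ≤ 2 * δ), (l : ℝ) ^ (1 - P.γ) * n l := by
                rw [← Finset.sum_filter, Finset.mul_sum]
                exact Finset.sum_congr rfl fun l _ => by rw [hf]; ring
            _ ≤ P.zs * P.decay * ε ^ (-P.γ) * (M * ε ^ P.γ) := by gcongr
            _ = P.zs * P.decay * M * (ε ^ (-P.γ) * ε ^ P.γ) := by ring
            _ = _ := by rw [← Real.rpow_add h0]; simp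

variable (P) in
/-- The quasistationary estimate in rescaled form. -/
lemma exists_relEntropyOn_mic_le_resc :
    ∃ C : ℝ, 0 < C ∧ ∀ K x : ℝ, 0 < x → x < 1 / 2 → ∀ᶠ ε : ℝ in 𝓝[>] 0, ∀ ρ₀ n, P.IsState ρ₀ K ε n →
      relEntropyOn (micSizes x ε) n (P.ω (n 1))
        ≤ ENNReal.ofReal (C * ε ^ (P.γ + (1 - x) * (1 - P.α + P.γ))) *
          P.dissipationResc ε (micSizes x ε) n := by
  have hz := P.zs_pos
  obtain ⟨C, hC, hmain⟩ := P.exists_relEntropyOn_mic_le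
  refine ⟨C / P.zs, by positivity, fun K x hx hx2 => ?_⟩
  filter_upwards [hmain K x hx hx2, self_mem_nhdsWithin] with ε h1 h0 ρ₀ n h
  have hε : 0 < ε := h0
  refine (h1 ρ₀ n h).trans (le_of_eq ?_)
  unfold dissipationResc
  rw [← mul_assoc, ← ENNReal.ofReal_mul (by positivity)]
  congr 2
  have e : ε ^ (-(x * (1 - P.α + P.γ))) = ε ^ (P.γ + (1 - x) * (1 - P.α + P.γ)) *
      ε ^ (-(1 - P.α + 2 * P.γ)) := by
    rw [← Real.rpow_add hε]
    congr 1
    ring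
  rw [e]
  field_simp

variable (P) in
/-- The energy of small clusters is negligible. -/
lemma eventually_freeEnergyResc_mic_le (K : ℝ) {x C₀ r : ℝ} (hx : 0 < x) (hx2 : x < 1 / 2)
    (hC₀ : 0 < C₀) (hr : 0 < r) :
    ∀ᶠ ε : ℝ in 𝓝[>] 0, ∀ ρ₀ n, P.IsState ρ₀ K ε n →
      P.dissipationResc ε (Set.Ici 1) n ≠ ⊤ →
      |n 1 - P.zs| ≤ C₀ * ε ^ P.γ * (1 + (P.dissipationResc ε (Set.Ici 1) n).toReal) →
      P.freeEnergyResc ε (micSizes x ε) n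
        ≤ ENNReal.ofReal (r * (1 + (P.dissipationResc ε (Set.Ici 1) n).toReal)) := by
  have hz := P.zs_pos
  have hγ := P.γ_pos
  have hα1 := P.α_lt_one
  have hβ : 0 < (1 - x) * (1 - P.α + P.γ) := mul_pos (by linarith) (by linarith)
  obtain ⟨C₁, hC₁, h₁⟩ := P.exists_relEntropyOn_mic_le_resc
  obtain ⟨C₂, hC₂, h₂⟩ := P.exists_abs_sum_mic_mass_le
  filter_upwards [eventually_mem_Ioc, h₁ K x hx hx2,
    P.eventually_abs_sub_zs_le K hx hx2 (by positivity : 0 < P.zs / 2),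
    eventually_mul_rpow_le hβ (P.zs * C₁) (by positivity : 0 < r / 3),
    eventually_mul_rpow_le (mul_pos hγ (by linarith : 0 < 1 - x)) (2 * C₀ * (C₂ * (|K| + 1)))
      (by positivity : 0 < r / 3),
    eventually_mul_rpow_le (mul_pos hx hγ) (2 * C₀ * (C₂ * (|K| + 1))) (by positivity : 0 < r / 3)]
    with ε ⟨h0, h1⟩ hent hn1 hs1 hs2 hs3 ρ₀ n h hD hn1D
  set D := (P.dissipationResc ε (Set.Ici 1) n).toReal with hDdef
  have hD0 : 0 ≤ D := ENNReal.toReal_nonneg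
  have h3 : |n 1 - P.zs| ≤ P.zs / 2 := by
    refine (hn1 ρ₀ n h).trans (mul_le_of_le_one_right (by positivity) ?_)
    exact Real.rpow_le_one h0.le h1 (by positivity)
  have hn1pos : P.zs / 2 ≤ n 1 := by linarith [(abs_le.1 h3).1]
  have hlog : |Real.log (n 1 / P.zs)| ≤ 2 / P.zs * (C₀ * ε ^ P.γ * (1 + D)) := by
    refine (abs_log_le ?_).trans ?_
    · rw [div_le_div_iff₀ (by norm_num) hz]
      linarith
    · have e : n 1 / P.zs - 1 = (n 1 - P.zs) / P.zs := by field_simp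
      rw [e, abs_div, abs_of_pos hz]
      calc 2 * (|n 1 - P.zs| / P.zs) = 2 / P.zs * |n 1 - P.zs| := by ring
        _ ≤ _ := by gcongr
  have hmass := h₂ K x hx ε h0 h1 ρ₀ n h
  -- After division by `ε^γ` the entropy relative to `ω(n_1)` keeps the factor `ε^{(1-x)(1-α+γ)}`.
  -- In the correction, `log(n_1/z_s) = O(ε^γ (1 + D))` compensates `ε^{-γ}`, and the mass deviation
  -- still tends to zero.
  have hmic := h.freeEnergyOn_mic_le (by linarith) (cutoff x ε)
  have hDmic : P.dissipationResc ε (micSizes x ε) n ≤ ENNReal.ofReal D := by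
    rw [hDdef, ENNReal.ofReal_toReal hD]
    unfold dissipationResc dissipationOn
    refine mul_le_mul_right ?_ _
    exact ENNReal.tsum_mono_subtype
      (fun l => dissipationTerm (P.a l * n 1 * n l) (P.b (l + 1) * n (l + 1))) fun l hl => hl.1
  have hent' : relEntropyOn (micSizes x ε) n (P.ω (n 1))
      ≤ ENNReal.ofReal (C₁ * ε ^ (P.γ + (1 - x) * (1 - P.α + P.γ)) * D) := by
    refine (hent ρ₀ n h).trans ((mul_le_mul_right hDmic _).trans (le_of_eq ?_))
    rw [← ENNReal.ofReal_mul (by positivity)]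
  have e1 : ε ^ (-P.γ) * ε ^ P.γ = 1 := by rw [← Real.rpow_add h0]; simp
  have e2 : ε ^ (-P.γ) * ε ^ (P.γ + (1 - x) * (1 - P.α + P.γ)) = ε ^ ((1 - x) * (1 - P.α + P.γ)) := by
    rw [← Real.rpow_add h0]
    congr 1
    ring
  unfold freeEnergyResc
  refine (mul_le_mul_right (hmic.trans (add_le_add hent' (ENNReal.ofReal_le_ofReal
    (mul_le_mul hlog hmass (abs_nonneg _) (by positivity))))) _).trans ?_
  rw [← ENNReal.ofReal_add (by positivity) (by positivity), ← ENNReal.ofReal_mul (by positivity)]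
  refine ENNReal.ofReal_le_ofReal ?_
  calc _ = P.zs * C₁ * (ε ^ (-P.γ) * ε ^ (P.γ + (1 - x) * (1 - P.α + P.γ))) * D
        + (ε ^ (-P.γ) * ε ^ P.γ) * (2 * C₀ * (C₂ * (|K| + 1)) * ε ^ (P.γ * (1 - x))
          + 2 * C₀ * (C₂ * (|K| + 1)) * ε ^ (x * P.γ)) * (1 + D) := by
        field_simp
    _ ≤ r / 3 * D + 1 * (r / 3 + r / 3) * (1 + D) := by
        rw [e1, e2]
        gcongr
    _ ≤ _ := by nlinarith

end Rates

/-! ### Convergence of the energies for almost every time -/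

/-- The integrals are summable, so the series of functions is finite almost everywhere and its terms
tend to zero. -/
lemma ae_tendsto_zero_of_lintegral_le {Ω : Type*} [MeasurableSpace Ω] {ν : Measure Ω}
    {f : ℕ → Ω → ℝ≥0∞} (hf : ∀ k, AEMeasurable (f k) ν) {C : ℝ≥0∞} (hC : C ≠ ⊤)
    (h : ∀ k, ∫⁻ t, f k t ∂ν ≤ C * (1 / 2) ^ k) :
    ∀ᵐ t ∂ν, Tendsto (fun k => f k t) atTop (𝓝 0) := by
  have h1 : ∫⁻ t, ∑' k, f k t ∂ν ≠ ⊤ := by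
    rw [lintegral_tsum hf]
    refine ne_top_of_le_ne_top ?_ (ENNReal.tsum_le_tsum h)
    rw [ENNReal.tsum_mul_left, ENNReal.tsum_geometric, one_div, ENNReal.one_sub_inv_two, inv_inv]
    exact ENNReal.mul_ne_top hC (by simp)
  filter_upwards [ae_lt_top' (AEMeasurable.tsum hf) h1] with t ht
  exact ENNReal.tendsto_atTop_zero_of_tsum_ne_top ht.ne

lemma measurable_dissipationTerm : Measurable fun p : ℝ × ℝ => dissipationTerm p.1 p.2 := by
  unfold dissipationTerm
  refine Measurable.ite (measurableSet_eq_fun measurable_fst measurable_snd) measurable_const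
    (Measurable.ite ?_ measurable_const ?_)
  · exact (measurableSet_eq_fun measurable_fst measurable_const).union
      (measurableSet_eq_fun measurable_snd measurable_const)
  · exact ((measurable_fst.sub measurable_snd).mul
      (measurable_fst.log.sub measurable_snd.log)).ennreal_ofReal

namespace Rates

variable {P : Rates} {ρ₀ K T ε A x : ℝ}

lemma IsRescaledCurve.aemeasurable {n φ : ℝ → ℕ → ℝ} (h : P.IsRescaledCurve ρ₀ K T ε n φ)
    (hT : 0 < T) {l : ℕ} (hl : 1 ≤ l) :
    AEMeasurable (fun t => n t l) (volume.restrict (Set.Icc 0 T)) := by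
  have h1 := (h.absCont l hl).continuousOn
  rw [Set.uIcc_of_le hT.le] at h1
  exact h1.aemeasurable measurableSet_Icc

lemma IsRescaledCurve.aemeasurable_dissipationResc {n φ : ℝ → ℕ → ℝ}
    (h : P.IsRescaledCurve ρ₀ K T ε n φ) (hT : 0 < T) :
    AEMeasurable (fun t => P.dissipationResc ε (Set.Ici 1) (n t))
      (volume.restrict (Set.Icc 0 T)) := by
  unfold dissipationResc dissipationOn
  refine AEMeasurable.const_mul (AEMeasurable.tsum fun l => ?_) _
  have hl : 1 ≤ (l : ℕ) := l.2
  exact measurable_dissipationTerm.comp_aemeasurable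
    ((((h.aemeasurable hT le_rfl).const_mul _).mul (h.aemeasurable hT hl)).prodMk
      ((h.aemeasurable hT (by omega : 1 ≤ (l : ℕ) + 1)).const_mul _))

lemma IsRescaledCurve.aemeasurable_energyAt {n φ : ℝ → ℕ → ℝ}
    (h : P.IsRescaledCurve ρ₀ K T ε n φ) (hT : 0 < T) {δ : ℝ} (hδ : 0 < δ) :
    AEMeasurable (fun t => P.energyAt ρ₀ δ (massMeasure ρ₀ ε (n t)))
      (volume.restrict (Set.Icc 0 T)) := by
  unfold energyAt
  refine ((AEMeasurable.const_mul ?_ _).const_mul _)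
  have e : (fun t => ∫ y, energyCut P.γ δ y ∂(massMeasure ρ₀ ε (n t)))
      = fun t => (∑' l : ℕ, ENNReal.ofReal (l * n t l / ρ₀)
          * ENNReal.ofReal (energyCut P.γ δ (ε * l))).toReal := by
    funext t
    rw [integral_eq_lintegral_of_nonneg_ae (Eventually.of_forall fun y => energyCut_nonneg hδ y)
      (continuous_energyCut hδ).aestronglyMeasurable, lintegral_massMeasure]
  rw [e]
  refine (AEMeasurable.tsum fun l => ?_).ennreal_toReal
  rcases Nat.eq_zero_or_pos l with rfl | hl
  · simp
  · exact ((((h.aemeasurable hT hl).const_mul _).div_const _).ennreal_ofReal).mul_const _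

variable {e : ℕ → ℝ} {n φ : ℕ → ℝ → ℕ → ℝ}

/-- Persistence of macroscopic clusters forces the monomer density to be close to `z_s`. -/
lemma IsBoundedSeq.exists_abs_sub_zs_le (h : P.IsBoundedSeq ρ₀ K T A x e n φ) (hT : 0 < T)
    (hρ : 0 < ρ₀) (hρs : P.criticalMass < ρ₀) (hx : 0 < x) (hx1 : x < 1) :
    ∃ C : ℝ, 0 < C ∧ ∀ᶠ j in atTop, ∀ t ∈ Set.Icc 0 T,
      P.dissipationResc (e j) (Set.Ici 1) (n j t) ≠ ⊤ →
      |n j t 1 - P.zs| ≤ C * e j ^ P.γ *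
        (1 + (P.dissipationResc (e j) (Set.Ici 1) (n j t)).toReal) := by
  set d := ρ₀ - P.criticalMass with hd
  have hd0 : 0 < d := by rw [hd]; linarith
  obtain ⟨C₁, hC₁, h₁⟩ := P.exists_abs_integral_trap_sub_le K hx hx1
  -- The test function at scale `δ` sees at most mass `ϱ_s + d/2`, and the tail beyond `R` takes at
  -- most `d/4`. At least `d/4` of the excess `d` therefore remains in the window.
  obtain ⟨δ, hδC, hδ0⟩ := ((eventually_mul_rpow_le P.γ_pos C₁ (by positivity : 0 < d / 4)).and
    self_mem_nhdsWithin).exists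
  have hδ : 0 < δ := hδ0
  obtain ⟨R, hR1, hRδ, hR⟩ := h.exists_tail hT hρ hx hx1 δ (by positivity : 0 < d / (4 * ρ₀))
  obtain ⟨C, hC, hmain⟩ := P.exists_abs_sub_zs_le hδ (by linarith : δ ≤ 2 * R)
    (by positivity : 0 < d / 4) hρ
  refine ⟨C, hC, ?_⟩
  filter_upwards [h.tendsto_nhdsGT.eventually (h₁ δ hδ (d / 4) (by positivity))] with j hj t ht hD
  have hs := (h.curve j).state t ht
  obtain ⟨S, hS, hSm⟩ := hs.exists_sum_mass_ge hρ (h.pos j) hδ hRδ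
  refine hmain K (e j) (n j t) (h.pos j) (h.le_one j) hs (h.monomer_le j t ht) hD S hS
    (le_trans ?_ hSm)
  have h2 := hj ρ₀ hρ _ hs
  have h3 := mul_le_mul_of_nonneg_left (hR j t ht) hρ.le
  have e1 : ρ₀ * (d / (4 * ρ₀)) = d / 4 := by field_simp
  rw [e1] at h3
  have h4 := (abs_le.1 h2).2
  rw [mul_sub]
  linarith

/-- The energies of small and large clusters converge along a subsequence for almost every time. -/
lemma IsBoundedSeq.exists_subseq_ae_tendsto (h : P.IsBoundedSeq ρ₀ K T A x e n φ) (hT : 0 < T)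
    (hρ : 0 < ρ₀) (hρs : P.criticalMass < ρ₀) (hx : 0 < x) (hx2 : x < 1 / 2)
    (μ : ℝ → ProbabilityMeasure ℝ)
    (hconv : ∀ t ∈ Set.Icc 0 T, ∀ f : ℝ → ℝ, Continuous f → ∀ C : ℝ, (∀ y, |f y| ≤ C) →
      Tendsto (fun j => ∫ y, f y ∂(massMeasure ρ₀ (e j) (n j t))) atTop
        (𝓝 (∫ y, f y ∂(μ t : Measure ℝ)))) :
    ∃ τ : ℕ → ℕ, StrictMono τ ∧ ∀ᵐ t ∂(volume.restrict (Set.Icc 0 T)),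
      Tendsto (fun k => P.freeEnergyResc (e (τ k)) (micSizes x (e (τ k))) (n (τ k) t)) atTop (𝓝 0) ∧
      Tendsto (fun k => P.freeEnergyResc (e (τ k)) (macSizes x (e (τ k))) (n (τ k) t)) atTop
        (𝓝 (P.macEnergy (macLimit ρ₀ (μ t : Measure ℝ)))) := by
  have hγ := P.γ_pos
  have hγ1 := P.γ_lt_one
  have hz := P.zs_pos
  have hd := P.decay_pos
  have hc := P.energyCoeff_pos
  have hx1 : x < 1 := by linarith
  set r : ℕ → ℝ := fun k => (1 / 2) ^ k with hr
  have hr0 : ∀ k, 0 < r k := fun k => by rw [hr]; positivity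
  have hr1 : ∀ k, r k ≤ 1 := fun k => by rw [hr]; exact pow_le_one₀ (by norm_num) (by norm_num)
  have hrlim : Tendsto r atTop (𝓝 0) := tendsto_pow_atTop_nhds_zero_of_lt_one (by norm_num) (by norm_num)
  have hranti : Antitone r := pow_right_anti₀ (by norm_num) (by norm_num)
  -- Chosen so that `(2 d k)^{γ/2} = r k`: the estimate for small macroscopic sizes at scale `2 d k`
  -- then has the factor `r k`.
  set d : ℕ → ℝ := fun k => r k ^ (2 / P.γ) / 2 with hdd
  have hd0 : ∀ k, 0 < d k := fun k => by have := hr0 k; rw [hdd]; positivity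
  have hda : Antitone d := fun i j hij => by
    have := hranti hij
    have := (hr0 j).le
    rw [hdd]
    beta_reduce
    gcongr
  have hdl : Tendsto d atTop (𝓝 0) := by
    have h1 := (hrlim.rpow_const (Or.inr (by positivity : 0 ≤ 2 / P.γ))).div_const 2
    rwa [Real.zero_rpow (by positivity), zero_div] at h1
  have hd2 : ∀ k, (2 * d k) ^ (P.γ / 2) = r k := fun k => by
    have e1 : 2 * d k = r k ^ (2 / P.γ) := by rw [hdd]; ring
    rw [e1, ← Real.rpow_mul (hr0 k).le, show 2 / P.γ * (P.γ / 2) = 1 by field_simp, Real.rpow_one]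
  have hd1 : ∀ k, 2 * d k ≤ 1 := fun k => by
    have e1 : 2 * d k = r k ^ (2 / P.γ) := by rw [hdd]; ring
    rw [e1]
    exact Real.rpow_le_one (hr0 k).le (hr1 k) (by positivity)
  have hprob : ∀ j, ∀ t ∈ Set.Icc 0 T, IsProbabilityMeasure (massMeasure ρ₀ (e j) (n j t)) :=
    fun j t ht => ((h.curve j).state t ht).isProbabilityMeasure_massMeasure hρ
  set D : ℕ → ℝ → ℝ≥0∞ := fun j t => P.dissipationResc (e j) (Set.Ici 1) (n j t) with hDdef
  set X : ℕ → ℕ → ℝ → ℝ := fun k j t => P.energyAt ρ₀ (d k) (massMeasure ρ₀ (e j) (n j t)) with hX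
  set Y : ℕ → ℝ → ℝ := fun k t => P.energyAt ρ₀ (d k) (μ t : Measure ℝ) with hY
  have hXY : ∀ k, ∀ t ∈ Set.Icc 0 T, Tendsto (fun j => X k j t) atTop (𝓝 (Y k t)) := by
    intro k t ht
    exact ((hconv t ht _ (continuous_energyCut (hd0 k)) _ (abs_energyCut_le hγ (hd0 k))).const_mul
      _).const_mul _
  have hXm : ∀ k j, AEMeasurable (X k j) (volume.restrict (Set.Icc 0 T)) := fun k j =>
    (h.curve j).aemeasurable_energyAt hT (hd0 k)
  have hYm : ∀ k, AEMeasurable (Y k) (volume.restrict (Set.Icc 0 T)) := fun k =>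
    aemeasurable_of_tendsto_metrizable_ae atTop (hXm k)
      (ae_restrict_of_forall_mem measurableSet_Icc fun t ht => hXY k t ht)
  have hDm : ∀ j, AEMeasurable (D j) (volume.restrict (Set.Icc 0 T)) := fun j =>
    (h.curve j).aemeasurable_dissipationResc hT
  have hZm : ∀ k j, AEMeasurable (fun t => ENNReal.ofReal |X k j t - Y k t|)
      (volume.restrict (Set.Icc 0 T)) := fun k j =>
    (((hXm k j).sub (hYm k)).norm).ennreal_ofReal
  -- Truncated energies are bounded for fixed `k`, so they converge in `L¹` in time. This permits a
  -- diagonal index that does not depend on `t`.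
  have hdom : ∀ k, Tendsto (fun j => ∫⁻ t in Set.Icc 0 T, ENNReal.ofReal |X k j t - Y k t|) atTop
      (𝓝 0) := by
    intro k
    have h1 := tendsto_lintegral_of_dominated_convergence' (μ := volume.restrict (Set.Icc 0 T))
      (F := fun j t => ENNReal.ofReal |X k j t - Y k t|) (f := fun _ => 0)
      (fun _ => ENNReal.ofReal (P.q / (1 - P.γ) * (ρ₀ * d k ^ (-P.γ)))) (hZm k)
      (fun j => ae_restrict_of_forall_mem measurableSet_Icc fun t ht => by
        have := hprob j t ht
        refine ENNReal.ofReal_le_ofReal (abs_sub_le_of_nonneg_of_le ?_ ?_ ?_ ?_)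
        · exact P.energyAt_nonneg hρ (hd0 k) _
        · exact P.energyAt_le hρ (hd0 k) _
        · exact P.energyAt_nonneg hρ (hd0 k) _
        · exact P.energyAt_le hρ (hd0 k) _)
      (by
        rw [lintegral_const]
        exact ENNReal.mul_ne_top ENNReal.ofReal_ne_top (measure_ne_top _ _))
      (ae_restrict_of_forall_mem measurableSet_Icc fun t ht => by
        have h2 := ((hXY k t ht).sub_const (Y k t)).abs
        rw [sub_self, abs_zero] at h2
        simpa using ENNReal.tendsto_ofReal h2)
    simpa using h1
  obtain ⟨C₀, hC₀, hmono⟩ := h.exists_abs_sub_zs_le hT hρ hρs hx hx1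
  obtain ⟨C₁, hC₁, hsmall⟩ := P.exists_sum_rpow_mul_le_dissipation K hx hC₀
  have hεlim := h.tendsto_nhdsGT
  have hgood : ∀ k, ∀ᶠ j in atTop,
      (∫⁻ t in Set.Icc 0 T, ENNReal.ofReal |X k j t - Y k t| ≤ 1 * (1 / 2) ^ k) ∧
      ∀ t ∈ Set.Icc 0 T, D j t ≠ ⊤ →
        P.freeEnergyResc (e j) (micSizes x (e j)) (n j t)
          ≤ ENNReal.ofReal (r k * (1 + (D j t).toReal)) ∧
        ENNReal.ofReal (X k j t) ≤ P.macEnergy (macMeasure x (e j) (n j t)) ∧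
        P.macEnergy (macMeasure x (e j) (n j t)) ≤ ENNReal.ofReal (X k j t)
          + ENNReal.ofReal (P.zs * P.decay * (C₁ * (r k * (2 + (D j t).toReal)))) ∧
        P.freeEnergyResc (e j) (macSizes x (e j)) (n j t)
          ≤ ENNReal.ofReal (1 + r (k + 1)) * P.macEnergy (macMeasure x (e j) (n j t))
            + ENNReal.ofReal (r (k + 1)) ∧
        ENNReal.ofReal (1 - r (k + 1)) * P.macEnergy (macMeasure x (e j) (n j t))
          ≤ P.freeEnergyResc (e j) (macSizes x (e j)) (n j t) + ENNReal.ofReal (r (k + 1)) := by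
    intro k
    -- The lower bound for the large clusters requires a parameter below `1`, while `r 0 = 1`; hence
    -- the shifted index.
    have hrk : r (k + 1) < 1 := by
      rw [hr]
      exact pow_lt_one₀ (by norm_num) (by norm_num) (by omega)
    filter_upwards [(hdom k).eventually (ge_mem_nhds (by
        rw [one_mul]
        exact ENNReal.pow_pos (by simp) k : (0 : ℝ≥0∞) < 1 * (1 / 2) ^ k)), hmono,
      hεlim.eventually (P.eventually_freeEnergyResc_mic_le K hx hx2 hC₀ (hr0 k)),
      hεlim.eventually (eventually_mul_cutoff_le hx1 (hd0 k)),
      hεlim.eventually ((tendsto_cutoff hx).eventually (eventually_ge_atTop 3)),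
      hεlim.eventually (eventually_mul_rpow_le (mul_pos hx (sub_pos.2 hγ1)) 1 (hr0 k)),
      hεlim.eventually (P.eventually_freeEnergyResc_mac_le K hx (hr0 (k + 1))),
      hεlim.eventually (P.eventually_le_freeEnergyResc_mac K hx (hr0 (k + 1)) hrk)]
      with j g1 g2 g3 g4 g5 g6 g7 g8
    refine ⟨g1, fun t ht hD => ?_⟩
    have hs := (h.curve j).state t ht
    have h2 := g2 t ht hD
    refine ⟨g3 ρ₀ _ hs hD h2, hs.energyAt_le_macEnergy hρ (h.pos j) (h.le_one j) hx (hd0 k) g4,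
      hs.macEnergy_le_energyAt_add hρ (h.pos j) (h.le_one j) hx (hd0 k) fun S hS => ?_,
      g7 ρ₀ _ hs, g8 ρ₀ _ hs⟩
    refine (hsmall ρ₀ (e j) _ (h.pos j) (h.le_one j) g5 hs (h.monomer_le j t ht) hD h2 (2 * d k)
      (by have := hd0 k; positivity) (hd1 k) S hS).trans ?_
    rw [hd2 k]
    rw [one_mul] at g6
    have hε := h.pos j
    have hpos : 0 ≤ C₁ * e j ^ P.γ := by positivity
    calc _ ≤ C₁ * e j ^ P.γ * ((1 + (D j t).toReal) * r k + r k) := by gcongr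
      _ = _ := by ring
  obtain ⟨τ, hτ, hτg⟩ := extraction_forall_of_eventually hgood
  refine ⟨τ, hτ, ?_⟩
  have hDfin : ∀ᵐ t ∂(volume.restrict (Set.Icc 0 T)), ∀ j, D j t ≠ ⊤ :=
    ae_all_iff.2 fun j => by
      filter_upwards [ae_lt_top' (hDm j) (h.curve j).finite_dissipation.ne] with t ht using ht.ne
  have hXae := ae_tendsto_zero_of_lintegral_le (fun k => hZm k (τ k)) ENNReal.one_ne_top
    fun k => (hτg k).1
  -- The dissipation is bounded only in `L¹` in time. The geometric weights make its error
  -- contributions vanish almost everywhere along the diagonal sequence.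
  have hDae := ae_tendsto_zero_of_lintegral_le (ν := volume.restrict (Set.Icc 0 T))
    (f := fun k t => (1 / 2) ^ k * D (τ k) t) (fun k => (hDm (τ k)).const_mul _)
    (C := ENNReal.ofReal A) ENNReal.ofReal_ne_top fun k => by
      rw [lintegral_const_mul' _ _ (ENNReal.pow_ne_top (by simp)), mul_comm]
      refine mul_le_mul_left ?_ _
      rw [← ENNReal.ofReal_toReal (h.curve (τ k)).finite_dissipation.ne]
      exact ENNReal.ofReal_le_ofReal (h.dissipation_le (τ k))
  filter_upwards [hDfin, hXae, hDae, ae_restrict_mem measurableSet_Icc] with t hfin hXt hDt ht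
  have hg := fun k => (hτg k).2 t ht (hfin (τ k))
  have hrD : Tendsto (fun k => r k * (D (τ k) t).toReal) atTop (𝓝 0) := by
    have h1 := (ENNReal.tendsto_toReal ENNReal.zero_ne_top).comp hDt
    rw [ENNReal.toReal_zero] at h1
    refine h1.congr fun k => ?_
    simp [hr]
  have hr2 : Tendsto (fun k => r (k + 1)) atTop (𝓝 0) := hrlim.comp (tendsto_add_atTop_nat 1)
  have hXt' : Tendsto (fun k => X k (τ k) t - Y k t) atTop (𝓝 0) := by
    have h1 := (ENNReal.tendsto_toReal ENNReal.zero_ne_top).comp hXt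
    rw [ENNReal.toReal_zero] at h1
    refine (tendsto_zero_iff_abs_tendsto_zero _).2 (h1.congr fun k => ?_)
    simp
  have hYt := P.tendsto_ofReal_energyAt hρ (μ t : Measure ℝ) hd0 hda hdl
  set E := P.macEnergy (macLimit ρ₀ (μ t : Measure ℝ)) with hE
  -- The squeeze with truncated subtraction in `ℝ≥0∞` does not require `E` to be finite.
  have hXE : Tendsto (fun k => ENNReal.ofReal (X k (τ k) t)) atTop (𝓝 E) := by
    have hlow : Tendsto (fun k => ENNReal.ofReal (Y k t) - ENNReal.ofReal |X k (τ k) t - Y k t|)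
        atTop (𝓝 (E - 0)) := ENNReal.Tendsto.sub hYt hXt (Or.inr ENNReal.zero_ne_top)
    have hup : Tendsto (fun k => ENNReal.ofReal (Y k t) + ENNReal.ofReal |X k (τ k) t - Y k t|)
        atTop (𝓝 (E + 0)) := hYt.add hXt
    rw [tsub_zero] at hlow
    rw [add_zero] at hup
    refine tendsto_of_tendsto_of_tendsto_of_le_of_le hlow hup (fun k => ?_) fun k => ?_
    · rw [← ENNReal.ofReal_sub _ (abs_nonneg _)]
      refine ENNReal.ofReal_le_ofReal ?_
      linarith [neg_abs_le (X k (τ k) t - Y k t)]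
    · rw [← ENNReal.ofReal_add (P.energyAt_nonneg hρ (hd0 k) _) (abs_nonneg _)]
      refine ENNReal.ofReal_le_ofReal ?_
      linarith [le_abs_self (X k (τ k) t - Y k t)]
  have hMac : Tendsto (fun k => P.macEnergy (macMeasure x (e (τ k)) (n (τ k) t))) atTop (𝓝 E) := by
    have h1 : Tendsto (fun k => P.zs * P.decay * (C₁ * (r k * (2 + (D (τ k) t).toReal)))) atTop
        (𝓝 0) := by
      have h2 : Tendsto (fun k => P.zs * P.decay * (C₁ * (r k * 2 + r k * (D (τ k) t).toReal)))
          atTop (𝓝 (P.zs * P.decay * (C₁ * (0 * 2 + 0)))) :=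
        (((hrlim.mul_const 2).add hrD).const_mul C₁).const_mul _
      rw [zero_mul, add_zero, mul_zero, mul_zero] at h2
      exact h2.congr fun k => by ring
    have hup := hXE.add (ENNReal.tendsto_ofReal h1)
    rw [ENNReal.ofReal_zero, add_zero] at hup
    exact tendsto_of_tendsto_of_tendsto_of_le_of_le hXE hup (fun k => (hg k).2.1)
      fun k => (hg k).2.2.1
  constructor
  · have h1 : Tendsto (fun k => r k * (1 + (D (τ k) t).toReal)) atTop (𝓝 0) := by
      have h2 := hrlim.add hrD
      rw [add_zero] at h2
      exact h2.congr fun k => by ring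
    have hup := ENNReal.tendsto_ofReal h1
    rw [ENNReal.ofReal_zero] at hup
    exact tendsto_of_tendsto_of_tendsto_of_le_of_le tendsto_const_nhds hup (fun _ => zero_le)
      fun k => (hg k).1
  · have hup : Tendsto (fun k => ENNReal.ofReal (1 + r (k + 1)) *
        P.macEnergy (macMeasure x (e (τ k)) (n (τ k) t)) + ENNReal.ofReal (r (k + 1))) atTop
        (𝓝 (ENNReal.ofReal (1 + 0) * E + ENNReal.ofReal 0)) :=
      (ENNReal.Tendsto.mul (ENNReal.tendsto_ofReal (hr2.const_add 1)) (Or.inl (by simp)) hMac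
        (Or.inr ENNReal.ofReal_ne_top)).add (ENNReal.tendsto_ofReal hr2)
    have hlow : Tendsto (fun k => ENNReal.ofReal (1 - r (k + 1)) *
        P.macEnergy (macMeasure x (e (τ k)) (n (τ k) t)) - ENNReal.ofReal (r (k + 1))) atTop
        (𝓝 (ENNReal.ofReal (1 - 0) * E - ENNReal.ofReal 0)) :=
      ENNReal.Tendsto.sub (ENNReal.Tendsto.mul (ENNReal.tendsto_ofReal (hr2.const_sub 1))
        (Or.inl (by simp)) hMac (Or.inr ENNReal.ofReal_ne_top)) (ENNReal.tendsto_ofReal hr2)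
        (Or.inr ENNReal.ofReal_ne_top)
    simp only [add_zero, sub_zero, ENNReal.ofReal_one, one_mul, ENNReal.ofReal_zero,
      tsub_zero] at hup hlow
    exact tendsto_of_tendsto_of_tendsto_of_le_of_le hlow hup
      (fun k => tsub_le_iff_right.2 (hg k).2.2.2.2) fun k => (hg k).2.2.2.1

end Rates

end BeckerDoring

end

/-! ### Assembly of the two assertions -/

theorem theorem2p5 (P : BeckerDoring.Rates) :
    ∃ C : ℝ, 0 < C ∧ ∀ ρ₀ x K : ℝ, P.criticalMass < ρ₀ → 0 < x → x < 1 / 2 →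
      ∃ ε₀ : ℝ, 0 < ε₀ ∧
      ∀ (T B : ℝ) (S : Set ℝ) (n φ : ℝ → ℝ → ℕ → ℝ), 0 < T → S ⊆ Set.Ioc 0 1 →
        (∀ ε ∈ S, P.IsRescaledCurve ρ₀ K T ε (n ε) (φ ε)) →
        (∀ ε ∈ S, P.gradFunctional T ε (n ε) (φ ε) ≤ B) →
        (∀ δ : ℝ, 0 < δ → ∃ R₀ : ℝ, ∀ R, R₀ ≤ R → ∀ ε ∈ S,
          ∫⁻ y in Set.Ioi R, ENNReal.ofReal y ∂(BeckerDoring.macMeasure x ε (n ε 0))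
            ≤ ENNReal.ofReal δ) →
        (∀ ε ∈ S, ε < ε₀ →
          ∫⁻ t in Set.Icc 0 T, BeckerDoring.relEntropyOn (BeckerDoring.micSizes x ε)
              (n ε t) (P.ω (n ε t 1))
            ≤ ENNReal.ofReal (C * ε ^ (P.γ + (1 - x) * (1 - P.α + P.γ))) *
              ∫⁻ t in Set.Icc 0 T, P.dissipationResc ε (BeckerDoring.micSizes x ε) (n ε t)) ∧
        (∀ e : ℕ → ℝ, (∀ j, e j ∈ S) → Tendsto e atTop (𝓝 0) →
          ∃ (σ : ℕ → ℕ) (ν : ℝ → Measure ℝ), StrictMono σ ∧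
            (∀ t ∈ Set.Icc 0 T,
              BeckerDoring.IsMacroState (ρ₀ - P.criticalMass) (ν t) ∧
              BeckerDoring.WeakStarTendsto
                (fun j => BeckerDoring.macMeasure x (e (σ j)) (n (e (σ j)) t)) (ν t)) ∧
            ∀ᵐ t ∂(volume.restrict (Set.Ioo 0 T)),
              Tendsto (fun j => P.freeEnergyResc (e (σ j))
                (BeckerDoring.micSizes x (e (σ j))) (n (e (σ j)) t)) atTop (𝓝 0) ∧
              Tendsto (fun j => P.freeEnergyResc (e (σ j))
                (BeckerDoring.macSizes x (e (σ j))) (n (e (σ j)) t)) atTop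
                (𝓝 (P.macEnergy (ν t)))) := by

  have hz := P.zs_pos
  obtain ⟨C, hC, hmain⟩ := P.exists_relEntropyOn_mic_le_resc
  refine ⟨C, hC, fun ρ₀ x K hρs hx hx2 => ?_⟩
  have hx1 : x < 1 := by linarith
  have hρ : 0 < ρ₀ := by
    refine lt_of_le_of_lt (tsum_nonneg fun l => ?_) hρs
    exact mul_nonneg (Nat.cast_nonneg l) (P.ω_pos hz l).le
  -- The first assertion holds state by state, so `ε₀` does not depend on the curves or on `T`;
  -- integration in time is all that remains.
  obtain ⟨ε₀, hε₀, hsub⟩ := mem_nhdsGT_iff_exists_Ioo_subset.1 (hmain K x hx hx2)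
  refine ⟨ε₀, hε₀, fun T B S n φ hT hS hcurve hJ htail => ⟨fun ε hε hεlt => ?_, fun e he hlim => ?_⟩⟩
  · rw [← lintegral_const_mul' _ _ ENNReal.ofReal_ne_top]
    exact setLIntegral_mono' measurableSet_Icc fun t ht =>
      hsub ⟨(hS hε).1, hεlt⟩ ρ₀ _ ((hcurve ε hε).state t ht)
  · have hlim' : Tendsto e atTop (𝓝[>] 0) :=
      tendsto_nhdsWithin_iff.2 ⟨hlim, Eventually.of_forall fun j => (hS (he j)).1⟩
    -- Discarding the first `J` members ensures `n_1 ≤ 2 z_s` throughout; the shift reappears in the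
    -- final subsequence.
    obtain ⟨J, hJm⟩ := eventually_atTop.1
      (hlim'.eventually (P.eventually_abs_sub_zs_le K hx hx2 hz))
    have hseq : P.IsBoundedSeq ρ₀ K T (2 * (B + P.zs * |K|)) x (fun j => e (j + J))
        (fun j => n (e (j + J))) (fun j => φ (e (j + J))) :=
      { pos := fun j => (hS (he _)).1
        le_one := fun j => (hS (he _)).2
        tendsto := hlim.comp (tendsto_add_atTop_nat J)
        curve := fun j => hcurve _ (he _)
        action_le := fun j =>
          ((hcurve _ (he _)).integral_toReal_le hT (hS (he _)).1 (hJ _ (he _))).1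
        dissipation_le := fun j =>
          ((hcurve _ (he _)).integral_toReal_le hT (hS (he _)).1 (hJ _ (he _))).2
        monomer_le := fun j t ht => by
          have h1 := hJm (j + J) (by omega) ρ₀ _ ((hcurve _ (he _)).state t ht)
          have h2 : e (j + J) ^ (x * P.γ) ≤ 1 :=
            Real.rpow_le_one (hS (he _)).1.le (hS (he _)).2 (mul_pos hx P.γ_pos).le
          have h3 := (abs_le.1 h1).2
          nlinarith
        tail := fun δ hδ => by
          obtain ⟨R₀, hR₀⟩ := htail δ hδ
          exact ⟨R₀, fun R hR j => hR₀ R hR _ (he _)⟩ }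
    obtain ⟨σ, μ, hσ, hμ⟩ := hseq.exists_subseq_tendsto hT hρ hx hx1
    have hseq' := hseq.comp hσ
    obtain ⟨τ, hτ, hae⟩ := hseq'.exists_subseq_ae_tendsto hT hρ hρs hx hx2 μ hμ
    refine ⟨fun k => σ (τ k) + J, fun t => BeckerDoring.macLimit ρ₀ (μ t : Measure ℝ),
      fun i j hij => by simpa using hσ (hτ hij), fun t ht => ?_,
      ae_restrict_of_ae_restrict_of_subset Set.Ioo_subset_Icc_self hae⟩
    have hseqτ := hseq'.comp hτ
    have hstate := fun k => (hseqτ.curve k).state t ht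
    have hconv : ∀ f : ℝ → ℝ, Continuous f → ∀ M : ℝ, (∀ y, |f y| ≤ M) →
        Tendsto (fun k => ∫ y, f y ∂(BeckerDoring.massMeasure ρ₀ (e (σ (τ k) + J))
          (n (e (σ (τ k) + J)) t))) atTop (𝓝 (∫ y, f y ∂(μ t : Measure ℝ))) :=
      fun f hf M hM => (hμ t ht f hf M hM).comp hτ.tendsto_atTop
    exact ⟨BeckerDoring.Rates.isMacroState_macLimit hρ
        (BeckerDoring.Rates.mul_measureReal_Iic_eq hx hx1 hρ hseqτ.tendsto_nhdsGT hstate hconv),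
      BeckerDoring.Rates.weakStarTendsto_macLimit hx1 hρ hseqτ.tendsto_nhdsGT hstate hconv⟩
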